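/- Let $n\ge 1$, let $(\Omega,\nu)$ be a measure space and $X=(X_1,\dots,X_n):\Omega\to\mathbb R^n$ a measurable map. Let $M\subseteq\mathbb R^n$ be the interior of the set of all $\beta$ with $Z(\beta)=\int_\Omega \exp(-\sum_j\beta^jX_j)\,d\nu<\infty$, and put $\Phi=\log Z$, $g_{ij}=\partial_i\partial_j\Phi$, $t_{ijk}=\partial_i\partial_j\partial_k\Phi$ on $M$. Assume that $M$, with these data, is an information geometry Frobenius manifold: $M\neq\emptyset$, $g$ is positive definite on $M$, and the multiplication $\circ$ on tangent spaces defined by $g(u\circ v,w)=t(u,v,w)$ is associative (the WDVV equations). A Riemannian metric on $M$ is called a Koszul–Souriau metric if near every point there are local coordinates $\varphi=(\varphi^1,\dots,\varphi^n)$ in which its components are $\frac{\partial^2}{\partial\varphi^a\partial\varphi^b}\log\int_{\mathbb R^n}e^{-\langle\varphi,\xi\rangle}\,d\mu(\xi)$ for a measure $\mu$ on $\mathbb R^n$, with $\varphi$ taking its values in the interior of the domain of finiteness of this integral. A metric with contravariant components $h^{ij}$ and Christoffel symbols $\Gamma^j_{sk}$ (of the Levi-Civita connection) has contravariant Christoffel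 symbols $\Gamma^{ij}_k=-h^{is}\Gamma^j_{sk}$. Two smooth pseudo-Riemannian metrics $h_1,h_2$ on $M$ form a flat pencil if for all $a,c\in\mathbb R$ the combination $a h_1^{ij}+c h_2^{ij}$ is, wherever it is nondegenerate, a flat metric with contravariant Christoffel symbols $a\Gamma^{ij}_{1,k}+c\Gamma^{ij}_{2,k}$. A bracket of hydrodynamic type with smooth coefficients $(h^{ij},b^{ij}_k)$ on $M$, $$\{u^i(x),u^j(y)\}=h^{ij}(u(x))\,\delta'(x-y)+b^{ij}_k(u(x))\,u^k_x\,\delta(x-y),$$ is the bracket $\{F,G\}[u]=\int_0^1\frac{\delta F}{\delta u^i}\Big(h^{ij}(u)\frac{d}{dx}\frac{\delta G}{\delta u^j}+b^{ij}_k(u)u^k_x\frac{\delta G}{\delta u^j}\Big)dx$ of smooth functionals (with smooth variational derivative) on the space of smooth maps $u:\mathbb R/\mathbb Z\to M$. It is a Novikov–Poisson bracket if it is skew-symmetric and satisfies the Jacobi identity; two such brackets are compatible if every linear combination of them with constant real coefficients is again a Poisson bracket. Then: 1. There is a metric $g_2$ on $M$ such that $g$ and $g_2$ form a flat pencil of Koszul–Souriau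 metrics: $(g,g_2)$ is a flat pencil, and for all $a,c\ge 0$ with $a+c>0$ the metric with contravariant components $a g^{ij}+c g_2^{ij}$ is a Koszul–Souriau metric on $M$. The pencil can be chosen nontrivial, that is, such that $g$ and $g_2$ have different Levi-Civita connections. The brackets of hydrodynamic type $(g^{ij},\Gamma^{ij}_k)$ and $(g_2^{ij},\Gamma^{ij}_{2,k})$ are then compatible Novikov–Poisson brackets. 2. More generally, two brackets of hydrodynamic type on $M$ with smooth coefficients $(h_1^{ij},b^{ij}_{1,k})$, $(h_2^{ij},b^{ij}_{2,k})$ and $\det h_1\ne0$, $\det h_2\neq 0$ everywhere on $M$ are compatible if and only if $h_1,h_2$ form a flat pencil of metrics and $b_{1}$, $b_{2}$ are the contravariant Christoffel symbols of $h_1$, $h_2$. -/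

import Mathlib

open MeasureTheory Set Matrix
open scoped ContDiff

noncomputable section

/-- Points of a coordinate domain in `ℝⁿ`, and also component vectors of vectors and covectors. -/
abbrev Vec (n : ℕ) := Fin n → ℝ

/-- The partial derivative `∂f/∂xⁱ` at `x`. -/
def pd {n : ℕ} (i : Fin n) (f : Vec n → ℝ) (x : Vec n) : ℝ :=
  fderiv ℝ f x (Pi.single i 1)

/-! ### Koszul–Souriau metrics and the information geometry Frobenius manifold -/

section Information

variable {n : ℕ} {Ω : Type*} [MeasurableSpace Ω]

/-- The partition function `Z(β) = ∫ exp (- ∑ⱼ βʲ Xⱼ(w)) ν(dw)`. -/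
def partitionFn (ν : Measure Ω) (X : Ω → Vec n) (β : Vec n) : ℝ :=
  ∫ w, Real.exp (-∑ j, β j * X w j) ∂ν

/-- The parameter manifold of the exponential family: the interior of the set of those `β` for
which the partition function is finite. The `βʲ` are its affine coordinates. -/
def paramManifold (ν : Measure Ω) (X : Ω → Vec n) : Set (Vec n) :=
  interior {β | Integrable (fun w => Real.exp (-∑ j, β j * X w j)) ν}

/-- The potential `Φ(β) = log Z(β)`. -/
def ksPotential (ν : Measure Ω) (X : Ω → Vec n) (β : Vec n) : ℝ :=
  Real.log (partitionFn ν X β)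

/-- The Koszul–Souriau (Fisher) metric `g_{ij} = ∂ᵢ∂ⱼΦ` in the affine coordinates `β`. -/
def ksHessian (ν : Measure Ω) (X : Ω → Vec n) (β : Vec n) : Matrix (Fin n) (Fin n) ℝ :=
  Matrix.of fun i j => pd i (pd j (ksPotential ν X)) β

/-- The rank three tensor `t_{ijk} = ∂ᵢ∂ⱼ∂ₖΦ`. -/
def ksCubic (ν : Measure Ω) (X : Ω → Vec n) (i j k : Fin n) (β : Vec n) : ℝ :=
  pd i (pd j (pd k (ksPotential ν X))) β

/-- The multiplication `u ∘ v` on the tangent space at `β`, given by `g(u ∘ v, w) = t(u, v, w)`,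
that is `(u ∘ v)ᵉ = g^{ef} t_{fab} uᵃ vᵇ`. -/
def tangentMul (ν : Measure Ω) (X : Ω → Vec n) (β u v : Vec n) : Vec n :=
  fun e => ∑ f, ∑ a, ∑ b, (ksHessian ν X β)⁻¹ e f * ksCubic ν X f a b β * u a * v b

/-- The exponential family with base measure `ν` and observables `X` is an information geometry
Frobenius manifold: its Koszul–Souriau metric is a Riemannian metric, and the multiplication
defined by the metric and the third derivatives of the potential is associative (the WDVV
equations `Φ_{abe} g^{ef} Φ_{fcd} = Φ_{bce} g^{ef} Φ_{fad}`). -/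
structure IsInfoFrobenius (ν : Measure Ω) (X : Ω → Vec n) : Prop where
  measurable : Measurable X
  nonempty : (paramManifold ν X).Nonempty
  posDef : ∀ β ∈ paramManifold ν X, (ksHessian ν X β).PosDef
  assoc : ∀ β ∈ paramManifold ν X, ∀ u v w : Vec n,
    tangentMul ν X β (tangentMul ν X β u v) w = tangentMul ν X β u (tangentMul ν X β v w)

/-- A Riemannian metric `h` (lower indices) on `U ⊆ ℝⁿ` is a Koszul–Souriau metric if every point
of `U` has a neighbourhood `W` with local coordinates `φ = (φ¹, …, φⁿ)` in which the components
of `h` are `∂ₐ∂_b log ∫ exp (-⟨φ, ξ⟩) ν(dξ)` for a measure `ν` on `ℝⁿ`. (Measures on `ℝⁿ`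
are enough: the partition function of `(ν, X)` depends only on the image of `ν` under `X`.) -/
def IsKSMetric (U : Set (Vec n)) (h : Vec n → Matrix (Fin n) (Fin n) ℝ) : Prop :=
  ∀ x ∈ U, (h x).PosDef ∧
    ∃ (W : Set (Vec n)) (φ : Vec n → Vec n) (ν : Measure (Vec n)),
      IsOpen W ∧ x ∈ W ∧ W ⊆ U ∧ ContDiffOn ℝ ∞ φ W ∧ InjOn φ W ∧
      ∀ y ∈ W,
        (Matrix.of fun a i => pd i (fun z => φ z a) y).det ≠ 0 ∧
        φ y ∈ paramManifold ν (fun ξ : Vec n => ξ) ∧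
        ∀ i j, h y i j = ∑ a, ∑ b,
          pd i (fun z => φ z a) y * pd j (fun z => φ z b) y *
            ksHessian ν (fun ξ : Vec n => ξ) (φ y) a b

end Information

/-! ### Contravariant metrics and flat pencils

A metric is given by its contravariant components `g^{ij}`; the covariant components `g_{ij}`
are the inverse matrix. -/

section Pencils

variable {n : ℕ}

/-- The Christoffel symbol `Γⁱ_{jk}` of the Levi-Civita connection of the metric with
contravariant components `g`. -/
def christoffel (g : Vec n → Matrix (Fin n) (Fin n) ℝ) (i j k : Fin n) (x : Vec n) : ℝ :=
  (1 / 2 : ℝ) * ∑ l, g x i l *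
    (pd j (fun y => (g y)⁻¹ l k) x + pd k (fun y => (g y)⁻¹ l j) x
      - pd l (fun y => (g y)⁻¹ j k) x)

/-- The contravariant Christoffel symbol `Γ^{ij}_k = - g^{is} Γʲ_{sk}`. -/
def contraChristoffel (g : Vec n → Matrix (Fin n) (Fin n) ℝ) (i j k : Fin n) (x : Vec n) : ℝ :=
  -∑ s, g x i s * christoffel g j s k x

/-- The component `Rⁱ_{jkl}` of the Riemann curvature tensor. -/
def riemann (g : Vec n → Matrix (Fin n) (Fin n) ℝ) (i j k l : Fin n) (x : Vec n) : ℝ :=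
  pd k (christoffel g i l j) x - pd l (christoffel g i k j) x
    + ∑ m, (christoffel g i k m x * christoffel g m l j x
      - christoffel g i l m x * christoffel g m k j x)

/-- `g₁`, `g₂` form a flat pencil on `U`: they are smooth (pseudo-Riemannian) metrics, and
every linear combination `a g₁^{ij} + c g₂^{ij}`, wherever it is nondegenerate, is flat and has
the contravariant Christoffel symbols `a Γ₁^{ij}_k + c Γ₂^{ij}_k`. -/
structure IsFlatPencil (U : Set (Vec n)) (g₁ g₂ : Vec n → Matrix (Fin n) (Fin n) ℝ) : Prop where
  smooth₁ : ∀ i j, ContDiffOn ℝ ∞ (fun x => g₁ x i j) U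
  smooth₂ : ∀ i j, ContDiffOn ℝ ∞ (fun x => g₂ x i j) U
  symm₁ : ∀ x ∈ U, (g₁ x).IsSymm
  symm₂ : ∀ x ∈ U, (g₂ x).IsSymm
  nondeg₁ : ∀ x ∈ U, (g₁ x).det ≠ 0
  nondeg₂ : ∀ x ∈ U, (g₂ x).det ≠ 0
  flat : ∀ a c : ℝ, ∀ x ∈ U, (a • g₁ x + c • g₂ x).det ≠ 0 →
    ∀ i j k l, riemann (fun y => a • g₁ y + c • g₂ y) i j k l x = 0
  linear : ∀ a c : ℝ, ∀ x ∈ U, (a • g₁ x + c • g₂ x).det ≠ 0 →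
    ∀ i j k, contraChristoffel (fun y => a • g₁ y + c • g₂ y) i j k x
      = a * contraChristoffel g₁ i j k x + c * contraChristoffel g₂ i j k x

end Pencils

/-! ### The phase space of fields and its functionals

The phase space is the space of smooth maps `u` of the circle `ℝ / ℤ` to `U`. -/

section Functionals

variable {n : ℕ}

/-- `u` is a smooth `1`-periodic field with values in `U`. With `U = univ` these are also
the variations of a field, and the covector fields along it. -/
structure IsLoop (U : Set (Vec n)) (u : ℝ → Vec n) : Prop where
  smooth : ContDiff ℝ ∞ u
  periodic : Function.Periodic u 1
  mem : ∀ x, u x ∈ U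

/-- A family of fields that depends smoothly on finitely many parameters `s ∈ S`. -/
structure IsLoopFamily {k : ℕ} (U : Set (Vec n)) (S : Set (Fin k → ℝ))
    (γ : (Fin k → ℝ) → ℝ → Vec n) : Prop where
  smooth : ContDiffOn ℝ ∞ (fun q : (Fin k → ℝ) × ℝ => γ q.1 q.2) (S ×ˢ univ)
  periodic : ∀ s ∈ S, Function.Periodic (γ s) 1
  mem : ∀ s ∈ S, ∀ x, γ s x ∈ U

/-- A smooth functional `F` of the fields, with its variational derivative `grad u = δF/δu`.
Smoothness is tested on finite-dimensional families of fields. Examples are the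
functionals `F[u] = ∫ f(x, u, u', …, u⁽ᵐ⁾) dx` with `f` smooth and periodic in `x`. -/
structure SmoothFunctional (U : Set (Vec n)) where
  val : (ℝ → Vec n) → ℝ
  grad : (ℝ → Vec n) → ℝ → Vec n
  val_smooth : ∀ (k : ℕ) (S : Set (Fin k → ℝ)) (γ : (Fin k → ℝ) → ℝ → Vec n),
    IsOpen S → IsLoopFamily U S γ → ContDiffOn ℝ ∞ (fun s => val (γ s)) S
  grad_smooth : ∀ (k : ℕ) (S : Set (Fin k → ℝ)) (γ : (Fin k → ℝ) → ℝ → Vec n),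
    IsOpen S → IsLoopFamily U S γ → IsLoopFamily univ S (fun s => grad (γ s))
  hasDerivAt : ∀ u, IsLoop U u → ∀ v, IsLoop univ v →
    HasDerivAt (fun ε : ℝ => val (fun x => u x + ε • v x))
      (∫ x in (0 : ℝ)..1, ∑ i, grad u x i * v x i) 0

end Functionals

/-! ### Brackets of hydrodynamic type -/

/-- The coefficients of a bracket of hydrodynamic type
`{uⁱ(x), uʲ(y)} = g^{ij}(u(x)) δ'(x - y) + b^{ij}_k(u(x)) u^k_x δ(x - y)`. -/
structure HydroBracket (n : ℕ) where
  g : Vec n → Matrix (Fin n) (Fin n) ℝ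
  b : Fin n → Fin n → Fin n → Vec n → ℝ

namespace HydroBracket

variable {n : ℕ}

/-- The coefficients are smooth and the leading coefficient is nondegenerate on `U`. -/
structure IsRegular (U : Set (Vec n)) (P : HydroBracket n) : Prop where
  smooth_g : ∀ i j, ContDiffOn ℝ ∞ (fun x => P.g x i j) U
  smooth_b : ∀ i j k, ContDiffOn ℝ ∞ (P.b i j k) U
  nondeg : ∀ x ∈ U, (P.g x).det ≠ 0

/-- The operator `p ↦ (A p)ⁱ = g^{ij}(u) p_j' + b^{ij}_k(u) u^k_x p_j`; for `p = δH/δu` this is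
the Hamiltonian vector field of `H`. -/
def op (P : HydroBracket n) (u p : ℝ → Vec n) : ℝ → Vec n := fun x i =>
  ∑ j, P.g (u x) i j * deriv (fun y => p y j) x
    + ∑ j, ∑ k, P.b i j k (u x) * deriv (fun y => u y k) x * p x j

/-- The bracket of two functionals, `{F, G}[u] = ∫ δF/δuⁱ (A δG/δu)ⁱ dx`. -/
def bracket {U : Set (Vec n)} (P : HydroBracket n) (F G : SmoothFunctional U)
    (u : ℝ → Vec n) : ℝ :=
  ∫ x in (0 : ℝ)..1, ∑ i, F.grad u x i * P.op u (G.grad u) x i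

/-- `r` is the value at the field `u` of the iterated bracket `{{F, G}, H}`: the derivative of the
functional `{F, G}` along the Hamiltonian vector field of `H`. -/
def HasIterated {U : Set (Vec n)} (P : HydroBracket n) (F G H : SmoothFunctional U)
    (u : ℝ → Vec n) (r : ℝ) : Prop :=
  HasDerivAt (fun ε : ℝ => P.bracket F G (fun x => u x + ε • P.op u (H.grad u) x)) r 0

/-- The bracket is a Poisson bracket: it is skew-symmetric and satisfies the Jacobi identity.
(Bilinearity and the Leibniz rule hold for every bracket of this form.) -/
structure IsPoisson (U : Set (Vec n)) (P : HydroBracket n) : Prop where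
  skew : ∀ (F G : SmoothFunctional U) (u : ℝ → Vec n), IsLoop U u →
    P.bracket F G u = -P.bracket G F u
  jacobi : ∀ (F G H : SmoothFunctional U) (u : ℝ → Vec n), IsLoop U u →
    ∃ r₁ r₂ r₃ : ℝ, P.HasIterated F G H u r₁ ∧ P.HasIterated G H F u r₂ ∧
      P.HasIterated H F G u r₃ ∧ r₁ + r₂ + r₃ = 0

/-- The linear combination `a { , }_P + c { , }_Q` of two brackets. -/
def comb (a c : ℝ) (P Q : HydroBracket n) : HydroBracket n where
  g := fun x => a • P.g x + c • Q.g x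
  b := fun i j k x => a * P.b i j k x + c * Q.b i j k x

/-- Two brackets are compatible if every linear combination of them with constant coefficients
is a Poisson bracket (in particular each of the two is). -/
def Compatible (U : Set (Vec n)) (P Q : HydroBracket n) : Prop :=
  ∀ a c : ℝ, (comb a c P Q).IsPoisson U

/-- The bracket of hydrodynamic type attached to a metric: `b^{ij}_k = Γ^{ij}_k`. -/
def ofMetric (g : Vec n → Matrix (Fin n) (Fin n) ℝ) : HydroBracket n where
  g := g
  b := contraChristoffel g

end HydroBracket

end

noncomputable section

/-! ### Parametric integrals of smooth functions -/

section ParametricIntegrals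

variable {E F : Type} [NormedAddCommGroup E] [NormedSpace ℝ E] [FiniteDimensional ℝ E]
  [NormedAddCommGroup F] [NormedSpace ℝ F]

/-! The pencil. Write `G` for the Hessian of the potential. Its derivatives are totally symmetric,
so the Levi-Civita connection is `Γₖ = ½ G⁻¹ ∂ₖG`, and `G⁻¹ ∂ₖG` is also the matrix of
multiplication by `∂ₖ`. When the derivatives of `Γₖ` are antisymmetrized only commutators of these
matrices survive; associativity and commutativity of the multiplication make them vanish, so `g` is
flat. The parameter manifold is convex, hence parallel sections exist globally: there are functions
`yᵃ` with Jacobian `J` and `G = Jᵀ J` (`exists_orthonormal_coordinates`). The map `y` need not be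
injective; invertibility of `J` is all that is used.

In the local coordinates `y` the contravariant metric `g` is the identity matrix, and `g₂` is taken
to be `diag (exp y¹, 1, …, 1)`. Every combination is of the form `δᵃᵇ Dₐ(yᵃ)`, with each entry
depending on its own coordinate only. Such a metric is flat where it is nondegenerate, because the
one-forms `|Dₐ|^(-1/2) dyᵃ` are closed and orthogonal of constant length; its contravariant
Christoffel symbols in the coordinates `y` are `Dₐ'/2`, linear in `D`
(`coordMetric_riemann_christoffel`, `contraMat_coordMetric`). If all `Dₐ` are positive, the
primitives of these forms are local coordinates in which the metric is Euclidean, and the Euclidean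
metric is the Hessian of the log-partition function `|φ|²/2` of the standard Gaussian
(`isKSMetric_coordMetric`). The exponential is positive everywhere and not constant, which gives a
nontrivial pencil on the whole manifold.

The brackets. In an iterated bracket `{{F, G}, H}` the derivative falls either on the gradients or
on the operator. The second variations cancel in the cyclic sum, by symmetry of the second variation
and skew-adjointness of the operator. What is left is the integral of a density, `jacobiator`, that
depends on the three gradients at `u` only (`hasIterated`, `isPoisson_of_jacobiator`).

From Poisson to geometry: linear functionals realize every covector field as a gradient, so
skew-adjointness and the vanishing of the integrated Jacobiator can be tested on covector fields
with one component, along constant loops and loops in a coordinate line. This yields symmetry,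
metric compatibility, vanishing torsion and vanishing curvature (`IsPoisson.skewCoeff`,
`IsPoisson.torsion`, `IsPoisson.curvature`), and hence `IsPoisson.flat_metric`, which is applied to
every combination on its nondegeneracy set.

From geometry to Poisson: for a flat metric the operator is `g` composed with the covariant
derivative along `u`, and the Jacobiator vanishes pointwise, since its terms cancel in pairs by
symmetry of the Christoffel symbols (`jacobiator_eq_zero_of_flat`). A combination `a g₁ + c g₂` may
degenerate, but its Jacobiator at a point is a quadratic form in `(a, c)` that vanishes for `a = 1`
and all small `c`, hence identically (`compatible_iff`). -/

theorem hasFDerivAt_parametric_intervalIntegral {S : Set E} (hS : IsOpen S) {f : E × ℝ → F}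
    (hf : ContDiffOn ℝ 1 f (S ×ˢ univ)) {s : E} (hs : s ∈ S) (a b : ℝ) :
    HasFDerivAt (fun s => ∫ x in a..b, f (s, x))
      (∫ x in a..b, (fderiv ℝ f (s, x)).comp (ContinuousLinearMap.inl ℝ E ℝ)) s := by
  have := FiniteDimensional.proper ℝ E
  have hSo : IsOpen (S ×ˢ (univ : Set ℝ)) := hS.prod isOpen_univ
  have hfd : ContinuousOn (fun q => (fderiv ℝ f q).comp (ContinuousLinearMap.inl ℝ E ℝ))
      (S ×ˢ univ) :=
    (hf.continuousOn_fderiv_of_isOpen hSo le_rfl).clm_comp continuousOn_const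
  obtain ⟨r, hr, hrS⟩ := Metric.nhds_basis_closedBall.mem_iff.1 (hS.mem_nhds hs)
  -- The derivative is continuous, so on this compact product it is bounded by a constant, which
  -- serves as the dominating function.
  have hK : IsCompact (Metric.closedBall s r ×ˢ uIcc a b) :=
    (isCompact_closedBall s r).prod isCompact_uIcc
  have hKS : Metric.closedBall s r ×ˢ uIcc a b ⊆ S ×ˢ univ := prod_mono hrS (subset_univ _)
  obtain ⟨C, hC⟩ := hK.exists_bound_of_continuousOn (hfd.mono hKS)
  have hslice : ∀ t ∈ S, ContinuousOn (fun x : ℝ => (t, x)) univ ∧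
      MapsTo (fun x : ℝ => (t, x)) univ (S ×ˢ univ) := fun t ht =>
    ⟨by fun_prop, fun x _ => ⟨ht, mem_univ _⟩⟩
  have hc : ∀ t ∈ S, Continuous fun x : ℝ => f (t, x) := fun t ht =>
    continuousOn_univ.1 (hf.continuousOn.comp (hslice t ht).1 (hslice t ht).2)
  have hc' : ∀ t ∈ S, Continuous fun x : ℝ =>
      (fderiv ℝ f (t, x)).comp (ContinuousLinearMap.inl ℝ E ℝ) := fun t ht =>
    continuousOn_univ.1 (hfd.comp (hslice t ht).1 (hslice t ht).2)
  refine intervalIntegral.hasFDerivAt_integral_of_dominated_of_fderiv_le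
    (Metric.closedBall_mem_nhds s hr) (F := fun t x => f (t, x))
    (F' := fun t x => (fderiv ℝ f (t, x)).comp (ContinuousLinearMap.inl ℝ E ℝ))
    (bound := fun _ => C) ?_ ?_ ?_ ?_ ?_ ?_
  · filter_upwards [hS.mem_nhds hs] with t ht
    exact (hc t ht).aestronglyMeasurable
  · exact (hc s hs).intervalIntegrable _ _
  · exact (hc' s hs).aestronglyMeasurable
  · refine Filter.Eventually.of_forall fun x hx t ht => hC (t, x) ⟨ht, uIoc_subset_uIcc hx⟩
  · exact intervalIntegrable_const
  · refine Filter.Eventually.of_forall fun x _ t ht => ?_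
    have h1 : DifferentiableAt ℝ f (t, x) :=
      (hf.differentiableOn (by norm_num)).differentiableAt (hSo.mem_nhds ⟨hrS ht, mem_univ _⟩)
    have h2 : HasFDerivAt (fun t : E => (t, x)) (ContinuousLinearMap.inl ℝ E ℝ) t :=
      hasFDerivAt_prodMk_left t x
    exact h1.hasFDerivAt.comp t h2

/-- The codomain is quantified after `n` because the induction step passes to the derivative, whose
values are continuous linear maps. -/
theorem contDiffOn_parametric_intervalIntegral_nat {S : Set E} (hS : IsOpen S) (a b : ℝ) (n : ℕ) :
    ∀ {F : Type} [NormedAddCommGroup F] [NormedSpace ℝ F] {f : E × ℝ → F},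
      ContDiffOn ℝ n f (S ×ˢ univ) → ContDiffOn ℝ n (fun s => ∫ x in a..b, f (s, x)) S := by
  induction n with
  | zero =>
    intro F _ _ f hf
    simp only [CharP.cast_eq_zero, contDiffOn_zero] at hf ⊢
    rw [continuousOn_iff_continuous_domRestrict]
    refine intervalIntegral.continuous_parametric_intervalIntegral_of_continuous'
      (f := fun (t : S) x => f (t, x)) ?_ a b
    have : Continuous fun q : S × ℝ => ((q.1 : E), q.2) := by fun_prop
    exact hf.comp_continuous this fun q => ⟨q.1.2, mem_univ _⟩
  | succ n ih =>
    intro F _ _ f hf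
    have hSo : IsOpen (S ×ˢ (univ : Set ℝ)) := hS.prod isOpen_univ
    have hf1 : ContDiffOn ℝ 1 f (S ×ˢ univ) := hf.of_le (by
      push_cast; exact le_add_of_nonneg_left zero_le)
    push_cast at hf ⊢
    rw [contDiffOn_succ_iff_hasFDerivWithinAt_of_uniqueDiffOn hS.uniqueDiffOn]
    refine ⟨by simp, fun s => ∫ x in a..b, (fderiv ℝ f (s, x)).comp
      (ContinuousLinearMap.inl ℝ E ℝ), ?_, fun s hs =>
      (hasFDerivAt_parametric_intervalIntegral hS hf1 hs a b).hasFDerivWithinAt⟩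
    refine ih (f := fun q => (fderiv ℝ f q).comp (ContinuousLinearMap.inl ℝ E ℝ)) ?_
    exact (hf.fderiv_of_isOpen hSo le_rfl).clm_comp contDiffOn_const

theorem contDiffOn_parametric_intervalIntegral {S : Set E} (hS : IsOpen S) (a b : ℝ)
    {f : E × ℝ → F} (hf : ContDiffOn ℝ ∞ f (S ×ˢ univ)) :
    ContDiffOn ℝ ∞ (fun s => ∫ x in a..b, f (s, x)) S :=
  contDiffOn_infty.2 fun n => contDiffOn_parametric_intervalIntegral_nat hS a b n
    (contDiffOn_infty.1 hf n)

end ParametricIntegrals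

/-! ### Partial derivatives -/

section PartialDerivatives

variable {n : ℕ} {U : Set (Vec n)}

theorem ContDiffOn.pd_smooth (hU : IsOpen U) {f : Vec n → ℝ} (hf : ContDiffOn ℝ ∞ f U)
    (i : Fin n) : ContDiffOn ℝ ∞ (pd i f) U :=
  (hf.fderiv_of_isOpen hU (by simp)).clm_apply contDiffOn_const

theorem ContDiffOn.diffAt (hU : IsOpen U) {f : Vec n → ℝ} (hf : ContDiffOn ℝ ∞ f U)
    {x : Vec n} (hx : x ∈ U) : DifferentiableAt ℝ f x :=
  (hf.differentiableOn (by simp)).differentiableAt (hU.mem_nhds hx)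

theorem pd_congr {f g : Vec n → ℝ} {x : Vec n} (h : f =ᶠ[nhds x] g) (i : Fin n) :
    pd i f x = pd i g x := by
  unfold pd; rw [h.fderiv_eq]

theorem pd_congr_on (hU : IsOpen U) {f g : Vec n → ℝ} (h : ∀ y ∈ U, f y = g y) {x : Vec n}
    (hx : x ∈ U) (i : Fin n) : pd i f x = pd i g x :=
  pd_congr (Filter.eventually_of_mem (hU.mem_nhds hx) h) i

theorem pd_comm (hU : IsOpen U) {f : Vec n → ℝ} (hf : ContDiffOn ℝ ∞ f U) {x : Vec n} (hx : x ∈ U)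
    (i j : Fin n) : pd i (pd j f) x = pd j (pd i f) x := by
  have hs : IsSymmSndFDerivAt ℝ f x :=
    (hf.contDiffAt (hU.mem_nhds hx)).isSymmSndFDerivAt (by
      rw [minSmoothness_of_isRCLikeNormedField]; exact WithTop.coe_le_coe.2 le_top)
  have hd : DifferentiableAt ℝ (fderiv ℝ f) x :=
    ((hf.fderiv_of_isOpen (m := ∞) hU (by simp)).differentiableOn (by simp)).differentiableAt
      (hU.mem_nhds hx)
  have key : ∀ i j : Fin n, pd i (pd j f) x
      = fderiv ℝ (fderiv ℝ f) x (Pi.single i 1) (Pi.single j 1) := fun i j => by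
    unfold pd
    rw [fderiv_clm_apply hd (differentiableAt_const _)]
    simp
  rw [key, key]
  exact hs _ _

theorem fderiv_apply_eq_sum_pd (f : Vec n → ℝ) (x v : Vec n) :
    fderiv ℝ f x v = ∑ i, v i * pd i f x := by
  conv_lhs => rw [pi_eq_sum_univ' v, map_sum]
  exact Finset.sum_congr rfl fun i _ => by
    rw [map_smul, smul_eq_mul]; unfold pd; congr 2

@[simp] theorem pd_const (c : ℝ) (i : Fin n) (x : Vec n) : pd i (fun _ => c) x = 0 := by
  simp [pd]

theorem pd_add {f g : Vec n → ℝ} {x : Vec n} (hf : DifferentiableAt ℝ f x)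
    (hg : DifferentiableAt ℝ g x) (i : Fin n) :
    pd i (fun y => f y + g y) x = pd i f x + pd i g x := by
  unfold pd; rw [fderiv_fun_add hf hg]; rfl

theorem pd_neg {f : Vec n → ℝ} {x : Vec n} (i : Fin n) :
    pd i (fun y => -f y) x = -pd i f x := by
  unfold pd; rw [fderiv_fun_neg]; rfl

theorem pd_mul {f g : Vec n → ℝ} {x : Vec n} (hf : DifferentiableAt ℝ f x)
    (hg : DifferentiableAt ℝ g x) (i : Fin n) :
    pd i (fun y => f y * g y) x = pd i f x * g x + f x * pd i g x := by
  unfold pd; rw [fderiv_fun_mul hf hg]; simp; ring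

theorem pd_const_mul {f : Vec n → ℝ} {x : Vec n} (hf : DifferentiableAt ℝ f x) (c : ℝ)
    (i : Fin n) : pd i (fun y => c * f y) x = c * pd i f x := by
  rw [pd_mul (differentiableAt_const c) hf]; simp

theorem pd_sum {ι : Type*} (s : Finset ι) {f : ι → Vec n → ℝ} {x : Vec n}
    (hf : ∀ a ∈ s, DifferentiableAt ℝ (f a) x) (i : Fin n) :
    pd i (fun y => ∑ a ∈ s, f a y) x = ∑ a ∈ s, pd i (f a) x := by
  unfold pd; rw [fderiv_fun_sum hf]; simp

end PartialDerivatives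

/-! ### Matrix-valued functions -/

section MatrixFunctions

variable {n : ℕ} {U : Set (Vec n)}

/-- The entrywise partial derivative of a matrix-valued function. -/
def mpd (k : Fin n) (A : Vec n → Matrix (Fin n) (Fin n) ℝ) (x : Vec n) :
    Matrix (Fin n) (Fin n) ℝ :=
  Matrix.of fun i j => pd k (fun y => A y i j) x

/-- A matrix-valued function with smooth entries. -/
def MSmooth (U : Set (Vec n)) (A : Vec n → Matrix (Fin n) (Fin n) ℝ) : Prop :=
  ∀ i j, ContDiffOn ℝ ∞ (fun x => A x i j) U

variable {A B : Vec n → Matrix (Fin n) (Fin n) ℝ}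

theorem MSmooth.mul (hA : MSmooth U A) (hB : MSmooth U B) : MSmooth U fun x => A x * B x :=
  fun i j => by
    simp only [Matrix.mul_apply]
    exact ContDiffOn.sum fun k _ => (hA i k).mul (hB k j)

theorem MSmooth.transpose (hA : MSmooth U A) : MSmooth U fun x => (A x)ᵀ := fun i j => hA j i

theorem MSmooth.const (C : Matrix (Fin n) (Fin n) ℝ) : MSmooth U fun _ => C :=
  fun _ _ => contDiffOn_const

theorem MSmooth.mono {W : Set (Vec n)} (hA : MSmooth U A) (h : W ⊆ U) : MSmooth W A :=
  fun i j => (hA i j).mono h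

theorem MSmooth.congr (hA : MSmooth U A) (h : ∀ x ∈ U, B x = A x) : MSmooth U B :=
  fun i j => (hA i j).congr fun x hx => by rw [h x hx]

theorem MSmooth.det (hA : MSmooth U A) : ContDiffOn ℝ ∞ (fun x => (A x).det) U := by
  simp only [Matrix.det_apply']
  exact ContDiffOn.sum fun σ _ => contDiffOn_const.mul
    (contDiffOn_prod fun i _ => hA (σ i) i)

theorem MSmooth.inv (hA : MSmooth U A) (hdet : ∀ x ∈ U, (A x).det ≠ 0) :
    MSmooth U fun x => (A x)⁻¹ := fun i j => by
  have h : ∀ x, (A x)⁻¹ i j = (A x).det⁻¹ * (A x).adjugate i j := fun x => by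
    rw [Matrix.inv_def, Ring.inverse_eq_inv']; rfl
  simp only [h]
  refine (hA.det.inv hdet).mul ?_
  simp only [Matrix.adjugate_apply]
  refine MSmooth.det (A := fun x => (A x).updateRow j (Pi.single i 1)) fun a b => ?_
  by_cases hab : a = j
  · subst hab; simpa using contDiffOn_const
  · simpa [Matrix.updateRow_ne hab] using hA a b

theorem MSmooth.mpd (hU : IsOpen U) (hA : MSmooth U A) (k : Fin n) : MSmooth U (mpd k A) :=
  fun i j => (hA i j).pd_smooth hU k

theorem mpd_transpose (k : Fin n) (x : Vec n) : mpd k (fun y => (A y)ᵀ) x = (mpd k A x)ᵀ := rfl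

theorem mpd_neg (k : Fin n) (x : Vec n) : mpd k (fun y => -A y) x = -mpd k A x := by
  ext i j; exact pd_neg k

@[simp] theorem mpd_const (C : Matrix (Fin n) (Fin n) ℝ) (k : Fin n) (x : Vec n) :
    mpd k (fun _ => C) x = 0 := by
  ext i j; simp [_root_.mpd]

theorem mpd_congr_on (hU : IsOpen U) (h : ∀ y ∈ U, A y = B y) {x : Vec n} (hx : x ∈ U)
    (k : Fin n) : mpd k A x = mpd k B x := by
  ext i j; exact pd_congr_on hU (fun y hy => by rw [h y hy]) hx k

theorem mpd_mul (hU : IsOpen U) (hA : MSmooth U A) (hB : MSmooth U B) {x : Vec n} (hx : x ∈ U)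
    (k : Fin n) : mpd k (fun y => A y * B y) x = mpd k A x * B x + A x * mpd k B x := by
  ext i j
  simp only [_root_.mpd, Matrix.mul_apply, Matrix.of_apply, Matrix.add_apply]
  rw [pd_sum (f := fun a y => A y i a * B y a j) _
      fun a _ => ((hA i a).diffAt hU hx).fun_mul ((hB a j).diffAt hU hx),
    ← Finset.sum_add_distrib]
  exact Finset.sum_congr rfl fun a _ => pd_mul ((hA i a).diffAt hU hx) ((hB a j).diffAt hU hx) k

theorem mpd_comm (hU : IsOpen U) (hA : MSmooth U A) {x : Vec n} (hx : x ∈ U) (k l : Fin n) :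
    mpd k (mpd l A) x = mpd l (mpd k A) x := by
  ext i j; exact pd_comm hU (hA i j) hx k l

theorem mpd_inv (hU : IsOpen U) (hA : MSmooth U A) (hdet : ∀ x ∈ U, (A x).det ≠ 0) {x : Vec n}
    (hx : x ∈ U) (k : Fin n) :
    mpd k (fun y => (A y)⁻¹) x = -((A x)⁻¹ * mpd k A x * (A x)⁻¹) := by
  have hu : IsUnit (A x).det := isUnit_iff_ne_zero.2 (hdet x hx)
  have h := mpd_mul hU (hA.inv hdet) hA hx k
  rw [mpd_congr_on hU (B := fun _ => 1)
    (fun y hy => Matrix.nonsing_inv_mul _ (isUnit_iff_ne_zero.2 (hdet y hy))) hx, mpd_const] at h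
  have h2 := congrArg (· * (A x)⁻¹) h
  simp only [add_mul, zero_mul, Matrix.mul_assoc, Matrix.mul_nonsing_inv _ hu, mul_one] at h2
  rw [Matrix.mul_assoc]
  exact eq_neg_of_add_eq_zero_left h2.symm

end MatrixFunctions

/-! ### Levi-Civita connections of contravariant metrics -/

section LeviCivita

variable {n : ℕ} {U : Set (Vec n)} {g h : Vec n → Matrix (Fin n) (Fin n) ℝ}

/-- A smooth pseudo-Riemannian metric on an open set, given by its contravariant components. -/
structure IsMetricOn (U : Set (Vec n)) (g : Vec n → Matrix (Fin n) (Fin n) ℝ) : Prop where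
  isOpen : IsOpen U
  smooth : MSmooth U g
  symm : ∀ x ∈ U, (g x).IsSymm
  nondeg : ∀ x ∈ U, (g x).det ≠ 0

theorem IsMetricOn.mono {W : Set (Vec n)} (hg : IsMetricOn U g) (hW : IsOpen W) (h : W ⊆ U) :
    IsMetricOn W g :=
  ⟨hW, hg.smooth.mono h, fun x hx => hg.symm x (h hx), fun x hx => hg.nondeg x (h hx)⟩

/-- The matrix `(Γₖ)ⁱⱼ` of Christoffel symbols. -/
def christoffelMat (g : Vec n → Matrix (Fin n) (Fin n) ℝ) (k : Fin n) (x : Vec n) :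
    Matrix (Fin n) (Fin n) ℝ :=
  Matrix.of fun i j => christoffel g i k j x

/-- The matrix `(Γ^{ij})ₖ` of contravariant Christoffel symbols. -/
def contraMat (g : Vec n → Matrix (Fin n) (Fin n) ℝ) (k : Fin n) (x : Vec n) :
    Matrix (Fin n) (Fin n) ℝ :=
  Matrix.of fun i j => contraChristoffel g i j k x

/-- The matrix `(R_{kl})ⁱⱼ` of the curvature tensor. -/
def riemannMat (g : Vec n → Matrix (Fin n) (Fin n) ℝ) (k l : Fin n) (x : Vec n) :
    Matrix (Fin n) (Fin n) ℝ :=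
  Matrix.of fun i j => riemann g i j k l x

theorem christoffel_congr_on (hU : IsOpen U) (hgh : ∀ y ∈ U, g y = h y) {x : Vec n} (hx : x ∈ U)
    (i j k : Fin n) : christoffel g i j k x = christoffel h i j k x := by
  unfold christoffel
  have hp : ∀ (a l m : Fin n), pd a (fun y => (g y)⁻¹ l m) x = pd a (fun y => (h y)⁻¹ l m) x :=
    fun a l m => pd_congr_on hU (fun y hy => by rw [hgh y hy]) hx a
  simp only [hp, hgh x hx]

theorem contraChristoffel_congr_on (hU : IsOpen U) (hgh : ∀ y ∈ U, g y = h y) {x : Vec n}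
    (hx : x ∈ U) (i j k : Fin n) : contraChristoffel g i j k x = contraChristoffel h i j k x := by
  unfold contraChristoffel
  simp only [christoffel_congr_on hU hgh hx, hgh x hx]

theorem riemann_congr_on (hU : IsOpen U) (hgh : ∀ y ∈ U, g y = h y) {x : Vec n} (hx : x ∈ U)
    (i j k l : Fin n) : riemann g i j k l x = riemann h i j k l x := by
  unfold riemann
  have hp : ∀ (a i j k : Fin n), pd a (christoffel g i j k) x = pd a (christoffel h i j k) x :=
    fun a i j k => pd_congr_on hU (fun y hy => christoffel_congr_on hU hgh hy i j k) hx a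
  simp only [hp, christoffel_congr_on hU hgh hx]

theorem riemannMat_eq (k l : Fin n) (x : Vec n) :
    riemannMat g k l x = mpd k (christoffelMat g l) x - mpd l (christoffelMat g k) x
      + (christoffelMat g k x * christoffelMat g l x
        - christoffelMat g l x * christoffelMat g k x) := by
  ext i j
  simp only [riemannMat, riemann, mpd, christoffelMat, Matrix.of_apply, Matrix.add_apply,
    Matrix.sub_apply, Matrix.mul_apply, Finset.sum_sub_distrib]

namespace IsMetricOn

theorem isUnit_det (hg : IsMetricOn U g) {x : Vec n} (hx : x ∈ U) : IsUnit (g x).det :=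
  isUnit_iff_ne_zero.2 (hg.nondeg x hx)

theorem smooth_inv (hg : IsMetricOn U g) : MSmooth U fun x => (g x)⁻¹ :=
  hg.smooth.inv hg.nondeg

theorem inv_symm (hg : IsMetricOn U g) {x : Vec n} (hx : x ∈ U) : ((g x)⁻¹)ᵀ = (g x)⁻¹ := by
  rw [Matrix.transpose_nonsing_inv, (hg.symm x hx).eq]

theorem christoffel_comm (hg : IsMetricOn U g) {x : Vec n} (hx : x ∈ U) (i j k : Fin n) :
    christoffel g i j k x = christoffel g i k j x := by
  unfold christoffel
  congr 1
  refine Finset.sum_congr rfl fun l _ => ?_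
  have : pd l (fun y => (g y)⁻¹ j k) x = pd l (fun y => (g y)⁻¹ k j) x :=
    pd_congr_on hg.isOpen (fun y hy => by
      conv_lhs => rw [← hg.inv_symm hy, Matrix.transpose_apply]) hx l
  rw [this]; ring

theorem smooth_christoffel (hg : IsMetricOn U g) (i j k : Fin n) :
    ContDiffOn ℝ ∞ (christoffel g i j k) U := by
  unfold christoffel
  have hp : ∀ a l m : Fin n, ContDiffOn ℝ ∞ (pd a fun y => (g y)⁻¹ l m) U :=
    fun a l m => (hg.smooth_inv l m).pd_smooth hg.isOpen a
  exact contDiffOn_const.mul (ContDiffOn.sum fun l _ =>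
    (hg.smooth i l).mul (((hp j l k).add (hp k l j)).sub (hp l j k)))

theorem smooth_contraChristoffel (hg : IsMetricOn U g) (i j k : Fin n) :
    ContDiffOn ℝ ∞ (contraChristoffel g i j k) U :=
  (ContDiffOn.sum fun s _ => (hg.smooth i s).mul (hg.smooth_christoffel j s k)).neg

theorem smooth_christoffelMat (hg : IsMetricOn U g) (k : Fin n) : MSmooth U (christoffelMat g k) :=
  fun i j => hg.smooth_christoffel i k j

theorem contraMat_eq (hg : IsMetricOn U g) {x : Vec n} (hx : x ∈ U) (k : Fin n) :
    contraMat g k x = -(g x * (christoffelMat g k x)ᵀ) := by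
  ext i j
  simp only [contraMat, contraChristoffel, christoffelMat, Matrix.of_apply, Matrix.neg_apply,
    Matrix.mul_apply, Matrix.transpose_apply]
  exact congrArg _ (Finset.sum_congr rfl fun s _ => by rw [hg.christoffel_comm hx])

/-- These are the Christoffel symbols of the first kind; the inverse metric cancels the leading
factor `g` of the definition. -/
theorem inv_mul_christoffelMat (hg : IsMetricOn U g) {x : Vec n} (hx : x ∈ U) (k i j : Fin n) :
    ((g x)⁻¹ * christoffelMat g k x) i j = (1 / 2 : ℝ) *
      (pd k (fun y => (g y)⁻¹ i j) x + pd j (fun y => (g y)⁻¹ i k) x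
        - pd i (fun y => (g y)⁻¹ k j) x) := by
  have h : ∀ a, christoffelMat g k x a j = (g x *ᵥ fun l => (1 / 2 : ℝ) *
      (pd k (fun y => (g y)⁻¹ l j) x + pd j (fun y => (g y)⁻¹ l k) x
        - pd l (fun y => (g y)⁻¹ k j) x)) a := fun a => by
    simp only [christoffelMat, christoffel, Matrix.of_apply, Matrix.mulVec, dotProduct,
      Finset.mul_sum]
    exact Finset.sum_congr rfl fun l _ => by ring
  have h2 : ((g x)⁻¹ * christoffelMat g k x) i j
      = ((g x)⁻¹ *ᵥ fun a => christoffelMat g k x a j) i := rfl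
  rw [h2, funext h, Matrix.mulVec_mulVec, Matrix.nonsing_inv_mul _ (hg.isUnit_det hx),
    Matrix.one_mulVec]

/-- The Levi-Civita connection is compatible with the covariant metric. -/
theorem mpd_inv_eq (hg : IsMetricOn U g) {x : Vec n} (hx : x ∈ U) (k : Fin n) :
    mpd k (fun y => (g y)⁻¹) x
      = (christoffelMat g k x)ᵀ * (g x)⁻¹ + (g x)⁻¹ * christoffelMat g k x := by
  have ht : (christoffelMat g k x)ᵀ * (g x)⁻¹ = ((g x)⁻¹ * christoffelMat g k x)ᵀ := by
    rw [Matrix.transpose_mul, hg.inv_symm hx]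
  have hs : ∀ a l m : Fin n, pd a (fun y => (g y)⁻¹ l m) x = pd a (fun y => (g y)⁻¹ m l) x :=
    fun a l m => pd_congr_on hg.isOpen (fun y hy => by
      conv_lhs => rw [← hg.inv_symm hy, Matrix.transpose_apply]) hx a
  ext i j
  rw [ht, Matrix.add_apply, Matrix.transpose_apply, hg.inv_mul_christoffelMat hx,
    hg.inv_mul_christoffelMat hx, hs k j i, hs i j k, hs j k i]
  simp only [mpd, Matrix.of_apply]
  ring

/-- The Levi-Civita connection is compatible with the contravariant metric. -/
theorem mpd_eq (hg : IsMetricOn U g) {x : Vec n} (hx : x ∈ U) (k : Fin n) :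
    mpd k g x = -(g x * (christoffelMat g k x)ᵀ) - christoffelMat g k x * g x := by
  have hu := hg.isUnit_det hx
  have h1 := mpd_inv hg.isOpen hg.smooth hg.nondeg hx k
  rw [hg.mpd_inv_eq hx] at h1
  have h2 := congrArg (fun M => -(g x * M * g x)) h1
  simp only [Matrix.mul_add, Matrix.add_mul, Matrix.mul_neg, Matrix.neg_mul, neg_neg] at h2
  simp only [← Matrix.mul_assoc, Matrix.mul_nonsing_inv _ hu, one_mul] at h2
  simp only [Matrix.mul_assoc, Matrix.nonsing_inv_mul _ hu, mul_one] at h2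
  rw [← h2]; abel

theorem pd_eq_contraChristoffel (hg : IsMetricOn U g) {x : Vec n} (hx : x ∈ U) (i j k : Fin n) :
    pd k (fun y => g y i j) x = contraChristoffel g i j k x + contraChristoffel g j i k x := by
  have h : mpd k g x = contraMat g k x + (contraMat g k x)ᵀ := by
    rw [hg.mpd_eq hx, hg.contraMat_eq hx, Matrix.transpose_neg, Matrix.transpose_mul,
      Matrix.transpose_transpose, (hg.symm x hx).eq, sub_eq_add_neg]
  exact congrFun (congrFun h i) j

theorem contraChristoffel_torsion (hg : IsMetricOn U g) {x : Vec n} (hx : x ∈ U) (i j k : Fin n) :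
    ∑ s, g x i s * contraChristoffel g j k s x = ∑ s, g x j s * contraChristoffel g i k s x := by
  simp only [contraChristoffel, mul_neg, Finset.sum_neg_distrib, Finset.mul_sum]
  rw [Finset.sum_comm]
  refine congrArg _ (Finset.sum_congr rfl fun s _ => Finset.sum_congr rfl fun t _ => ?_)
  rw [hg.christoffel_comm hx]; ring

/-- The contravariant Christoffel symbols are determined by compatibility with the metric and
vanishing torsion. -/
theorem eq_contraChristoffel (hg : IsMetricOn U g) {x : Vec n} (hx : x ∈ U)
    (b : Fin n → Fin n → Fin n → ℝ)
    (hb : ∀ i j k, pd k (fun y => g y i j) x = b i j k + b j i k)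
    (ht : ∀ i j k, ∑ s, g x i s * b j k s = ∑ s, g x j s * b i k s) (i j k : Fin n) :
    b i j k = contraChristoffel g i j k x := by
  -- Uniqueness of the Levi-Civita connection. The difference `d` is antisymmetric in its upper
  -- indices; with the lower index raised it is antisymmetric in the last two indices and, by the
  -- torsion condition, symmetric in the first two. A three-index array with both symmetries is
  -- zero.
  set d : Fin n → Fin n → Fin n → ℝ := fun i j k => b i j k - contraChristoffel g i j k x with hd
  have hanti : ∀ i j k, d i j k = -d j i k := fun i j k => by
    have h1 := hb i j k
    have h2 := hg.pd_eq_contraChristoffel hx i j k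
    simp only [hd]; linarith
  set D : Fin n → Fin n → Fin n → ℝ := fun i j k => ∑ s, g x i s * d j k s with hD
  have hDs : ∀ i j k, D i j k = D j i k := fun i j k => by
    simp only [hD, hd, mul_sub, Finset.sum_sub_distrib]
    rw [ht, hg.contraChristoffel_torsion hx]
  have hDa : ∀ i j k, D i j k = -D i k j := fun i j k => by
    simp only [hD]
    rw [← Finset.sum_neg_distrib]
    exact Finset.sum_congr rfl fun s _ => by rw [hanti]; ring
  have hD0 : ∀ i j k, D i j k = 0 := fun i j k => by
    have h1 := hDs i j k
    have h2 := hDa j i k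
    have h3 := hDs j k i
    have h4 := hDa k j i
    have h5 := hDs k i j
    have h6 := hDa i k j
    linarith
  have hz : (g x) *ᵥ (fun s => d i j s) = 0 := funext fun a => hD0 a i j
  have := Matrix.eq_zero_of_mulVec_eq_zero (hg.nondeg x hx) hz
  have h0 := congrFun this k
  simp only [hd, Pi.zero_apply] at h0
  linarith

/-- The antisymmetrized derivatives of the contravariant Christoffel symbols. -/
theorem mpd_contraMat_sub (hg : IsMetricOn U g) {x : Vec n} (hx : x ∈ U) (k l : Fin n) :
    mpd k (contraMat g l) x - mpd l (contraMat g k) x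
      = christoffelMat g k x * g x * (christoffelMat g l x)ᵀ
        - christoffelMat g l x * g x * (christoffelMat g k x)ᵀ
        - g x * (riemannMat g k l x)ᵀ := by
  -- Differentiate `-g Γᵀ` and insert `∂g = -g Γᵀ - Γ g`: the products with `g` on the left assemble
  -- to the curvature, and the terms `Γ g Γᵀ` remain.
  have key : ∀ a c, mpd a (contraMat g c) x = -(mpd a g x * (christoffelMat g c x)ᵀ
      + g x * (mpd a (christoffelMat g c) x)ᵀ) := fun a c => by
    rw [mpd_congr_on hg.isOpen (fun y hy => hg.contraMat_eq hy c) hx, mpd_neg,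
      mpd_mul hg.isOpen hg.smooth (hg.smooth_christoffelMat c).transpose hx, mpd_transpose]
  rw [key, key, hg.mpd_eq hx, hg.mpd_eq hx, riemannMat_eq]
  simp only [Matrix.transpose_add, Matrix.transpose_sub, Matrix.transpose_mul]
  noncomm_ring

end IsMetricOn

/-! ### Metrics with a closed orthogonal coframe -/

/-- If `g_{ij} = ∑ₐ εₐ Mₐᵢ Mₐⱼ` with constant `εₐ` and closed one-forms `Mₐ`, then
`Γₖ = M⁻¹ ∂ₖ M`. -/
theorem christoffelMat_of_closed_coframe (hg : IsMetricOn U g)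
    {M : Vec n → Matrix (Fin n) (Fin n) ℝ} (hM : MSmooth U M) {ε : Fin n → ℝ}
    (hgM : ∀ x ∈ U, (g x)⁻¹ = (M x)ᵀ * Matrix.diagonal ε * M x)
    (hclosed : ∀ x ∈ U, ∀ a i j, mpd i M x a j = mpd j M x a i) {x : Vec n} (hx : x ∈ U)
    (k : Fin n) : christoffelMat g k x = (M x)⁻¹ * mpd k M x := by
  have hu := hg.isUnit_det hx
  have hgu : IsUnit (g x)⁻¹.det := by
    rw [Matrix.det_nonsing_inv, Ring.inverse_eq_inv']
    exact isUnit_iff_ne_zero.2 (inv_ne_zero (hg.nondeg x hx))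
  have hMu : IsUnit (M x).det := by
    have h := hgu
    rw [hgM x hx, Matrix.det_mul] at h
    exact isUnit_of_mul_isUnit_right h
  have hd : ∀ a, mpd a (fun y => (g y)⁻¹) x
      = (mpd a M x)ᵀ * Matrix.diagonal ε * M x + (M x)ᵀ * Matrix.diagonal ε * mpd a M x :=
    fun a => by
    rw [mpd_congr_on hg.isOpen hgM hx,
      mpd_mul hg.isOpen (hM.transpose.mul (MSmooth.const _)) hM hx,
      mpd_mul hg.isOpen hM.transpose (MSmooth.const _) hx, mpd_transpose, mpd_const]
    simp
  have hd' : ∀ a i j, pd a (fun y => (g y)⁻¹ i j) x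
      = ∑ c, ε c * (mpd a M x c i * M x c j + M x c i * mpd a M x c j) := fun a i j => by
    have := congrFun (congrFun (hd a) i) j
    rw [Matrix.add_apply, Matrix.mul_assoc, Matrix.mul_assoc, Matrix.mul_apply, Matrix.mul_apply,
      ← Finset.sum_add_distrib] at this
    refine this.trans (Finset.sum_congr rfl fun c _ => ?_)
    rw [Matrix.diagonal_mul, Matrix.diagonal_mul]
    simp only [Matrix.transpose_apply]; ring
  -- Of the six terms in the symbols of the first kind, closedness makes four cancel and the other
  -- two coincide, which absorbs the factor one half.
  have hl : (g x)⁻¹ * christoffelMat g k x = (M x)ᵀ * Matrix.diagonal ε * mpd k M x := by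
    ext i j
    rw [hg.inv_mul_christoffelMat hx, hd', hd', hd', Matrix.mul_assoc, Matrix.mul_apply,
      ← Finset.sum_add_distrib, ← Finset.sum_sub_distrib, Finset.mul_sum]
    refine Finset.sum_congr rfl fun c _ => ?_
    rw [Matrix.diagonal_mul, Matrix.transpose_apply, hclosed x hx c j k, hclosed x hx c j i,
      hclosed x hx c i k]
    ring
  have h2 : (g x)⁻¹ * ((M x)⁻¹ * mpd k M x) = (M x)ᵀ * Matrix.diagonal ε * mpd k M x := by
    rw [hgM x hx, Matrix.mul_assoc, ← Matrix.mul_assoc (M x), Matrix.mul_nonsing_inv _ hMu,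
      one_mul]
  have h3 := congrArg (g x * ·) (hl.trans h2.symm)
  simpa only [← Matrix.mul_assoc, Matrix.mul_nonsing_inv _ hu, one_mul] using h3

/-- A metric with a closed orthogonal coframe of constant lengths is flat. -/
theorem riemann_of_closed_coframe (hg : IsMetricOn U g)
    {M : Vec n → Matrix (Fin n) (Fin n) ℝ} (hM : MSmooth U M) {ε : Fin n → ℝ}
    (hdet : ∀ x ∈ U, (M x).det ≠ 0)
    (hgM : ∀ x ∈ U, (g x)⁻¹ = (M x)ᵀ * Matrix.diagonal ε * M x)
    (hclosed : ∀ x ∈ U, ∀ a i j, mpd i M x a j = mpd j M x a i) {x : Vec n} (hx : x ∈ U)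
    (i j k l : Fin n) : riemann g i j k l x = 0 := by
  have hΓ := fun (y : Vec n) (hy : y ∈ U) (k : Fin n) =>
    christoffelMat_of_closed_coframe hg hM hgM hclosed hy k
  have hMu : IsUnit (M x).det := isUnit_iff_ne_zero.2 (hdet x hx)
  have key : ∀ a c, mpd a (christoffelMat g c) x
      = -((M x)⁻¹ * mpd a M x * (M x)⁻¹) * mpd c M x + (M x)⁻¹ * mpd a (mpd c M) x :=
    fun a c => by
    rw [mpd_congr_on hg.isOpen (fun y hy => hΓ y hy c) hx,
      mpd_mul hg.isOpen (hM.inv hdet) (hM.mpd hg.isOpen c) hx, mpd_inv hg.isOpen hM hdet hx]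
  -- The connection `M⁻¹ ∂ₖM` is pure gauge, so its curvature vanishes once the second derivatives
  -- of `M` commute.
  have : riemannMat g k l x = 0 := by
    rw [riemannMat_eq, key, key, hΓ x hx, hΓ x hx, mpd_comm hg.isOpen hM hx k l]
    noncomm_ring
  exact congrFun (congrFun this i) j

end LeviCivita

/-! ### Smooth periodic functions -/

section PeriodicFunctions

/-- A smooth real function of period one. -/
structure SmoothPeriodic (f : ℝ → ℝ) : Prop where
  smooth : ContDiff ℝ ∞ f
  periodic : Function.Periodic f 1

namespace SmoothPeriodic

variable {f h : ℝ → ℝ}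

theorem const (c : ℝ) : SmoothPeriodic fun _ => c := ⟨contDiff_const, fun _ => rfl⟩

theorem add (hf : SmoothPeriodic f) (hh : SmoothPeriodic h) : SmoothPeriodic fun x => f x + h x :=
  ⟨hf.smooth.add hh.smooth, fun x => by simp only [hf.periodic x, hh.periodic x]⟩

theorem sub (hf : SmoothPeriodic f) (hh : SmoothPeriodic h) : SmoothPeriodic fun x => f x - h x :=
  ⟨hf.smooth.sub hh.smooth, fun x => by simp only [hf.periodic x, hh.periodic x]⟩

theorem mul (hf : SmoothPeriodic f) (hh : SmoothPeriodic h) : SmoothPeriodic fun x => f x * h x :=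
  ⟨hf.smooth.mul hh.smooth, fun x => by simp only [hf.periodic x, hh.periodic x]⟩

theorem sum {ι : Type*} (s : Finset ι) {f : ι → ℝ → ℝ} (hf : ∀ i ∈ s, SmoothPeriodic (f i)) :
    SmoothPeriodic fun x => ∑ i ∈ s, f i x :=
  ⟨ContDiff.sum fun i hi => (hf i hi).smooth, fun x =>
    Finset.sum_congr rfl fun i hi => (hf i hi).periodic x⟩

theorem deriv (hf : SmoothPeriodic f) : SmoothPeriodic (deriv f) :=
  ⟨(contDiff_infty_iff_deriv.1 hf.smooth).2, fun x => by
    rw [← deriv_comp_add_const]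
    exact congrArg (fun k => _root_.deriv k x) (funext hf.periodic)⟩

theorem differentiable (hf : SmoothPeriodic f) : Differentiable ℝ f :=
  hf.smooth.differentiable (by simp)

theorem hasDerivAt (hf : SmoothPeriodic f) (x : ℝ) : HasDerivAt f (_root_.deriv f x) x :=
  (hf.differentiable x).hasDerivAt

theorem continuous (hf : SmoothPeriodic f) : Continuous f := hf.smooth.continuous

theorem intervalIntegrable (hf : SmoothPeriodic f) (a b : ℝ) :
    IntervalIntegrable f volume a b := hf.continuous.intervalIntegrable a b

theorem integral_eq_zero_of_hasDerivAt (hf : SmoothPeriodic f) {f' : ℝ → ℝ}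
    (h' : ∀ x, HasDerivAt f (f' x) x) : ∫ x in (0 : ℝ)..1, f' x = 0 := by
  have : f' = _root_.deriv f := funext fun x => (h' x).deriv.symm
  rw [this, intervalIntegral.integral_deriv_eq_sub (fun x _ => hf.differentiable x)
    (hf.deriv.intervalIntegrable 0 1)]
  have := hf.periodic 0
  rw [zero_add] at this
  rw [this, sub_self]

/-- Integration by parts on the circle, in the form needed to move a derivative off a test function:
the integrand may be changed by an exact derivative. -/
theorem integral_eq_zero_of_eq_sub_deriv {q B : ℝ → ℝ} (hf : SmoothPeriodic f)
    (hq : SmoothPeriodic q) (h : ∫ x in (0 : ℝ)..1, f x = 0)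
    (hB : ∀ x, B x = f x - _root_.deriv q x) : ∫ x in (0 : ℝ)..1, B x = 0 := by
  simp only [hB]
  rw [intervalIntegral.integral_sub (hf.intervalIntegrable 0 1) (hq.deriv.intervalIntegrable 0 1),
    h, hq.integral_eq_zero_of_hasDerivAt hq.hasDerivAt, sub_zero]

/-- The fundamental lemma of the calculus of variations; `f` is its own test function, so no bump
functions are needed. -/
theorem eq_zero_of_integral_mul (hf : SmoothPeriodic f)
    (h : ∀ φ, SmoothPeriodic φ → ∫ x in (0 : ℝ)..1, φ x * f x = 0) (x : ℝ) : f x = 0 := by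
  have h0 := h f hf
  have hc : Continuous fun x => f x * f x := hf.continuous.mul hf.continuous
  have hz : ∀ y ∈ Icc (0 : ℝ) 1, f y * f y = 0 := by
    intro y hy
    by_contra hne
    have hpos : 0 < f y * f y := lt_of_le_of_ne (mul_self_nonneg _) (Ne.symm hne)
    have := intervalIntegral.integral_pos (a := (0 : ℝ)) (b := 1) one_pos hc.continuousOn
      (fun z _ => mul_self_nonneg (f z)) ⟨y, hy, hpos⟩
    linarith
  obtain ⟨y, hy, hxy⟩ := hf.periodic.exists_mem_Ico₀ one_pos x
  rw [hxy]
  exact mul_self_eq_zero.1 (hz y ⟨hy.1, hy.2.le⟩)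

theorem sin_two_pi : SmoothPeriodic fun x => Real.sin (2 * Real.pi * x) :=
  ⟨by fun_prop, fun x => by simp only [mul_add, mul_one, Real.sin_add_two_pi]⟩

theorem cos_two_pi : SmoothPeriodic fun x => Real.cos (2 * Real.pi * x) :=
  ⟨by fun_prop, fun x => by simp only [mul_add, mul_one, Real.cos_add_two_pi]⟩

theorem deriv_sin_two_pi (x : ℝ) : _root_.deriv (fun x => Real.sin (2 * Real.pi * x)) x
    = 2 * Real.pi * Real.cos (2 * Real.pi * x) := by
  have h : HasDerivAt (fun x : ℝ => 2 * Real.pi * x) (2 * Real.pi) x := by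
    simpa using (hasDerivAt_id x).const_mul (2 * Real.pi)
  rw [h.sin.deriv]; ring

theorem deriv_cos_two_pi (x : ℝ) : _root_.deriv (fun x => Real.cos (2 * Real.pi * x)) x
    = -(2 * Real.pi * Real.sin (2 * Real.pi * x)) := by
  have h : HasDerivAt (fun x : ℝ => 2 * Real.pi * x) (2 * Real.pi) x := by
    simpa using (hasDerivAt_id x).const_mul (2 * Real.pi)
  rw [h.cos.deriv]; ring

end SmoothPeriodic

end PeriodicFunctions

/-! ### Mixed partial derivatives -/

section MixedDerivatives

variable {O : Set (ℝ × ℝ)} {H : ℝ × ℝ → ℝ}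

theorem hasDerivAt_fst_of_contDiffOn (hO : IsOpen O) (hH : ContDiffOn ℝ ∞ H O) {s x : ℝ}
    (hq : (s, x) ∈ O) : HasDerivAt (fun t => H (t, x)) (fderiv ℝ H (s, x) (1, 0)) s := by
  have h1 : HasFDerivAt H (fderiv ℝ H (s, x)) (s, x) :=
    ((hH.differentiableOn (by simp)).differentiableAt (hO.mem_nhds hq)).hasFDerivAt
  exact h1.comp_hasDerivAt s ((hasDerivAt_id s).prodMk (hasDerivAt_const s x))

theorem hasDerivAt_snd_of_contDiffOn (hO : IsOpen O) (hH : ContDiffOn ℝ ∞ H O) {s x : ℝ}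
    (hq : (s, x) ∈ O) : HasDerivAt (fun y => H (s, y)) (fderiv ℝ H (s, x) (0, 1)) x := by
  have h1 : HasFDerivAt H (fderiv ℝ H (s, x)) (s, x) :=
    ((hH.differentiableOn (by simp)).differentiableAt (hO.mem_nhds hq)).hasFDerivAt
  exact h1.comp_hasDerivAt x ((hasDerivAt_const x s).prodMk (hasDerivAt_id x))

theorem contDiffOn_deriv_fst (hO : IsOpen O) (hH : ContDiffOn ℝ ∞ H O) :
    ContDiffOn ℝ ∞ (fun q : ℝ × ℝ => deriv (fun t => H (t, q.2)) q.1) O :=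
  ((hH.fderiv_of_isOpen (m := ∞) hO (by simp)).clm_apply contDiffOn_const).congr fun _ hq =>
    (hasDerivAt_fst_of_contDiffOn hO hH hq).deriv

theorem contDiffOn_deriv_snd (hO : IsOpen O) (hH : ContDiffOn ℝ ∞ H O) :
    ContDiffOn ℝ ∞ (fun q : ℝ × ℝ => deriv (fun y => H (q.1, y)) q.2) O :=
  ((hH.fderiv_of_isOpen (m := ∞) hO (by simp)).clm_apply contDiffOn_const).congr fun _ hq =>
    (hasDerivAt_snd_of_contDiffOn hO hH hq).deriv

/-- The derivative in the parameter of the derivative in the variable is the derivative in the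
variable of the derivative in the parameter. -/
theorem hasDerivAt_mixed (hO : IsOpen O) (hH : ContDiffOn ℝ ∞ H O) {s x : ℝ} (hq : (s, x) ∈ O) :
    HasDerivAt (fun t => deriv (fun y => H (t, y)) x)
      (deriv (fun y => deriv (fun t => H (t, y)) s) x) s := by
  have hH' : ContDiffOn ℝ ∞ (fderiv ℝ H) O := hH.fderiv_of_isOpen (m := ∞) hO (by simp)
  have hd : HasFDerivAt (fderiv ℝ H) (fderiv ℝ (fderiv ℝ H) (s, x)) (s, x) :=
    ((hH'.differentiableOn (by simp)).differentiableAt (hO.mem_nhds hq)).hasFDerivAt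
  have hsymm : IsSymmSndFDerivAt ℝ H (s, x) :=
    (hH.contDiffAt (hO.mem_nhds hq)).isSymmSndFDerivAt (by
      rw [minSmoothness_of_isRCLikeNormedField]; exact WithTop.coe_le_coe.2 le_top)
  have h1 : HasDerivAt (fun t => fderiv ℝ H (t, x) (0, 1))
      (fderiv ℝ (fderiv ℝ H) (s, x) (1, 0) (0, 1)) s :=
    (ContinuousLinearMap.apply ℝ ℝ ((0 : ℝ), (1 : ℝ))).hasFDerivAt.comp_hasDerivAt s
      (hd.comp_hasDerivAt s ((hasDerivAt_id s).prodMk (hasDerivAt_const s x)))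
  have h2 : HasDerivAt (fun y => fderiv ℝ H (s, y) (1, 0))
      (fderiv ℝ (fderiv ℝ H) (s, x) (0, 1) (1, 0)) x :=
    (ContinuousLinearMap.apply ℝ ℝ ((1 : ℝ), (0 : ℝ))).hasFDerivAt.comp_hasDerivAt x
      (hd.comp_hasDerivAt x ((hasDerivAt_const x s).prodMk (hasDerivAt_id x)))
  have e1 : (fun t => deriv (fun y => H (t, y)) x) =ᶠ[nhds s] fun t => fderiv ℝ H (t, x) (0, 1) := by
    have : Continuous fun t : ℝ => (t, x) := by fun_prop
    filter_upwards [this.continuousAt.preimage_mem_nhds (hO.mem_nhds hq)] with t ht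
    exact (hasDerivAt_snd_of_contDiffOn hO hH ht).deriv
  have e2 : (fun y => deriv (fun t => H (t, y)) s) =ᶠ[nhds x] fun y => fderiv ℝ H (s, y) (1, 0) := by
    have : Continuous fun y : ℝ => (s, y) := by fun_prop
    filter_upwards [this.continuousAt.preimage_mem_nhds (hO.mem_nhds hq)] with y hy
    exact (hasDerivAt_fst_of_contDiffOn hO hH hy).deriv
  rw [e2.deriv_eq, h2.deriv, hsymm]
  exact h1.congr_of_eventuallyEq e1

/-- Differentiation under the integral sign for a smooth integrand. -/
theorem hasDerivAt_integral_of_contDiffOn {O : Set ℝ} (hO : IsOpen O) {Θ : ℝ × ℝ → ℝ}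
    (hΘ : ContDiffOn ℝ ∞ Θ (O ×ˢ univ)) {s : ℝ} (hs : s ∈ O) {Θ' : ℝ → ℝ}
    (hd : ∀ x, HasDerivAt (fun t => Θ (t, x)) (Θ' x) s) :
    HasDerivAt (fun t => ∫ x in (0 : ℝ)..1, Θ (t, x)) (∫ x in (0 : ℝ)..1, Θ' x) s := by
  have hoo : IsOpen (O ×ˢ (univ : Set ℝ)) := hO.prod isOpen_univ
  have h := (hasFDerivAt_parametric_intervalIntegral hO (hΘ.of_le (by simp)) hs 0 1).hasDerivAt
  refine h.congr_deriv ?_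
  have hcont : Continuous fun x => (fderiv ℝ Θ (s, x)).comp (ContinuousLinearMap.inl ℝ ℝ ℝ) := by
    have h1 : ContinuousOn (fun q => (fderiv ℝ Θ q).comp (ContinuousLinearMap.inl ℝ ℝ ℝ))
      (O ×ˢ univ) := (hΘ.continuousOn_fderiv_of_isOpen hoo (by simp)).clm_comp continuousOn_const
    exact h1.comp_continuous (by fun_prop) fun x => ⟨hs, mem_univ _⟩
  rw [ContinuousLinearMap.intervalIntegral_apply (hcont.intervalIntegrable 0 1)]
  refine intervalIntegral.integral_congr fun x _ => ?_
  have := (hasDerivAt_fst_of_contDiffOn hoo hΘ (s := s) (x := x) ⟨hs, mem_univ _⟩).unique (hd x)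
  simpa using this

end MixedDerivatives

/-! ### Loops and their variations -/

section Loops

variable {n : ℕ} {U : Set (Vec n)}

namespace IsLoop

variable {u w p q : ℝ → Vec n}

theorem coord (hu : IsLoop U u) (i : Fin n) : SmoothPeriodic fun x => u x i :=
  ⟨contDiff_pi.1 hu.smooth i, fun x => congrFun (hu.periodic x) i⟩

theorem of_coord (h : ∀ i, SmoothPeriodic fun x => p x i) : IsLoop univ p :=
  ⟨contDiff_pi.2 fun i => (h i).smooth, fun x => funext fun i => (h i).periodic x,
    fun _ => mem_univ _⟩

theorem comp_smoothPeriodic (hu : IsLoop U u) {φ : Vec n → ℝ} (hφ : ContDiffOn ℝ ∞ φ U) :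
    SmoothPeriodic fun x => φ (u x) :=
  ⟨contDiffOn_univ.1 (hφ.comp hu.smooth.contDiffOn fun x _ => hu.mem x), fun x => by
    simp only [hu.periodic x]⟩

theorem hasDerivAt_comp (hU : IsOpen U) (hu : IsLoop U u) {φ : Vec n → ℝ}
    (hφ : ContDiffOn ℝ ∞ φ U) (x : ℝ) : HasDerivAt (fun x => φ (u x))
      (∑ l, pd l φ (u x) * deriv (fun y => u y l) x) x := by
  have h1 := (hφ.diffAt hU (hu.mem x)).hasFDerivAt
  have h2 : HasDerivAt u (fun l => deriv (fun y => u y l) x) x :=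
    hasDerivAt_pi.2 fun l => (hu.coord l).hasDerivAt x
  refine (h1.comp_hasDerivAt x h2).congr_deriv ?_
  rw [fderiv_apply_eq_sum_pd]
  exact Finset.sum_congr rfl fun l _ => mul_comm _ _

end IsLoop

/-- A smooth perturbation of a loop in an open set stays in the set for small parameters. -/
theorem exists_isLoopFamily (hU : IsOpen U) {k : ℕ} {u : ℝ → Vec n} (hu : IsLoop U u)
    {w : Fin k → ℝ → Vec n} (hw : ∀ i, IsLoop univ (w i)) :
    ∃ S : Set (Fin k → ℝ), IsOpen S ∧ 0 ∈ S ∧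
      IsLoopFamily U S fun s x => u x + ∑ i, s i • w i x := by
  have hsm : ContDiff ℝ ∞ fun q : (Fin k → ℝ) × ℝ => u q.2 + ∑ i, q.1 i • w i q.2 := by
    refine (hu.smooth.comp contDiff_snd).add (ContDiff.sum fun i _ => ?_)
    exact ((contDiff_apply ℝ ℝ i).comp contDiff_fst).smul ((hw i).smooth.comp contDiff_snd)
  have hO : IsOpen ((fun q : (Fin k → ℝ) × ℝ => u q.2 + ∑ i, q.1 i • w i q.2) ⁻¹' U) :=
    hU.preimage hsm.continuous
  -- Compactness of one period gives a parameter neighbourhood that works for all `x` in it;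
  -- periodicity extends this to the whole line.
  obtain ⟨S, V, hS, -, h0, hV, hSV⟩ := generalized_tube_lemma
    (isCompact_singleton (x := (0 : Fin k → ℝ))) (isCompact_Icc (a := (0 : ℝ)) (b := 1)) hO (by
      rintro ⟨s, x⟩ ⟨hs, -⟩
      rw [mem_singleton_iff] at hs
      subst hs
      simpa using hu.mem x)
  have hper : ∀ s : Fin k → ℝ, Function.Periodic (fun x => u x + ∑ i, s i • w i x) 1 := fun s x => by
    simp only [hu.periodic x, fun i => (hw i).periodic x]
  refine ⟨S, hS, h0 rfl, hsm.contDiffOn, fun s _ => hper s, fun s hs x => ?_⟩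
  obtain ⟨y, hy, hxy⟩ := (hper s).exists_mem_Ico₀ one_pos x
  exact Eq.mpr (congrArg (· ∈ U) hxy) (hSV (show (s, y) ∈ S ×ˢ V from ⟨hs, hV ⟨hy.1, hy.2.le⟩⟩))

/-- A parameter neighbourhood for the variation `u + ε w` of a loop. -/
theorem exists_variation (hU : IsOpen U) {u w : ℝ → Vec n} (hu : IsLoop U u)
    (hw : IsLoop univ w) : ∃ O : Set ℝ, IsOpen O ∧ (0 : ℝ) ∈ O ∧
      (∀ ε ∈ O, IsLoop U fun x => u x + ε • w x) ∧
      ∀ (F : SmoothFunctional U) (i : Fin n),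
        ContDiffOn ℝ ∞ (fun q : ℝ × ℝ => F.grad (fun x => u x + q.1 • w x) q.2 i) (O ×ˢ univ) ∧
        ∀ ε ∈ O, Function.Periodic (fun x => F.grad (fun x => u x + ε • w x) x i) 1 := by
  obtain ⟨S, hS, h0, hfam⟩ := exists_isLoopFamily hU hu (w := fun _ : Fin 1 => w) fun _ => hw
  simp only [Finset.univ_unique, Fin.default_eq_zero, Fin.isValue, Finset.sum_singleton] at hfam
  have hc : ContDiff ℝ ∞ fun (ε : ℝ) (_ : Fin 1) => ε := contDiff_pi.2 fun _ => contDiff_id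
  refine ⟨(fun (ε : ℝ) (_ : Fin 1) => ε) ⁻¹' S, hS.preimage hc.continuous, h0, fun ε hε => ?_,
    fun F i => ⟨?_, fun ε hε x => ?_⟩⟩
  · refine ⟨?_, hfam.periodic _ hε, hfam.mem _ hε⟩
    exact hu.smooth.add (hw.smooth.const_smul ε)
  · have h1 := contDiffOn_pi.1 (F.grad_smooth 1 S _ hS hfam).smooth i
    exact h1.comp ((hc.comp contDiff_fst).prodMk contDiff_snd).contDiffOn
      fun q hq => ⟨hq.1, mem_univ _⟩
  · exact congrFun ((F.grad_smooth 1 S _ hS hfam).periodic _ hε x) i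

namespace SmoothFunctional

/-- The derivative of the gradient of `F` at `u` in direction `w`. -/
def dgrad (F : SmoothFunctional U) (u w : ℝ → Vec n) : ℝ → Vec n :=
  fun x i => deriv (fun ε : ℝ => F.grad (fun y => u y + ε • w y) x i) 0

/-- A single loop is a family with no parameters, so `grad_smooth` applies with `k = 0`. -/
theorem isLoop_grad (F : SmoothFunctional U) {u : ℝ → Vec n} (hu : IsLoop U u) :
    IsLoop univ (F.grad u) := by
  have hfam : IsLoopFamily U univ fun _ : Fin 0 → ℝ => u :=
    ⟨(hu.smooth.comp contDiff_snd).contDiffOn, fun _ _ => hu.periodic, fun _ _ => hu.mem⟩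
  have h := F.grad_smooth 0 univ _ isOpen_univ hfam
  refine ⟨?_, h.periodic 0 (mem_univ _), fun _ => mem_univ _⟩
  exact contDiffOn_univ.1 (h.smooth.comp (contDiff_const.prodMk contDiff_id).contDiffOn
    fun x _ => ⟨mem_univ (0 : Fin 0 → ℝ), mem_univ _⟩)

theorem isLoop_dgrad (hU : IsOpen U) (F : SmoothFunctional U) {u w : ℝ → Vec n} (hu : IsLoop U u)
    (hw : IsLoop univ w) : IsLoop univ (F.dgrad u w) := by
  obtain ⟨O, hO, h0, -, hF⟩ := exists_variation hU hu hw
  refine IsLoop.of_coord fun i => ⟨?_, fun x => ?_⟩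
  · have h1 := contDiffOn_deriv_fst (hO.prod isOpen_univ) (hF F i).1
    exact contDiffOn_univ.1 (h1.comp ((contDiff_const (c := (0 : ℝ))).prodMk
      contDiff_id).contDiffOn fun x _ => ⟨h0, mem_univ _⟩)
  · refine Filter.EventuallyEq.deriv_eq ?_
    filter_upwards [hO.mem_nhds h0] with ε hε
    exact (hF F i).2 ε hε x

/-- The second variation of a smooth functional is symmetric. -/
theorem dgrad_symm (hU : IsOpen U) (F : SmoothFunctional U) {u v w : ℝ → Vec n} (hu : IsLoop U u)
    (hv : IsLoop univ v) (hw : IsLoop univ w) :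
    ∫ x in (0 : ℝ)..1, ∑ i, F.dgrad u w x i * v x i
      = ∫ x in (0 : ℝ)..1, ∑ i, F.dgrad u v x i * w x i := by
  have first : ∀ {v w : ℝ → Vec n}, IsLoop univ v → IsLoop univ w →
      HasDerivAt (fun t : ℝ => deriv (fun s : ℝ => F.val fun x => u x + t • w x + s • v x) 0)
        (∫ x in (0 : ℝ)..1, ∑ i, F.dgrad u w x i * v x i) 0 := by
    intro v w hv hw
    obtain ⟨O, hO, h0, hl, hF⟩ := exists_variation hU hu hw
    have hd := hasDerivAt_integral_of_contDiffOn hO (s := 0)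
      (Θ := fun q => ∑ i, F.grad (fun x => u x + q.1 • w x) q.2 i * v q.2 i)
      (Θ' := fun x => ∑ i, F.dgrad u w x i * v x i)
      (ContDiffOn.sum fun i _ => (hF F i).1.mul
        ((hv.coord i).smooth.comp contDiff_snd).contDiffOn) h0 (fun x => by
        refine HasDerivAt.fun_sum fun i _ => ?_
        have := hasDerivAt_fst_of_contDiffOn (hO.prod isOpen_univ) (hF F i).1 (s := 0) (x := x)
          ⟨h0, mem_univ _⟩
        exact this.differentiableAt.hasDerivAt.mul_const (v x i))
    refine hd.congr_of_eventuallyEq ?_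
    filter_upwards [hO.mem_nhds h0] with t ht
    exact (F.hasDerivAt _ (hl t ht) v hv).deriv
  -- Both integrals are mixed partial derivatives at the origin of the value of `F` on the
  -- two-parameter family `u + s v + t w`, taken in the two possible orders.
  obtain ⟨S, hS, h0, hfam⟩ := exists_isLoopFamily hU hu (w := ![v, w]) (fun i => by
    fin_cases i
    · exact hv
    · exact hw)
  simp only [Fin.sum_univ_two, Fin.isValue, cons_val_zero, cons_val_one] at hfam
  have hval := F.val_smooth 2 S _ hS hfam
  have hmap : ContDiff ℝ ∞ fun q : ℝ × ℝ => (![q.2, q.1] : Fin 2 → ℝ) :=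
    contDiff_pi.2 fun i => by
      fin_cases i
      · exact contDiff_snd
      · exact contDiff_fst
  have hH : ContDiffOn ℝ ∞ (fun q : ℝ × ℝ => F.val fun x => u x + (q.2 • v x + q.1 • w x))
      ((fun q : ℝ × ℝ => (![q.2, q.1] : Fin 2 → ℝ)) ⁻¹' S) :=
    hval.comp hmap.contDiffOn fun q hq => hq
  have hm := hasDerivAt_mixed (hS.preimage hmap.continuous) hH (s := 0) (x := 0) (by
    have : (![0, 0] : Fin 2 → ℝ) = 0 := by ext i; fin_cases i <;> rfl
    simpa [this] using h0)
  have e1 := (first hv hw).deriv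
  have e2 := (first hw hv).deriv
  have e3 := hm.deriv
  have a1 : ∀ (t s : ℝ) (x : ℝ), u x + t • w x + s • v x = u x + (s • v x + t • w x) :=
    fun t s x => by abel
  have a2 : ∀ (t s : ℝ) (x : ℝ), u x + t • v x + s • w x = u x + (t • v x + s • w x) :=
    fun t s x => by abel
  simp only [a1] at e1
  simp only [a2] at e2
  rw [← e1, ← e2]
  exact e3

end SmoothFunctional

/-- The linear functional `u ↦ ∫ p · u dx`. -/
def linearFunctional (p : ℝ → Vec n) (hp : IsLoop univ p) : SmoothFunctional U where
  val u := ∫ x in (0 : ℝ)..1, ∑ i, p x i * u x i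
  grad _ := p
  val_smooth k S γ hS hγ :=
    contDiffOn_parametric_intervalIntegral hS 0 1 (f := fun q => ∑ i, p q.2 i * γ q.1 q.2 i)
      (ContDiffOn.sum fun i _ => ((hp.coord i).smooth.comp contDiff_snd).contDiffOn.mul
        (contDiffOn_pi.1 hγ.smooth i))
  grad_smooth k S γ _ _ := ⟨(hp.smooth.comp contDiff_snd).contDiffOn, fun _ _ => hp.periodic,
    fun _ _ _ => mem_univ _⟩
  hasDerivAt u hu v hv := by
    have hi : SmoothPeriodic fun x => ∑ i, p x i * u x i :=
      SmoothPeriodic.sum _ fun i _ => (hp.coord i).mul (hu.coord i)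
    have hj : SmoothPeriodic fun x => ∑ i, p x i * v x i :=
      SmoothPeriodic.sum _ fun i _ => (hp.coord i).mul (hv.coord i)
    have h : ∀ ε : ℝ, ∫ x in (0 : ℝ)..1, ∑ i, p x i * (u x + ε • v x) i
        = (∫ x in (0 : ℝ)..1, ∑ i, p x i * u x i)
          + ε * ∫ x in (0 : ℝ)..1, ∑ i, p x i * v x i := fun ε => by
      rw [← intervalIntegral.integral_const_mul, ← intervalIntegral.integral_add
        (hi.intervalIntegrable 0 1) ((hj.intervalIntegrable 0 1).const_mul ε)]
      refine intervalIntegral.integral_congr fun x _ => ?_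
      simp only [Pi.add_apply, Pi.smul_apply, smul_eq_mul]
      rw [Finset.mul_sum, ← Finset.sum_add_distrib]
      exact Finset.sum_congr rfl fun i _ => by ring
    simp only [h]
    simpa using ((hasDerivAt_id (0 : ℝ)).mul_const
      (∫ x in (0 : ℝ)..1, ∑ i, p x i * v x i)).const_add (∫ x in (0 : ℝ)..1, ∑ i, p x i * u x i)

end Loops

namespace HydroBracket

variable {n : ℕ} {U : Set (Vec n)}

/-! ### The bracket of functionals and its first variation -/

/-- The coefficients of the bracket are smooth. -/
structure SmoothCoeff (U : Set (Vec n)) (P : HydroBracket n) : Prop where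
  smooth_g : ∀ i j, ContDiffOn ℝ ∞ (fun x => P.g x i j) U
  smooth_b : ∀ i j k, ContDiffOn ℝ ∞ (P.b i j k) U

/-- The conditions on the coefficients that express skew-symmetry of the bracket. -/
structure SkewCoeff (U : Set (Vec n)) (P : HydroBracket n) : Prop where
  symm : ∀ x ∈ U, ∀ i j, P.g x i j = P.g x j i
  compat : ∀ x ∈ U, ∀ i j k, pd k (fun y => P.g y i j) x = P.b i j k x + P.b j i k x

variable {P : HydroBracket n}

/-- The derivative of the operator `op` in the field `u`, in direction `w`. -/
def opDeriv (P : HydroBracket n) (u w p : ℝ → Vec n) : ℝ → Vec n := fun x i =>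
  ∑ j, (∑ l, pd l (fun y => P.g y i j) (u x) * w x l) * deriv (fun y => p y j) x
    + ∑ j, ∑ k, ((∑ l, pd l (P.b i j k) (u x) * w x l) * deriv (fun y => u y k) x
      + P.b i j k (u x) * deriv (fun y => w y k) x) * p x j

/-- The covector field along `u` whose pairing with a variation `w` of `u` is, up to a total
derivative, the pairing of `a` with the derivative of the operator in direction `w`, applied
to `b`. -/
def opGrad (P : HydroBracket n) (u a b : ℝ → Vec n) : ℝ → Vec n := fun x l =>
  ∑ i, ∑ j, (a x i * deriv (fun y => b y j) x * P.b j i l (u x)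
    - deriv (fun y => a y i) x * b x j * P.b i j l (u x)
    + a x i * b x j *
      ∑ k, (pd l (P.b i j k) (u x) - pd k (P.b i j l) (u x)) * deriv (fun y => u y k) x)

/-- The density of the Jacobiator on covector fields along `u`. -/
def jacobiator (P : HydroBracket n) (u a b c : ℝ → Vec n) (x : ℝ) : ℝ :=
  ∑ l, (P.op u c x l * P.opGrad u a b x l + P.op u a x l * P.opGrad u b c x l
    + P.op u b x l * P.opGrad u c a x l)

theorem smoothPeriodic_pd_comp (hU : IsOpen U) {φ : Vec n → ℝ} (hφ : ContDiffOn ℝ ∞ φ U)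
    {u : ℝ → Vec n} (hu : IsLoop U u) (l : Fin n) : SmoothPeriodic fun x => pd l φ (u x) :=
  hu.comp_smoothPeriodic (hφ.pd_smooth hU l)

theorem isLoop_op (hP : P.SmoothCoeff U) {u p : ℝ → Vec n} (hu : IsLoop U u)
    (hp : IsLoop univ p) : IsLoop univ (P.op u p) := by
  refine IsLoop.of_coord fun i => ?_
  unfold op
  exact (SmoothPeriodic.sum _ fun j _ => (hu.comp_smoothPeriodic (hP.smooth_g i j)).mul
    (hp.coord j).deriv).add (SmoothPeriodic.sum _ fun j _ => SmoothPeriodic.sum _ fun k _ =>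
    ((hu.comp_smoothPeriodic (hP.smooth_b i j k)).mul (hu.coord k).deriv).mul (hp.coord j))

theorem isLoop_opDeriv (hU : IsOpen U) (hP : P.SmoothCoeff U) {u w p : ℝ → Vec n}
    (hu : IsLoop U u) (hw : IsLoop univ w) (hp : IsLoop univ p) :
    IsLoop univ (P.opDeriv u w p) := by
  refine IsLoop.of_coord fun i => ?_
  unfold opDeriv
  exact (SmoothPeriodic.sum _ fun j _ => (SmoothPeriodic.sum _ fun l _ =>
      (smoothPeriodic_pd_comp hU (hP.smooth_g i j) hu l).mul (hw.coord l)).mul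
        (hp.coord j).deriv).add
    (SmoothPeriodic.sum _ fun j _ => SmoothPeriodic.sum _ fun k _ =>
      (((SmoothPeriodic.sum _ fun l _ =>
        (smoothPeriodic_pd_comp hU (hP.smooth_b i j k) hu l).mul (hw.coord l)).mul
        (hu.coord k).deriv).add ((hu.comp_smoothPeriodic (hP.smooth_b i j k)).mul
          (hw.coord k).deriv)).mul (hp.coord j))

theorem isLoop_opGrad (hU : IsOpen U) (hP : P.SmoothCoeff U) {u a b : ℝ → Vec n}
    (hu : IsLoop U u) (ha : IsLoop univ a) (hb : IsLoop univ b) :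
    IsLoop univ (P.opGrad u a b) := by
  refine IsLoop.of_coord fun l => ?_
  unfold opGrad
  exact SmoothPeriodic.sum _ fun i _ => SmoothPeriodic.sum _ fun j _ =>
    ((((ha.coord i).mul (hb.coord j).deriv).mul (hu.comp_smoothPeriodic (hP.smooth_b j i l))).sub
      (((ha.coord i).deriv.mul (hb.coord j)).mul
        (hu.comp_smoothPeriodic (hP.smooth_b i j l)))).add
      (((ha.coord i).mul (hb.coord j)).mul (SmoothPeriodic.sum _ fun k _ =>
        ((smoothPeriodic_pd_comp hU (hP.smooth_b i j k) hu l).sub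
          (smoothPeriodic_pd_comp hU (hP.smooth_b i j l) hu k)).mul (hu.coord k).deriv))

theorem smoothPeriodic_dot {p q : ℝ → Vec n} (hp : IsLoop univ p) (hq : IsLoop univ q) :
    SmoothPeriodic fun x => ∑ i, p x i * q x i :=
  SmoothPeriodic.sum _ fun i _ => (hp.coord i).mul (hq.coord i)

/-- The first variation of the bracket of two functionals. -/
theorem hasDerivAt_bracket (hU : IsOpen U) (hP : P.SmoothCoeff U) (F G : SmoothFunctional U)
    {u w : ℝ → Vec n} (hu : IsLoop U u) (hw : IsLoop univ w) :
    HasDerivAt (fun ε : ℝ => P.bracket F G fun x => u x + ε • w x)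
      (∫ x in (0 : ℝ)..1, ∑ i, (F.dgrad u w x i * P.op u (G.grad u) x i
        + F.grad u x i * (P.opDeriv u w (G.grad u) x i + P.op u (G.dgrad u w) x i))) 0 := by
  obtain ⟨O, hO, h0, hl, hF⟩ := exists_variation hU hu hw
  have hOu : IsOpen (O ×ˢ (univ : Set ℝ)) := hO.prod isOpen_univ
  have hfield : ContDiff ℝ ∞ fun q : ℝ × ℝ => u q.2 + q.1 • w q.2 :=
    (hu.smooth.comp contDiff_snd).add (contDiff_fst.smul (hw.smooth.comp contDiff_snd))
  have hfieldk : ∀ k, ContDiffOn ℝ ∞ (fun q : ℝ × ℝ => (u q.2 + q.1 • w q.2) k)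
      (O ×ˢ (univ : Set ℝ)) := fun k => (contDiff_pi.1 hfield k).contDiffOn
  have hcomp : ∀ {φ : Vec n → ℝ}, ContDiffOn ℝ ∞ φ U →
      ContDiffOn ℝ ∞ (fun q : ℝ × ℝ => φ (u q.2 + q.1 • w q.2)) (O ×ˢ (univ : Set ℝ)) :=
    fun hφ => hφ.comp hfield.contDiffOn fun q hq => (hl q.1 hq.1).mem q.2
  have hgradd : ∀ (K : SmoothFunctional U) (x : ℝ) (i : Fin n), HasDerivAt
      (fun ε : ℝ => K.grad (fun y => u y + ε • w y) x i) (K.dgrad u w x i) 0 := fun K x i =>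
    (hasDerivAt_fst_of_contDiffOn hOu (hF K i).1 (s := 0) (x := x)
      ⟨h0, mem_univ _⟩).differentiableAt.hasDerivAt
  have hcompd : ∀ {φ : Vec n → ℝ}, ContDiffOn ℝ ∞ φ U → ∀ x : ℝ, HasDerivAt
      (fun ε : ℝ => φ (u x + ε • w x)) (∑ l, pd l φ (u x) * w x l) 0 := fun {φ} hφ x => by
    have h1 : HasFDerivAt φ (fderiv ℝ φ (u x)) (u x + (0 : ℝ) • w x) := by
      rw [zero_smul, add_zero]
      exact (hφ.diffAt hU (hu.mem x)).hasFDerivAt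
    have h2 : HasDerivAt (fun ε : ℝ => u x + ε • w x) (w x) 0 := by
      simpa using ((hasDerivAt_id (0 : ℝ)).smul_const (w x)).const_add (u x)
    refine (h1.comp_hasDerivAt 0 h2).congr_deriv ?_
    rw [fderiv_apply_eq_sum_pd]
    exact Finset.sum_congr rfl fun l _ => mul_comm _ _
  have hfd : ∀ (x : ℝ) (k : Fin n), HasDerivAt
      (fun ε : ℝ => deriv (fun y => (u y + ε • w y) k) x) (deriv (fun y => w y k) x) 0 :=
    fun x k => by
    have h : ∀ ε : ℝ, deriv (fun y => (u y + ε • w y) k) x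
        = deriv (fun y => u y k) x + ε * deriv (fun y => w y k) x := fun ε =>
      (((hu.coord k).hasDerivAt x).add (((hw.coord k).hasDerivAt x).const_mul ε)).deriv
    simp only [h]
    simpa using ((hasDerivAt_id (0 : ℝ)).mul_const (deriv (fun y => w y k) x)).const_add
      (deriv (fun y => u y k) x)
  have hu0 : (fun x => u x + (0 : ℝ) • w x) = u := by funext x; simp
  refine hasDerivAt_integral_of_contDiffOn hO (s := 0)
    (Θ := fun q => ∑ i, F.grad (fun x => u x + q.1 • w x) q.2 i
      * P.op (fun x => u x + q.1 • w x) (G.grad fun x => u x + q.1 • w x) q.2 i) ?_ h0 ?_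
  · refine ContDiffOn.sum fun i _ => (hF F i).1.mul ?_
    unfold op
    refine (ContDiffOn.sum fun j _ => (hcomp (hP.smooth_g i j)).mul
      (contDiffOn_deriv_snd hOu (hF G j).1)).add (ContDiffOn.sum fun j _ =>
      ContDiffOn.sum fun k _ => ((hcomp (hP.smooth_b i j k)).mul
        (contDiffOn_deriv_snd hOu (hfieldk k))).mul (hF G j).1)
  · intro x
    have hop : ∀ i, HasDerivAt (fun ε : ℝ => P.op (fun x => u x + ε • w x)
        (G.grad fun x => u x + ε • w x) x i)
        (P.opDeriv u w (G.grad u) x i + P.op u (G.dgrad u w) x i) 0 := fun i => by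
      have h1 : ∀ j, HasDerivAt (fun ε : ℝ => P.g (u x + ε • w x) i j
          * deriv (fun y => G.grad (fun x => u x + ε • w x) y j) x)
          ((∑ l, pd l (fun y => P.g y i j) (u x) * w x l) * deriv (fun y => G.grad u y j) x
            + P.g (u x) i j * deriv (fun y => G.dgrad u w y j) x) 0 := fun j => by
        have := (hcompd (hP.smooth_g i j) x).mul
          (hasDerivAt_mixed hOu (hF G j).1 (s := 0) (x := x) ⟨h0, mem_univ _⟩)
        refine this.congr_deriv ?_
        simp only [zero_smul, add_zero]
        rfl
      have h2 : ∀ j k, HasDerivAt (fun ε : ℝ => P.b i j k (u x + ε • w x)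
          * deriv (fun y => (u y + ε • w y) k) x * G.grad (fun x => u x + ε • w x) x j)
          (((∑ l, pd l (P.b i j k) (u x) * w x l) * deriv (fun y => u y k) x
            + P.b i j k (u x) * deriv (fun y => w y k) x) * G.grad u x j
            + P.b i j k (u x) * deriv (fun y => u y k) x * G.dgrad u w x j) 0 := fun j k => by
        have := ((hcompd (hP.smooth_b i j k) x).mul (hfd x k)).mul (hgradd G x j)
        refine this.congr_deriv ?_
        simp only [Pi.mul_apply, zero_smul, add_zero]
      refine ((HasDerivAt.fun_sum fun j (_ : j ∈ Finset.univ) => h1 j).add (HasDerivAt.fun_sum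
        fun j (_ : j ∈ Finset.univ) => HasDerivAt.fun_sum
        fun k (_ : k ∈ Finset.univ) => h2 j k)).congr_deriv ?_
      simp only [opDeriv, op, Finset.sum_add_distrib]
      ring
    refine (HasDerivAt.fun_sum fun i (_ : i ∈ Finset.univ) =>
      (hgradd F x i).mul (hop i)).congr_deriv ?_
    simp only [hu0]

/-! ### Integration by parts -/

/-- The pointwise algebra behind an integration by parts that frees `w` of its derivative. Primes
and `v` stand for `x`-derivatives, `dB i j k l` for the derivative of `b i j k` in direction `l`,
and the last sum is the total derivative of `∑ aᵢ B^{ij}_l wˡ bⱼ`. Metric compatibility turns the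
remaining `b'` terms into `B j i l`. -/
theorem sum_opDeriv_identity (a a' b b' w w' v : Fin n → ℝ) (dg : Fin n → Fin n → Fin n → ℝ)
    (B : Fin n → Fin n → Fin n → ℝ) (dB : Fin n → Fin n → Fin n → Fin n → ℝ)
    (h : ∀ i j l, dg i j l = B i j l + B j i l) :
    ∑ i, a i * (∑ j, (∑ l, dg i j l * w l) * b' j
      + ∑ j, ∑ k, ((∑ l, dB i j k l * w l) * v k + B i j k * w' k) * b j)
    = ∑ l, w l * ∑ i, ∑ j, (a i * b' j * B j i l - a' i * b j * B i j l
        + a i * b j * ∑ k, (dB i j k l - dB i j l k) * v k)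
      + ∑ i, ∑ j, ∑ l, (a' i * (B i j l * (w l * b j)) + a i * ((∑ k, dB i j l k * v k)
        * (w l * b j) + B i j l * (w' l * b j + w l * b' j))) := by
  have e1 : ∑ i, a i * (∑ j, (∑ l, dg i j l * w l) * b' j
      + ∑ j, ∑ k, ((∑ l, dB i j k l * w l) * v k + B i j k * w' k) * b j)
      = ∑ i, ∑ j, ∑ l, (a i * (dg i j l * w l * b' j + (∑ k, dB i j k l * v k) * w l * b j
        + B i j l * w' l * b j)) := by
    refine Finset.sum_congr rfl fun i _ => ?_
    rw [← Finset.sum_add_distrib, Finset.mul_sum]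
    refine Finset.sum_congr rfl fun j _ => ?_
    have : ∑ k, ((∑ l, dB i j k l * w l) * v k + B i j k * w' k) * b j
        = ∑ l, ((∑ k, dB i j k l * v k) * w l * b j + B i j l * w' l * b j) := by
      simp only [add_mul, Finset.sum_add_distrib, Finset.sum_mul]
      rw [Finset.sum_comm]
      congr 1
      exact Finset.sum_congr rfl fun l _ => Finset.sum_congr rfl fun k _ => by ring
    rw [this, Finset.sum_mul, ← Finset.sum_add_distrib, Finset.mul_sum]
    exact Finset.sum_congr rfl fun l _ => by ring
  have e2 : ∑ l, w l * ∑ i, ∑ j, (a i * b' j * B j i l - a' i * b j * B i j l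
        + a i * b j * ∑ k, (dB i j k l - dB i j l k) * v k)
      = ∑ i, ∑ j, ∑ l, w l * (a i * b' j * B j i l - a' i * b j * B i j l
        + a i * b j * ∑ k, (dB i j k l - dB i j l k) * v k) := by
    have : ∀ (l : Fin n) (f : Fin n → Fin n → ℝ),
        w l * ∑ i, ∑ j, f i j = ∑ i, ∑ j, w l * f i j := fun l f => by
      rw [Finset.mul_sum]
      exact Finset.sum_congr rfl fun i _ => Finset.mul_sum _ _ _
    simp only [this]
    rw [Finset.sum_comm]
    exact Finset.sum_congr rfl fun i _ => Finset.sum_comm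
  rw [e1, e2, ← Finset.sum_add_distrib]
  refine Finset.sum_congr rfl fun i _ => ?_
  rw [← Finset.sum_add_distrib]
  refine Finset.sum_congr rfl fun j _ => ?_
  rw [← Finset.sum_add_distrib]
  refine Finset.sum_congr rfl fun l _ => ?_
  simp only [sub_mul, Finset.sum_sub_distrib]
  rw [h]
  ring

theorem integral_opDeriv (hU : IsOpen U) (hP : P.SmoothCoeff U) (hS : P.SkewCoeff U)
    {u w a b : ℝ → Vec n} (hu : IsLoop U u) (hw : IsLoop univ w) (ha : IsLoop univ a)
    (hb : IsLoop univ b) :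
    ∫ x in (0 : ℝ)..1, ∑ i, a x i * P.opDeriv u w b x i
      = ∫ x in (0 : ℝ)..1, ∑ l, w x l * P.opGrad u a b x l := by
  have h1 := smoothPeriodic_dot ha (isLoop_opDeriv hU hP hu hw hb)
  have h2 := smoothPeriodic_dot hw (isLoop_opGrad hU hP hu ha hb)
  rw [← sub_eq_zero, ← intervalIntegral.integral_sub (h1.intervalIntegrable 0 1)
    (h2.intervalIntegrable 0 1)]
  have hQ : SmoothPeriodic fun x =>
      ∑ i, ∑ j, ∑ l, a x i * (P.b i j l (u x) * (w x l * b x j)) :=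
    SmoothPeriodic.sum _ fun i _ => SmoothPeriodic.sum _ fun j _ => SmoothPeriodic.sum _ fun l _ =>
      (ha.coord i).mul ((hu.comp_smoothPeriodic (hP.smooth_b i j l)).mul
        ((hw.coord l).mul (hb.coord j)))
  refine hQ.integral_eq_zero_of_hasDerivAt fun x => ?_
  refine (HasDerivAt.fun_sum fun i (_ : i ∈ Finset.univ) => HasDerivAt.fun_sum
    fun j (_ : j ∈ Finset.univ) => HasDerivAt.fun_sum fun l (_ : l ∈ Finset.univ) =>
      ((ha.coord i).hasDerivAt x).mul ((hu.hasDerivAt_comp hU (hP.smooth_b i j l) x).mul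
        (((hw.coord l).hasDerivAt x).mul ((hb.coord j).hasDerivAt x)))).congr_deriv ?_
  rw [eq_sub_iff_add_eq, add_comm]
  exact (sum_opDeriv_identity (a x) (fun i => deriv (fun y => a y i) x) (b x)
    (fun i => deriv (fun y => b y i) x) (w x) (fun i => deriv (fun y => w y i) x)
    (fun i => deriv (fun y => u y i) x) (fun i j l => pd l (fun y => P.g y i j) (u x))
    (fun i j k => P.b i j k (u x)) (fun i j k l => pd l (P.b i j k) (u x))
    (fun i j l => hS.compat _ (hu.mem x) i j l)).symm

/-- Under the skew-symmetry conditions the operator is skew-adjoint. -/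
theorem integral_op_skew (hU : IsOpen U) (hP : P.SmoothCoeff U) (hS : P.SkewCoeff U)
    {u p q : ℝ → Vec n} (hu : IsLoop U u) (hp : IsLoop univ p) (hq : IsLoop univ q) :
    ∫ x in (0 : ℝ)..1, ∑ i, p x i * P.op u q x i
      = -∫ x in (0 : ℝ)..1, ∑ i, q x i * P.op u p x i := by
  have h1 := smoothPeriodic_dot hp (isLoop_op hP hu hq)
  have h2 := smoothPeriodic_dot hq (isLoop_op hP hu hp)
  rw [← sub_eq_zero, sub_neg_eq_add, ← intervalIntegral.integral_add (h1.intervalIntegrable 0 1)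
    (h2.intervalIntegrable 0 1)]
  -- The sum of the two densities is the derivative of `p · g q`: symmetry of `g` matches the terms
  -- with `p'`, compatibility those with `∂g`.
  have hQ : SmoothPeriodic fun x => ∑ i, ∑ j, p x i * (P.g (u x) i j * q x j) :=
    SmoothPeriodic.sum _ fun i _ => SmoothPeriodic.sum _ fun j _ =>
      (hp.coord i).mul ((hu.comp_smoothPeriodic (hP.smooth_g i j)).mul (hq.coord j))
  refine hQ.integral_eq_zero_of_hasDerivAt fun x => ?_
  refine (HasDerivAt.fun_sum fun i (_ : i ∈ Finset.univ) => HasDerivAt.fun_sum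
    fun j (_ : j ∈ Finset.univ) => ((hp.coord i).hasDerivAt x).mul
      ((hu.hasDerivAt_comp hU (hP.smooth_g i j) x).mul ((hq.coord j).hasDerivAt x))).congr_deriv ?_
  have e : ∀ p q : ℝ → Vec n, ∑ i, p x i * P.op u q x i
      = ∑ i, ∑ j, p x i * (P.g (u x) i j * deriv (fun y => q y j) x
        + (∑ k, P.b i j k (u x) * deriv (fun y => u y k) x) * q x j) := fun p q =>
    Finset.sum_congr rfl fun i _ => by
      rw [op, ← Finset.sum_add_distrib, Finset.mul_sum]
      exact Finset.sum_congr rfl fun j _ => by rw [Finset.sum_mul]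
  rw [e p q, e q p]
  conv_rhs => rw [Finset.sum_comm (f := fun i j => q x i * _)]
  rw [← Finset.sum_add_distrib]
  refine Finset.sum_congr rfl fun i _ => ?_
  rw [← Finset.sum_add_distrib]
  refine Finset.sum_congr rfl fun j _ => ?_
  simp only [hS.compat _ (hu.mem x), add_mul, Finset.sum_add_distrib, hS.symm _ (hu.mem x) j i,
    Pi.mul_apply]
  ring

theorem integral_jacobiator (hU : IsOpen U) (hP : P.SmoothCoeff U)
    {u a b c : ℝ → Vec n} (hu : IsLoop U u) (ha : IsLoop univ a) (hb : IsLoop univ b)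
    (hc : IsLoop univ c) : ∫ x in (0 : ℝ)..1, P.jacobiator u a b c x
      = (∫ x in (0 : ℝ)..1, ∑ l, P.op u c x l * P.opGrad u a b x l)
        + (∫ x in (0 : ℝ)..1, ∑ l, P.op u a x l * P.opGrad u b c x l)
        + ∫ x in (0 : ℝ)..1, ∑ l, P.op u b x l * P.opGrad u c a x l := by
  have h : ∀ {p a b : ℝ → Vec n}, IsLoop univ p → IsLoop univ a → IsLoop univ b →
      IntervalIntegrable (fun x => ∑ l, P.op u p x l * P.opGrad u a b x l) volume 0 1 :=
    fun hp ha hb => (smoothPeriodic_dot (isLoop_op hP hu hp)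
      (isLoop_opGrad hU hP hu ha hb)).intervalIntegrable 0 1
  rw [← intervalIntegral.integral_add (h hc ha hb) (h ha hb hc),
    ← intervalIntegral.integral_add ((h hc ha hb).add (h ha hb hc)) (h hb hc ha)]
  refine intervalIntegral.integral_congr fun x _ => ?_
  simp only [jacobiator, Finset.sum_add_distrib]

/-- The iterated bracket, up to the second variations of the functionals. -/
theorem hasIterated (hU : IsOpen U) (hP : P.SmoothCoeff U) (hS : P.SkewCoeff U)
    (F G H : SmoothFunctional U) {u : ℝ → Vec n} (hu : IsLoop U u) :
    P.HasIterated F G H u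
      ((∫ x in (0 : ℝ)..1, ∑ i, F.dgrad u (P.op u (H.grad u)) x i * P.op u (G.grad u) x i)
        - (∫ x in (0 : ℝ)..1, ∑ i, G.dgrad u (P.op u (H.grad u)) x i * P.op u (F.grad u) x i)
        + ∫ x in (0 : ℝ)..1, ∑ l, P.op u (H.grad u) x l
          * P.opGrad u (F.grad u) (G.grad u) x l) := by
  have hf := F.isLoop_grad hu
  have hg := G.isLoop_grad hu
  have hw := isLoop_op hP hu (H.isLoop_grad hu)
  have hdf := F.isLoop_dgrad hU hu hw
  have hdg := G.isLoop_dgrad hU hu hw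
  refine (hasDerivAt_bracket hU hP F G hu hw).congr_deriv ?_
  have h1 := smoothPeriodic_dot hdf (isLoop_op hP hu hg)
  have h2 := smoothPeriodic_dot hf (isLoop_opDeriv hU hP hu hw hg)
  have h3 := smoothPeriodic_dot hf (isLoop_op hP hu hdg)
  -- Skew-adjointness accounts for the minus sign in front of the second variation of `G`.
  rw [← integral_opDeriv hU hP hS hu hw hf hg, sub_eq_add_neg,
    ← integral_op_skew hU hP hS hu hf hdg,
    ← intervalIntegral.integral_add (h1.intervalIntegrable 0 1) (h3.intervalIntegrable 0 1),
    ← intervalIntegral.integral_add ((h1.add h3).intervalIntegrable 0 1)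
      (h2.intervalIntegrable 0 1)]
  refine intervalIntegral.integral_congr fun x _ => ?_
  simp only [mul_add, Finset.sum_add_distrib]
  ring

/-- A bracket with skew-symmetric coefficients and vanishing Jacobiator is Poisson. -/
theorem isPoisson_of_jacobiator (hU : IsOpen U) (hP : P.SmoothCoeff U) (hS : P.SkewCoeff U)
    (hJ : ∀ u a b c : ℝ → Vec n, IsLoop U u → IsLoop univ a → IsLoop univ b → IsLoop univ c →
      ∫ x in (0 : ℝ)..1, P.jacobiator u a b c x = 0) : P.IsPoisson U where
  skew F G u hu := integral_op_skew hU hP hS hu (F.isLoop_grad hu) (G.isLoop_grad hu)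
  jacobi F G H u hu := by
    refine ⟨_, _, _, hasIterated hU hP hS F G H hu, hasIterated hU hP hS G H F hu,
      hasIterated hU hP hS H F G hu, ?_⟩
    have hf := F.isLoop_grad hu
    have hg := G.isLoop_grad hu
    have hh := H.isLoop_grad hu
    have hJ' := hJ u _ _ _ hu hf hg hh
    rw [integral_jacobiator hU hP hu hf hg hh] at hJ'
    -- Each functional contributes two second-variation terms of opposite sign with their two
    -- directions interchanged; symmetry makes each pair cancel.
    rw [F.dgrad_symm hU hu (isLoop_op hP hu hg) (isLoop_op hP hu hh),
      G.dgrad_symm hU hu (isLoop_op hP hu hf) (isLoop_op hP hu hh),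
      H.dgrad_symm hU hu (isLoop_op hP hu hf) (isLoop_op hP hu hg)]
    linarith

end HydroBracket

namespace HydroBracket

variable {n : ℕ} {U : Set (Vec n)} {P : HydroBracket n}

/-! ### Covector fields with a single component -/

/-- The covector field with `i`-th component `φ` and all other components zero. -/
def single (φ : ℝ → ℝ) (i : Fin n) : ℝ → Vec n := fun x j => if j = i then φ x else 0

theorem isLoop_single {φ : ℝ → ℝ} (hφ : SmoothPeriodic φ) (i : Fin n) :
    IsLoop univ (single φ i) := by
  refine IsLoop.of_coord fun j => ?_
  by_cases h : j = i
  · simpa [single, h] using hφ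
  · simpa [single, h] using SmoothPeriodic.const 0

theorem deriv_single (φ : ℝ → ℝ) (i j : Fin n) (x : ℝ) :
    deriv (fun y => single φ i y j) x = if j = i then deriv φ x else 0 := by
  by_cases h : j = i <;> simp [single, h]

theorem op_single (u : ℝ → Vec n) (φ : ℝ → ℝ) (j : Fin n) (x : ℝ) (l : Fin n) :
    P.op u (single φ j) x l = P.g (u x) l j * deriv φ x
      + (∑ k, P.b l j k (u x) * deriv (fun y => u y k) x) * φ x := by
  simp only [op, deriv_single, mul_ite, mul_zero, Finset.sum_ite_eq', Finset.mem_univ, if_true]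
  rw [Finset.sum_comm]
  simp only [single, mul_ite, mul_zero, Finset.sum_ite_eq', Finset.mem_univ, if_true,
    Finset.sum_mul]

theorem opGrad_single (u : ℝ → Vec n) (φ ψ : ℝ → ℝ) (i j : Fin n) (x : ℝ) (l : Fin n) :
    P.opGrad u (single φ i) (single ψ j) x l = φ x * deriv ψ x * P.b j i l (u x)
      - deriv φ x * ψ x * P.b i j l (u x) + φ x * ψ x *
        ∑ k, (pd l (P.b i j k) (u x) - pd k (P.b i j l) (u x)) * deriv (fun y => u y k) x := by
  simp only [opGrad, deriv_single]
  simp only [single]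
  rw [Finset.sum_eq_single i (fun a _ ha => by simp [ha]) (by simp),
    Finset.sum_eq_single j (fun a _ ha => by simp [ha]) (by simp)]
  simp

/-- Test loops with a prescribed shape near a given point; `ε ≠ 0` allows the factor `ε` to be
cancelled from the resulting identities. -/
theorem exists_loop_through (hU : IsOpen U) {x₀ : Vec n} (hx : x₀ ∈ U) {w : ℝ → Vec n}
    (hw : IsLoop univ w) : ∃ ε : ℝ, ε ≠ 0 ∧ IsLoop U fun x => x₀ + ε • w x := by
  have hc : IsLoop U fun _ => x₀ := ⟨contDiff_const, fun _ => rfl, fun _ => hx⟩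
  obtain ⟨O, hO, h0, hl, -⟩ := exists_variation hU hc hw
  obtain ⟨r, hr, hrO⟩ := Metric.isOpen_iff.1 hO 0 h0
  refine ⟨r / 2, by positivity, hl _ (hrO ?_)⟩
  rw [Metric.mem_ball, Real.dist_eq, sub_zero, abs_of_pos (by positivity)]
  linarith

/-- The component `x₀ + ε f eₘ` of a loop along a coordinate line. -/
theorem deriv_loop_single (x₀ : Vec n) (ε : ℝ) (f : ℝ → ℝ) (m k : Fin n) (x : ℝ) :
    deriv (fun y => (x₀ + ε • single f m y) k) x = if k = m then ε * deriv f x else 0 := by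
  by_cases h : k = m <;> simp [single, h]

/-! ### Necessary conditions -/

/-- Any covector field is the gradient of a linear functional, so skew-symmetry of the bracket is
skew-adjointness of the operator. -/
theorem IsPoisson.skew_integral (hP : P.IsPoisson U) {u p q : ℝ → Vec n} (hu : IsLoop U u)
    (hp : IsLoop univ p) (hq : IsLoop univ q) :
    ∫ x in (0 : ℝ)..1, ∑ i, p x i * P.op u q x i
      = -∫ x in (0 : ℝ)..1, ∑ i, q x i * P.op u p x i :=
  hP.skew (linearFunctional p hp) (linearFunctional q hq) u hu

theorem smoothPeriodic_b_dot (hP : P.SmoothCoeff U) {u : ℝ → Vec n} (hu : IsLoop U u)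
    (i j : Fin n) : SmoothPeriodic fun x => ∑ k, P.b i j k (u x) * deriv (fun y => u y k) x :=
  SmoothPeriodic.sum _ fun k _ => (hu.comp_smoothPeriodic (hP.smooth_b i j k)).mul
    (hu.coord k).deriv

theorem IsPoisson.skew_scalar (hP : P.IsPoisson U) (hs : P.SmoothCoeff U) {u : ℝ → Vec n}
    (hu : IsLoop U u) {φ ψ : ℝ → ℝ} (hφ : SmoothPeriodic φ) (hψ : SmoothPeriodic ψ)
    (i j : Fin n) : ∫ x in (0 : ℝ)..1,
      (φ x * (P.g (u x) i j * deriv ψ x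
        + (∑ k, P.b i j k (u x) * deriv (fun y => u y k) x) * ψ x)
      + ψ x * (P.g (u x) j i * deriv φ x
        + (∑ k, P.b j i k (u x) * deriv (fun y => u y k) x) * φ x)) = 0 := by
  have h := hP.skew_integral hu (isLoop_single hφ i) (isLoop_single hψ j)
  have e : ∀ (φ ψ : ℝ → ℝ) (i j : Fin n) (x : ℝ),
      ∑ a, single φ i x a * P.op u (single ψ j) x a = φ x * (P.g (u x) i j * deriv ψ x
        + (∑ k, P.b i j k (u x) * deriv (fun y => u y k) x) * ψ x) := fun φ ψ i j x => by
    simp only [op_single]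
    rw [Finset.sum_eq_single i (fun a _ ha => by simp [single, ha]) (by simp)]
    simp [single]
  have hi : ∀ {φ ψ : ℝ → ℝ}, SmoothPeriodic φ → SmoothPeriodic ψ → ∀ i j : Fin n,
      SmoothPeriodic fun x => φ x * (P.g (u x) i j * deriv ψ x
        + (∑ k, P.b i j k (u x) * deriv (fun y => u y k) x) * ψ x) := fun hφ hψ i j =>
    hφ.mul (((hu.comp_smoothPeriodic (hs.smooth_g i j)).mul hψ.deriv).add
      ((smoothPeriodic_b_dot hs hu i j).mul hψ))
  simp only [e] at h
  rw [intervalIntegral.integral_add ((hi hφ hψ i j).intervalIntegrable 0 1)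
    ((hi hψ hφ j i).intervalIntegrable 0 1), h, neg_add_cancel]

/-- Skew-symmetry of the bracket along a loop gives the compatibility condition. -/
theorem IsPoisson.deriv_g_eq (hP : P.IsPoisson U) (hs : P.SmoothCoeff U) {u : ℝ → Vec n}
    (hu : IsLoop U u) (i j : Fin n) (x : ℝ) : deriv (fun y => P.g (u y) i j) x
      = (∑ k, P.b i j k (u x) * deriv (fun y => u y k) x)
        + ∑ k, P.b j i k (u x) * deriv (fun y => u y k) x := by
  have hg := hu.comp_smoothPeriodic (hs.smooth_g i j)
  have hb := smoothPeriodic_b_dot hs hu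
  have hf := ((hb i j).add (hb j i)).sub hg.deriv
  have hz := hf.eq_zero_of_integral_mul (fun φ hφ => by
    -- Taking the second test function equal to one leaves a single derivative, on `φ`; it is moved
    -- onto `g` by parts.
    have h := hP.skew_scalar hs hu hφ (SmoothPeriodic.const 1) j i
    have i1 : SmoothPeriodic fun x =>
        (φ x * (P.g (u x) j i * deriv (fun _ => (1 : ℝ)) x
        + (∑ k, P.b j i k (u x) * deriv (fun y => u y k) x) * 1)
      + 1 * (P.g (u x) i j * deriv φ x
        + (∑ k, P.b i j k (u x) * deriv (fun y => u y k) x) * φ x)) := by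
      simp only [deriv_const, mul_zero, zero_add, mul_one, one_mul]
      exact (hφ.mul (hb j i)).add ((hg.mul hφ.deriv).add ((hb i j).mul hφ))
    refine i1.integral_eq_zero_of_eq_sub_deriv (hφ.mul hg) h fun x => ?_
    rw [((hφ.hasDerivAt x).fun_mul (hg.hasDerivAt x)).deriv, deriv_const]
    ring) x
  linarith

/-- Symmetry is seen on the constant loop at `x₀`, where only the `δ'` part of the bracket acts.
Compatibility is seen on a loop that passes through `x₀` at time zero with nonzero velocity along
the `m`-th axis; the sine is used for its nonzero derivative at zero. -/
theorem IsPoisson.skewCoeff (hU : IsOpen U) (hP : P.IsPoisson U) (hs : P.SmoothCoeff U) :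
    P.SkewCoeff U where
  symm x₀ hx i j := by
    have hc : IsLoop U fun _ : ℝ => x₀ := ⟨contDiff_const, fun _ => rfl, fun _ => hx⟩
    have hsin := SmoothPeriodic.sin_two_pi
    have hf := hsin.deriv.mul (SmoothPeriodic.const (P.g x₀ i j - P.g x₀ j i))
    have hz := hf.eq_zero_of_integral_mul (fun φ hφ => by
      have h := hP.skew_scalar hs hc hφ hsin i j
      simp only [deriv_const, mul_zero, Finset.sum_const_zero, zero_mul, add_zero] at h
      have i1 := (hφ.mul ((SmoothPeriodic.const (P.g x₀ i j)).mul hsin.deriv)).add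
        (hsin.mul ((SmoothPeriodic.const (P.g x₀ j i)).mul hφ.deriv))
      refine i1.integral_eq_zero_of_eq_sub_deriv
        ((hφ.mul hsin).mul (SmoothPeriodic.const (P.g x₀ j i))) h fun x => ?_
      rw [(((hφ.hasDerivAt x).fun_mul (hsin.hasDerivAt x)).mul_const (P.g x₀ j i)).deriv]
      ring) 0
    rw [SmoothPeriodic.deriv_sin_two_pi, mul_zero, Real.cos_zero] at hz
    have := (mul_eq_zero.1 hz).resolve_left (by positivity)
    linarith
  compat x₀ hx i j m := by
    obtain ⟨ε, hε, hu⟩ := exists_loop_through hU hx (isLoop_single SmoothPeriodic.sin_two_pi m)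
    have h := hP.deriv_g_eq hs hu i j 0
    rw [(hu.hasDerivAt_comp hU (hs.smooth_g i j) 0).deriv] at h
    have h0 : x₀ + ε • single (fun x => Real.sin (2 * Real.pi * x)) m 0 = x₀ := by
      ext k; simp [single]
    simp only [deriv_loop_single, h0, SmoothPeriodic.deriv_sin_two_pi, mul_ite, mul_zero,
      Finset.sum_ite_eq', Finset.mem_univ, if_true, Real.cos_zero, mul_one] at h
    have hne : ε * (2 * Real.pi) ≠ 0 := mul_ne_zero hε (by positivity)
    rw [← add_mul] at h
    exact mul_right_cancel₀ hne h

/-- The Jacobi identity for linear functionals. -/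
theorem IsPoisson.integral_jacobiator_eq_zero (hU : IsOpen U) (hP : P.IsPoisson U)
    (hs : P.SmoothCoeff U) {u a b c : ℝ → Vec n} (hu : IsLoop U u) (ha : IsLoop univ a)
    (hb : IsLoop univ b) (hc : IsLoop univ c) :
    ∫ x in (0 : ℝ)..1, P.jacobiator u a b c x = 0 := by
  have hS := hP.skewCoeff hU hs
  obtain ⟨r₁, r₂, r₃, h₁, h₂, h₃, hr⟩ := hP.jacobi (linearFunctional a ha)
    (linearFunctional b hb) (linearFunctional c hc) u hu
  -- The gradient of a linear functional does not depend on the field, so all second variations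
  -- vanish and only the Jacobiator is left.
  have hd : ∀ {p : ℝ → Vec n} (hp : IsLoop univ p) (w : ℝ → Vec n) (x : ℝ) (i : Fin n),
      (linearFunctional (U := U) p hp).dgrad u w x i = 0 := fun {p} hp w x i =>
    deriv_const (0 : ℝ) (p x i)
  have key : ∀ {a b c : ℝ → Vec n} (ha : IsLoop univ a) (hb : IsLoop univ b)
      (hc : IsLoop univ c) {r : ℝ}, P.HasIterated (linearFunctional (U := U) a ha)
        (linearFunctional b hb) (linearFunctional c hc) u r →
      r = ∫ x in (0 : ℝ)..1, ∑ l, P.op u c x l * P.opGrad u a b x l := by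
    intro a b c ha hb hc r hr
    have h := hr.unique (hasIterated hU hs hS (linearFunctional a ha) (linearFunctional b hb)
      (linearFunctional c hc) hu)
    simp only [hd, zero_mul, Finset.sum_const_zero, intervalIntegral.integral_zero, sub_zero,
      zero_add] at h
    exact h
  rw [integral_jacobiator hU hs hu ha hb hc, ← key ha hb hc h₁, ← key hb hc ha h₂,
    ← key hc ha hb h₃]
  exact hr

/-- On a constant loop all terms with `u_x` drop out. For the covector components `1, sin, sin` the
Jacobiator is the torsion defect at `x₀` times the square of the derivative of the sine, whose
integral is positive. -/
theorem IsPoisson.torsion (hU : IsOpen U) (hP : P.IsPoisson U) (hs : P.SmoothCoeff U) {x₀ : Vec n}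
    (hx : x₀ ∈ U) (i j s : Fin n) :
    ∑ l, P.g x₀ l s * P.b j i l x₀ = ∑ l, P.g x₀ l j * P.b s i l x₀ := by
  have hu : IsLoop U fun _ : ℝ => x₀ := ⟨contDiff_const, fun _ => rfl, fun _ => hx⟩
  have hsin := SmoothPeriodic.sin_two_pi
  have h := hP.integral_jacobiator_eq_zero hU hs hu (isLoop_single (SmoothPeriodic.const 1) i)
    (isLoop_single hsin j) (isLoop_single hsin s)
  have e : ∀ x, P.jacobiator (fun _ => x₀) (single (fun _ => 1) i)
      (single (fun x => Real.sin (2 * Real.pi * x)) j)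
      (single (fun x => Real.sin (2 * Real.pi * x)) s) x
      = ((∑ l, P.g x₀ l s * P.b j i l x₀) - ∑ l, P.g x₀ l j * P.b s i l x₀)
        * (deriv (fun x => Real.sin (2 * Real.pi * x)) x
          * deriv (fun x => Real.sin (2 * Real.pi * x)) x) := fun x => by
    unfold jacobiator
    rw [← Finset.sum_sub_distrib, Finset.sum_mul]
    refine Finset.sum_congr rfl fun l _ => ?_
    simp only [op_single, opGrad_single, deriv_const, mul_zero, zero_mul, Finset.sum_const_zero,
      add_zero, one_mul, sub_zero, zero_sub]
    ring
  simp only [e] at h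
  rw [intervalIntegral.integral_const_mul] at h
  have hpos : 0 < ∫ x in (0 : ℝ)..1, deriv (fun x => Real.sin (2 * Real.pi * x)) x
          * deriv (fun x => Real.sin (2 * Real.pi * x)) x :=
    intervalIntegral.integral_pos one_pos (hsin.deriv.mul hsin.deriv).continuous.continuousOn
      (fun x _ => mul_self_nonneg _) ⟨0, by simp, by
        rw [SmoothPeriodic.deriv_sin_two_pi, mul_zero, Real.cos_zero]; positivity⟩
  have := (mul_eq_zero.1 h).resolve_right hpos.ne'
  linarith

/-- For covector components `1, φ, 1` along a loop in the `m`-th direction the Jacobiator is `φ'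
E(u) ε f' + φ D`, where `E` is the wanted expression and `D` is quadratic in the velocity. Hence `D
= (E(u) ε f')'`. The choice `f = 1 - cos (2πx)` gives a loop at `x₀` with zero velocity and nonzero
acceleration at time zero: there `D` vanishes and the right side is a nonzero multiple of `E(x₀)`.
-/
theorem IsPoisson.curvature (hU : IsOpen U) (hP : P.IsPoisson U) (hs : P.SmoothCoeff U)
    {x₀ : Vec n} (hx : x₀ ∈ U) (i j s m : Fin n) :
    ∑ l, (P.b l s m x₀ * P.b j i l x₀ - P.b l i m x₀ * P.b j s l x₀
      + P.g x₀ l j * (pd l (P.b s i m) x₀ - pd m (P.b s i l) x₀)) = 0 := by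
  set f : ℝ → ℝ := fun x => 1 - Real.cos (2 * Real.pi * x) with hf
  have hfs : SmoothPeriodic f := (SmoothPeriodic.const 1).sub SmoothPeriodic.cos_two_pi
  have hf' : deriv f = fun x => 2 * Real.pi * Real.sin (2 * Real.pi * x) := funext fun x => by
    rw [hf, deriv_const_sub, SmoothPeriodic.deriv_cos_two_pi, neg_neg]
  obtain ⟨ε, hε, hu⟩ := exists_loop_through hU hx (isLoop_single hfs m)
  set u : ℝ → Vec n := fun x => x₀ + ε • single f m x with hudef
  have hu0 : u 0 = x₀ := by ext k; simp [hudef, single, hf]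
  have hdu : ∀ k x, deriv (fun y => u y k) x = if k = m then ε * deriv f x else 0 :=
    fun k x => deriv_loop_single x₀ ε f m k x
  set E : Vec n → ℝ := fun y => ∑ l, (P.b l s m y * P.b j i l y - P.b l i m y * P.b j s l y
      + P.g y l j * (pd l (P.b s i m) y - pd m (P.b s i l) y)) with hE
  have hEs : ContDiffOn ℝ ∞ E U := ContDiffOn.sum fun l _ =>
    (((hs.smooth_b l s m).mul (hs.smooth_b j i l)).sub
      ((hs.smooth_b l i m).mul (hs.smooth_b j s l))).add ((hs.smooth_g l j).mul
      (((hs.smooth_b s i m).pd_smooth hU l).sub ((hs.smooth_b s i l).pd_smooth hU m)))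
  set D : ℝ → ℝ := fun x => (ε * deriv f x) * (ε * deriv f x) * ∑ l,
    (P.b l s m (u x) * (pd l (P.b i j m) (u x) - pd m (P.b i j l) (u x))
      + P.b l i m (u x) * (pd l (P.b j s m) (u x) - pd m (P.b j s l) (u x))
      + P.b l j m (u x) * (pd l (P.b s i m) (u x) - pd m (P.b s i l) (u x))) with hD
  have hEu : SmoothPeriodic fun x => E (u x) * (ε * deriv f x) :=
    (hu.comp_smoothPeriodic hEs).mul ((SmoothPeriodic.const ε).mul hfs.deriv)
  have hDs : SmoothPeriodic D := by
    have hq : ∀ a b c, SmoothPeriodic fun x => pd a (P.b b c m) (u x) - pd m (P.b b c a) (u x) :=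
      fun a b c => (smoothPeriodic_pd_comp hU (hs.smooth_b b c m) hu a).sub
        (smoothPeriodic_pd_comp hU (hs.smooth_b b c a) hu m)
    have hbb : ∀ a b c, SmoothPeriodic fun x => P.b a b c (u x) :=
      fun a b c => hu.comp_smoothPeriodic (hs.smooth_b a b c)
    have hef := (SmoothPeriodic.const ε).mul hfs.deriv
    exact (hef.mul hef).mul (SmoothPeriodic.sum _ fun l _ => (((hbb l s m).mul (hq l i j)).add
      ((hbb l i m).mul (hq l j s))).add ((hbb l j m).mul (hq l s i)))
  have hjac : ∀ φ x, P.jacobiator u (single (fun _ => 1) i) (single φ j) (single (fun _ => 1) s) x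
      = deriv φ x * (E (u x) * (ε * deriv f x)) + φ x * D x := fun φ x => by
    simp only [jacobiator, hE, hD]
    rw [Finset.sum_mul, Finset.mul_sum, Finset.mul_sum, Finset.mul_sum, ← Finset.sum_add_distrib]
    refine Finset.sum_congr rfl fun l _ => ?_
    simp only [op_single, opGrad_single, deriv_const, hdu, mul_ite, mul_zero, Finset.sum_ite_eq',
      Finset.mem_univ, if_true]
    ring
  have hz := (hDs.sub hEu.deriv).eq_zero_of_integral_mul (fun φ hφ => by
    have h := hP.integral_jacobiator_eq_zero hU hs hu (isLoop_single (SmoothPeriodic.const 1) i)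
      (isLoop_single hφ j) (isLoop_single (SmoothPeriodic.const 1) s)
    simp only [hjac] at h
    refine ((hφ.deriv.mul hEu).add (hφ.mul hDs)).integral_eq_zero_of_eq_sub_deriv (hφ.mul hEu) h
      fun x => ?_
    rw [((hφ.hasDerivAt x).fun_mul (hEu.hasDerivAt x)).deriv]
    ring) 0
  have hf0 : deriv f 0 = 0 := by rw [hf']; simp
  have hf1 : HasDerivAt (deriv f) (2 * Real.pi * (2 * Real.pi)) 0 := by
    rw [hf']
    have h := (SmoothPeriodic.sin_two_pi.hasDerivAt 0).const_mul (2 * Real.pi)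
    rw [SmoothPeriodic.deriv_sin_two_pi] at h
    simpa using h
  have hE' : deriv (fun x => E (u x) * (ε * deriv f x)) 0 = E x₀ * (ε * (2 * Real.pi * (2 * Real.pi))) := by
    have := ((hu.comp_smoothPeriodic hEs).hasDerivAt 0).mul (hf1.const_mul ε)
    have := this.deriv
    simp only [hf0, mul_zero, zero_add, hu0] at this
    exact this
  have hD0 : D 0 = 0 := by simp [hD, hf0]
  rw [hE', hD0, zero_sub, neg_eq_zero] at hz
  exact (mul_eq_zero.1 hz).resolve_right (mul_ne_zero hε (by positivity))

/-! ### Brackets attached to metrics -/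

/-- The metric of a Poisson bracket of hydrodynamic type is flat where it is nondegenerate, and
the remaining coefficients are its contravariant Christoffel symbols. -/
theorem IsPoisson.flat_metric (hU : IsOpen U) (hP : P.IsPoisson U) (hs : P.SmoothCoeff U)
    {W : Set (Vec n)} (hW : IsOpen W) (hWU : W ⊆ U) (hdet : ∀ x ∈ W, (P.g x).det ≠ 0) :
    IsMetricOn W P.g ∧ ∀ x ∈ W, (∀ i j k, P.b i j k x = contraChristoffel P.g i j k x) ∧
      ∀ i j k l, riemann P.g i j k l x = 0 := by
  have hS := hP.skewCoeff hU hs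
  have hg : IsMetricOn W P.g := ⟨hW, fun i j => (hs.smooth_g i j).mono hWU,
    fun x hx => Matrix.IsSymm.ext fun i j => hS.symm x (hWU hx) j i, hdet⟩
  have hb : ∀ x ∈ W, ∀ i j k, P.b i j k x = contraChristoffel P.g i j k x := fun x hx =>
    hg.eq_contraChristoffel hx (fun i j k => P.b i j k x) (hS.compat x (hWU hx))
      fun i j k => by
        have h := hP.torsion hU hs (hWU hx) k j i
        simpa only [hS.symm x (hWU hx) _ i, hS.symm x (hWU hx) _ j] using h
  refine ⟨hg, fun x hx => ⟨hb x hx, fun i j k l => ?_⟩⟩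
  have hbm : ∀ i j k, P.b i j k x = contraMat P.g k x i j := hb x hx
  have hpd : ∀ a i j k, pd a (P.b i j k) x = mpd a (contraMat P.g k) x i j := fun a i j k =>
    pd_congr_on hW (fun y hy => hb y hy i j k) hx a
  have hgs : ∀ a b, P.g x a b = P.g x b a := hS.symm x (hWU hx)
  -- The quadratic terms of the relation in `IsPoisson.curvature` are contractions of `Γ g Γᵀ`, the
  -- same products that appear in `mpd_contraMat_sub`.
  have hsum : ∀ i s m j, ∑ l, P.b l s m x * P.b j i l x
      = ∑ p, P.g x j p * (christoffelMat P.g m x * P.g x * (christoffelMat P.g p x)ᵀ) s i := by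
    intro i s m j
    have e1 : ∀ l, P.b j i l x = -∑ p, P.g x j p * christoffelMat P.g p x i l := fun l => by
      rw [hb x hx]
      rfl
    have e2 : ∀ p, (christoffelMat P.g m x * P.g x * (christoffelMat P.g p x)ᵀ) s i
        = ∑ l, (P.g x * (christoffelMat P.g m x)ᵀ) l s * christoffelMat P.g p x i l := fun p => by
      rw [Matrix.mul_apply]
      refine Finset.sum_congr rfl fun l _ => ?_
      rw [Matrix.transpose_apply, ← Matrix.transpose_apply (P.g x * _) s l, Matrix.transpose_mul,
        Matrix.transpose_transpose, (hg.symm x hx).eq]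
    simp only [e1, e2, hbm, hg.contraMat_eq hx, Matrix.neg_apply, neg_mul_neg, Finset.mul_sum]
    rw [Finset.sum_comm]
    exact Finset.sum_congr rfl fun p _ => Finset.sum_congr rfl fun l _ => by ring
  -- Substituting `mpd_contraMat_sub` cancels the products `Γ g Γᵀ`; what remains is `g` contracted
  -- with `g Rᵀ`, and both factors `g` can be removed.
  have hR : ∀ s i m p, (P.g x * (riemannMat P.g p m x)ᵀ) s i = 0 := by
    intro s i m
    have hz : P.g x *ᵥ (fun p => (P.g x * (riemannMat P.g p m x)ᵀ) s i) = 0 := by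
      funext j
      have h := hP.curvature hU hs (hWU hx) i j s m
      rw [Finset.sum_add_distrib, Finset.sum_sub_distrib, hsum, hsum, ← Finset.sum_sub_distrib,
        ← Finset.sum_add_distrib] at h
      simp only [Matrix.mulVec, dotProduct, Pi.zero_apply]
      rw [← neg_eq_zero, ← Finset.sum_neg_distrib, ← h]
      refine Finset.sum_congr rfl fun p _ => ?_
      have h1 := congrFun (congrFun (hg.mpd_contraMat_sub hx p m) s) i
      simp only [Matrix.sub_apply] at h1
      have h2 : (christoffelMat P.g m x * P.g x * (christoffelMat P.g p x)ᵀ) i s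
          = (christoffelMat P.g p x * P.g x * (christoffelMat P.g m x)ᵀ) s i := by
        rw [← Matrix.transpose_apply (_ * _) s i]
        simp only [Matrix.transpose_mul, Matrix.transpose_transpose, (hg.symm x hx).eq,
          Matrix.mul_assoc]
      rw [h2, hpd, hpd, h1, hgs p j]
      ring
    exact fun p => congrFun (Matrix.eq_zero_of_mulVec_eq_zero (hdet x hx) hz) p
  have h0 : P.g x * (riemannMat P.g k l x)ᵀ = 0 := by
    ext s i; exact hR s i l k
  have h1 : (riemannMat P.g k l x)ᵀ = 0 := by
    have := congrArg ((P.g x)⁻¹ * ·) h0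
    simpa only [← Matrix.mul_assoc, Matrix.nonsing_inv_mul _ (hg.isUnit_det hx), one_mul,
      mul_zero] using this
  exact congrFun (congrFun h1 j) i

/-- The Jacobiator of a bracket vanishes at points near which the bracket comes from a flat
metric. -/
theorem jacobiator_eq_zero_of_flat {W : Set (Vec n)} (hg : IsMetricOn W P.g)
    (hb : ∀ x ∈ W, ∀ i j k, P.b i j k x = contraChristoffel P.g i j k x)
    (hR : ∀ x ∈ W, ∀ i j k l, riemann P.g i j k l x = 0) (u a b c : ℝ → Vec n) {x : ℝ}
    (hx : u x ∈ W) : P.jacobiator u a b c x = 0 := by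
  set y := u x with hy
  set v : Vec n := fun k => deriv (fun z => u z k) x with hv
  set Γ := fun k => christoffelMat P.g k y with hΓ
  -- `G` is the connection pulled back to the loop and `cov` the covariant derivative of covector
  -- fields along it, so that the operator becomes `g` applied to `cov`.
  set G : Matrix (Fin n) (Fin n) ℝ := ∑ k, v k • Γ k with hG
  set cov : (ℝ → Vec n) → Vec n := fun p => (fun i => deriv (fun z => p z i) x) - Gᵀ *ᵥ p x
    with hcov
  have hgT : (P.g y)ᵀ = P.g y := (hg.symm y hx).eq
  have hbm : ∀ i j k, P.b i j k y = contraMat P.g k y i j := hb y hx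
  have hop : ∀ p, P.op u p x = P.g y *ᵥ cov p := fun p => by
    have h2 : ∀ l, ∑ j, ∑ k, P.b l j k y * v k * p x j = -(P.g y *ᵥ (Gᵀ *ᵥ p x)) l := fun l => by
      rw [Matrix.mulVec_mulVec, Matrix.mulVec, dotProduct, ← Finset.sum_neg_distrib]
      refine Finset.sum_congr rfl fun j _ => ?_
      rw [hG, Matrix.transpose_sum, Matrix.mul_sum, Matrix.sum_apply, ← Finset.sum_mul,
        ← neg_mul, ← Finset.sum_neg_distrib]
      congr 1
      refine Finset.sum_congr rfl fun k _ => ?_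
      rw [hbm, hg.contraMat_eq hx, Matrix.transpose_smul, Matrix.mul_smul, Matrix.smul_apply,
        Matrix.neg_apply, smul_eq_mul]
      ring
    funext l
    rw [hcov, Matrix.mulVec_sub, Pi.sub_apply, sub_eq_add_neg, ← h2]
    rfl
  -- Flatness enters here: the derivatives of the coefficients become products of Christoffel
  -- symbols, exactly those that complete `a'` and `b'` in `opGrad` to covariant derivatives.
  have hK : ∀ l, ∑ k, v k • (mpd l (contraMat P.g k) y - mpd k (contraMat P.g l) y)
      = Γ l * P.g y * Gᵀ - G * P.g y * (Γ l)ᵀ := fun l => by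
    rw [hG, Matrix.transpose_sum, Matrix.mul_sum, Matrix.sum_mul, Matrix.sum_mul,
      ← Finset.sum_sub_distrib]
    refine Finset.sum_congr rfl fun k _ => ?_
    have h0 : riemannMat P.g l k y = 0 := by
      ext i j; exact hR y hx i j l k
    rw [hg.mpd_contraMat_sub hx, h0, Matrix.transpose_zero, Matrix.mul_zero, sub_zero, smul_sub,
      Matrix.transpose_smul, Matrix.mul_smul, Matrix.smul_mul, Matrix.smul_mul]
  have hgrad : ∀ a b : ℝ → Vec n, ∀ l, P.opGrad u a b x l
      = -((P.g y *ᵥ cov b) ⬝ᵥ ((Γ l)ᵀ *ᵥ a x)) + (P.g y *ᵥ cov a) ⬝ᵥ ((Γ l)ᵀ *ᵥ b x) := by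
    intro a b l
    set a' : Vec n := fun i => deriv (fun z => a z i) x with ha'
    set b' : Vec n := fun i => deriv (fun z => b z i) x with hb'
    have e1 : P.opGrad u a b x l = b' ⬝ᵥ (contraMat P.g l y *ᵥ a x)
        - a' ⬝ᵥ (contraMat P.g l y *ᵥ b x)
        + a x ⬝ᵥ ((Γ l * P.g y * Gᵀ - G * P.g y * (Γ l)ᵀ) *ᵥ b x) := by
      have hpd : ∀ a i j k, pd a (P.b i j k) y = mpd a (contraMat P.g k) y i j := fun a i j k =>
        pd_congr_on hg.isOpen (fun z hz => hb z hz i j k) hx a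
      have t1 : b' ⬝ᵥ (contraMat P.g l y *ᵥ a x)
          = ∑ i, ∑ j, a x i * b' j * P.b j i l y := by
        simp only [dotProduct, Matrix.mulVec, Finset.mul_sum, hbm]
        rw [Finset.sum_comm]
        exact Finset.sum_congr rfl fun i _ => Finset.sum_congr rfl fun j _ => by ring
      have t2 : a' ⬝ᵥ (contraMat P.g l y *ᵥ b x)
          = ∑ i, ∑ j, a' i * b x j * P.b i j l y := by
        simp only [dotProduct, Matrix.mulVec, Finset.mul_sum, hbm]
        exact Finset.sum_congr rfl fun i _ => Finset.sum_congr rfl fun j _ => by ring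
      have t3 : a x ⬝ᵥ ((Γ l * P.g y * Gᵀ - G * P.g y * (Γ l)ᵀ) *ᵥ b x)
          = ∑ i, ∑ j, a x i * b x j
            * ∑ k, (pd l (P.b i j k) y - pd k (P.b i j l) y) * v k := by
        rw [← hK]
        simp only [dotProduct, Matrix.mulVec, Matrix.sum_apply, Matrix.smul_apply,
          Matrix.sub_apply, smul_eq_mul, hpd]
        refine Finset.sum_congr rfl fun i _ => ?_
        rw [Finset.mul_sum]
        refine Finset.sum_congr rfl fun j _ => ?_
        rw [Finset.sum_mul, Finset.mul_sum, Finset.mul_sum]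
        exact Finset.sum_congr rfl fun k _ => by ring
      rw [t1, t2, t3]
      simp only [opGrad, Finset.sum_add_distrib, Finset.sum_sub_distrib]
      rfl
    have e2 : ∀ p q : Vec n, (P.g y *ᵥ p) ⬝ᵥ q = p ⬝ᵥ (P.g y *ᵥ q) := fun p q => by
      rw [Matrix.dotProduct_mulVec, ← Matrix.mulVec_transpose, hgT]
    have e3 : ∀ (A : Matrix (Fin n) (Fin n) ℝ) (p q : Vec n),
        (Aᵀ *ᵥ p) ⬝ᵥ q = p ⬝ᵥ (A *ᵥ q) := fun A p q => by
      rw [Matrix.dotProduct_mulVec, ← Matrix.mulVec_transpose]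
    rw [e1, hg.contraMat_eq hx, e2, e2]
    simp only [hcov, sub_dotProduct, e3, Matrix.neg_mulVec, dotProduct_neg, Matrix.sub_mulVec,
      dotProduct_sub, ← Matrix.mulVec_mulVec]
    have e4 : a x ⬝ᵥ Γ l *ᵥ P.g y *ᵥ Gᵀ *ᵥ b x = b x ⬝ᵥ G *ᵥ P.g y *ᵥ (Γ l)ᵀ *ᵥ a x := by
      rw [← e3, ← e2, ← e3, dotProduct_comm, Matrix.mulVec_transpose, Matrix.mulVec_transpose,
        ← Matrix.mulVec_transpose, ← Matrix.mulVec_transpose, Matrix.transpose_transpose]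
    rw [e4]
    ring
  -- Vanishing torsion makes `T` symmetric in its last two arguments, so the six terms of the cyclic
  -- sum cancel in pairs.
  set T : Vec n → Vec n → Vec n → ℝ := fun a p q => ∑ l, q l * (p ⬝ᵥ ((Γ l)ᵀ *ᵥ a)) with hT
  have hTs : ∀ a p q, T a p q = T a q p := fun a p q => by
    simp only [hT, dotProduct, Matrix.mulVec, Finset.mul_sum]
    rw [Finset.sum_comm]
    refine Finset.sum_congr rfl fun i _ => Finset.sum_congr rfl fun l _ =>
      Finset.sum_congr rfl fun s _ => ?_
    have : (Γ l)ᵀ i s = (Γ i)ᵀ l s := hg.christoffel_comm hx s l i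
    rw [this]
    ring
  have hJ : P.jacobiator u a b c x
      = (-T (a x) (P.op u b x) (P.op u c x) + T (b x) (P.op u a x) (P.op u c x))
        + (-T (b x) (P.op u c x) (P.op u a x) + T (c x) (P.op u b x) (P.op u a x))
        + (-T (c x) (P.op u a x) (P.op u b x) + T (a x) (P.op u c x) (P.op u b x)) := by
    simp only [jacobiator, hgrad, ← hop, hT, mul_add, mul_neg, Finset.sum_add_distrib,
      Finset.sum_neg_distrib]
  rw [hJ, hTs (a x), hTs (b x), hTs (c x)]
  ring

/-! ### Linear combinations of brackets -/

variable {Q : HydroBracket n}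

theorem SmoothCoeff.comb (hP : P.SmoothCoeff U) (hQ : Q.SmoothCoeff U) (a c : ℝ) :
    (comb a c P Q).SmoothCoeff U where
  smooth_g i j := (contDiffOn_const.mul (hP.smooth_g i j)).add
    (contDiffOn_const.mul (hQ.smooth_g i j))
  smooth_b i j k := (contDiffOn_const.mul (hP.smooth_b i j k)).add
    (contDiffOn_const.mul (hQ.smooth_b i j k))

theorem op_comb (a c : ℝ) (u p : ℝ → Vec n) (x : ℝ) (i : Fin n) :
    (comb a c P Q).op u p x i = a * P.op u p x i + c * Q.op u p x i := by
  simp only [op, comb, Matrix.add_apply, Matrix.smul_apply, smul_eq_mul, add_mul,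
    Finset.sum_add_distrib, mul_add, Finset.mul_sum, mul_assoc]
  ring

theorem pd_comb_b (hU : IsOpen U) (hP : P.SmoothCoeff U) (hQ : Q.SmoothCoeff U) (a c : ℝ)
    {y : Vec n} (hy : y ∈ U) (i j k l : Fin n) :
    pd l ((comb a c P Q).b i j k) y = a * pd l (P.b i j k) y + c * pd l (Q.b i j k) y := by
  have h1 := (hP.smooth_b i j k).diffAt hU hy
  have h2 := (hQ.smooth_b i j k).diffAt hU hy
  rw [← pd_const_mul h1, ← pd_const_mul h2]
  exact pd_add (h1.const_mul a) (h2.const_mul c) l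

theorem opGrad_comb (hU : IsOpen U) (hP : P.SmoothCoeff U) (hQ : Q.SmoothCoeff U) (a c : ℝ)
    (u p q : ℝ → Vec n) {x : ℝ} (hx : u x ∈ U) (l : Fin n) :
    (comb a c P Q).opGrad u p q x l = a * P.opGrad u p q x l + c * Q.opGrad u p q x l := by
  simp only [opGrad, pd_comb_b hU hP hQ a c hx]
  rw [Finset.mul_sum, Finset.mul_sum, ← Finset.sum_add_distrib]
  refine Finset.sum_congr rfl fun i _ => ?_
  rw [Finset.mul_sum, Finset.mul_sum, ← Finset.sum_add_distrib]
  refine Finset.sum_congr rfl fun j _ => ?_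
  have : ∑ k, (a * pd l (P.b i j k) (u x) + c * pd l (Q.b i j k) (u x)
      - (a * pd k (P.b i j l) (u x) + c * pd k (Q.b i j l) (u x))) * deriv (fun y => u y k) x
      = a * (∑ k, (pd l (P.b i j k) (u x) - pd k (P.b i j l) (u x)) * deriv (fun y => u y k) x)
      + c * ∑ k, (pd l (Q.b i j k) (u x) - pd k (Q.b i j l) (u x))
        * deriv (fun y => u y k) x := by
    rw [Finset.mul_sum, Finset.mul_sum, ← Finset.sum_add_distrib]
    exact Finset.sum_congr rfl fun k _ => by ring
  rw [this]
  simp only [comb]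
  ring

/-- The Jacobiator is quadratic in the bracket. -/
theorem exists_jacobiator_comb (hU : IsOpen U) (hP : P.SmoothCoeff U) (hQ : Q.SmoothCoeff U)
    (u p q r : ℝ → Vec n) {x : ℝ} (hx : u x ∈ U) : ∃ A B C : ℝ, ∀ a c : ℝ,
      (comb a c P Q).jacobiator u p q r x = a ^ 2 * A + a * c * B + c ^ 2 * C := by
  refine ⟨P.jacobiator u p q r x, ∑ l, (P.op u r x l * Q.opGrad u p q x l
    + Q.op u r x l * P.opGrad u p q x l + (P.op u p x l * Q.opGrad u q r x l
    + Q.op u p x l * P.opGrad u q r x l) + (P.op u q x l * Q.opGrad u r p x l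
    + Q.op u q x l * P.opGrad u r p x l)), Q.jacobiator u p q r x, fun a c => ?_⟩
  unfold jacobiator
  rw [Finset.mul_sum, Finset.mul_sum, Finset.mul_sum, ← Finset.sum_add_distrib,
    ← Finset.sum_add_distrib]
  refine Finset.sum_congr rfl fun l _ => ?_
  simp only [op_comb, opGrad_comb hU hP hQ a c u _ _ hx]
  ring

theorem IsRegular.smoothCoeff (hP : P.IsRegular U) : P.SmoothCoeff U := ⟨hP.smooth_g, hP.smooth_b⟩

theorem comb_one_zero : comb 1 0 P Q = P := by
  cases P; simp [comb]

theorem comb_zero_one : comb 0 1 P Q = Q := by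
  cases Q; simp [comb]

/-- Two nondegenerate brackets of hydrodynamic type are compatible if and only if they come from
a flat pencil of metrics. -/
theorem compatible_iff (hU : IsOpen U) (hP : P.IsRegular U) (hQ : Q.IsRegular U) :
    Compatible U P Q ↔ IsFlatPencil U P.g Q.g ∧ ∀ x ∈ U, ∀ i j k,
      P.b i j k x = contraChristoffel P.g i j k x ∧
      Q.b i j k x = contraChristoffel Q.g i j k x := by
  have hsP := hP.smoothCoeff
  have hsQ := hQ.smoothCoeff
  have hopen : ∀ a c : ℝ, IsOpen {x | x ∈ U ∧ (a • P.g x + c • Q.g x).det ≠ 0} := fun a c => by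
    have h : ContinuousOn (fun x => (a • P.g x + c • Q.g x).det) U :=
      (MSmooth.det (A := fun x => a • P.g x + c • Q.g x)
        (hsP.comb hsQ a c).smooth_g).continuousOn
    exact h.isOpen_inter_preimage hU isOpen_ne
  constructor
  · intro h
    have hP' : P.IsPoisson U := by simpa only [comb_one_zero] using h 1 0
    have hQ' : Q.IsPoisson U := by simpa only [comb_zero_one] using h 0 1
    obtain ⟨mP, fP⟩ := hP'.flat_metric hU hsP hU subset_rfl hP.nondeg
    obtain ⟨mQ, fQ⟩ := hQ'.flat_metric hU hsQ hU subset_rfl hQ.nondeg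
    have hcomb := fun a c : ℝ => (h a c).flat_metric hU (hsP.comb hsQ a c) (hopen a c)
      (fun x hx => hx.1) fun x hx => hx.2
    refine ⟨⟨mP.smooth, mQ.smooth, mP.symm, mQ.symm, mP.nondeg, mQ.nondeg,
      fun a c x hx hd => ((hcomb a c).2 x ⟨hx, hd⟩).2, fun a c x hx hd i j k => ?_⟩,
      fun x hx i j k => ⟨(fP x hx).1 i j k, (fQ x hx).1 i j k⟩⟩
    rw [← (fP x hx).1, ← (fQ x hx).1]
    exact (((hcomb a c).2 x ⟨hx, hd⟩).1 i j k).symm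
  · rintro ⟨hf, hb⟩ a c
    have mP : IsMetricOn U P.g := ⟨hU, hf.smooth₁, hf.symm₁, hf.nondeg₁⟩
    have mQ : IsMetricOn U Q.g := ⟨hU, hf.smooth₂, hf.symm₂, hf.nondeg₂⟩
    have hs := hsP.comb hsQ a c
    have hskew : (comb a c P Q).SkewCoeff U := by
      refine ⟨fun x hx i j => ?_, fun x hx i j k => ?_⟩
      · simp only [comb, Matrix.add_apply, Matrix.smul_apply]
        rw [(mP.symm x hx).apply i j, (mQ.symm x hx).apply i j]
      · have h1 := (hf.smooth₁ i j).diffAt hU hx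
        have h2 := (hf.smooth₂ i j).diffAt hU hx
        have h3 := pd_add (h1.const_mul a) (h2.const_mul c) k
        rw [pd_const_mul h1, pd_const_mul h2, mP.pd_eq_contraChristoffel hx,
          mQ.pd_eq_contraChristoffel hx] at h3
        refine Eq.trans h3 ?_
        simp only [comb, (hb x hx _ _ _).1, (hb x hx _ _ _).2]
        ring
    refine isPoisson_of_jacobiator hU hs hskew fun u p q r hu _ _ _ => ?_
    refine (intervalIntegral.integral_congr fun x _ => ?_).trans intervalIntegral.integral_zero
    obtain ⟨A, B, C, hABC⟩ := exists_jacobiator_comb hU hsP hsQ u p q r (hu.mem x)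
    -- The given combination may be degenerate at `u x`. Instead the coefficients `A, B, C`, which
    -- do not depend on the combination, are determined from `1 · P + c · Q` with `c` near zero,
    -- where nondegeneracy is inherited from `P.g`.
    have hzero : ∀ c : ℝ, (1 • P.g (u x) + c • Q.g (u x)).det ≠ 0 → A + c * B + c ^ 2 * C = 0 := by
      intro c hc
      have h := hABC 1 c
      rw [jacobiator_eq_zero_of_flat (P := comb 1 c P Q)
        (W := {x | x ∈ U ∧ ((1 : ℝ) • P.g x + c • Q.g x).det ≠ 0})] at h
      · linarith
      · refine ⟨hopen 1 c, MSmooth.mono (hsP.comb hsQ 1 c).smooth_g fun x hx => hx.1,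
          fun x hx => ?_, fun x hx => hx.2⟩
        exact ((mP.symm x hx.1).smul 1).add ((mQ.symm x hx.1).smul c)
      · intro y hy i j k
        refine Eq.trans ?_ (hf.linear 1 c y hy.1 hy.2 i j k).symm
        simp only [comb, (hb y hy.1 i j k).1, (hb y hy.1 i j k).2]
      · exact fun y hy => hf.flat 1 c y hy.1 hy.2
      · exact ⟨hu.mem x, by simpa using hc⟩
    have hcont : Continuous fun c : ℝ => (1 • P.g (u x) + c • Q.g (u x)).det :=
      Continuous.matrix_det (by fun_prop)
    have hev : ∀ᶠ c in nhds (0 : ℝ), A + c * B + c ^ 2 * C = 0 := by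
      filter_upwards [hcont.continuousAt.preimage_mem_nhds (isOpen_ne.mem_nhds (by
        simpa using hf.nondeg₁ _ (hu.mem x)))] with c hc
      exact hzero c hc
    obtain ⟨ε, hε, hball⟩ := Metric.eventually_nhds_iff_ball.1 hev
    -- A polynomial of degree at most two that vanishes at `0` and `±ε/2` is zero.
    have h0 := hball 0 (Metric.mem_ball_self hε)
    have h1 := hball (ε / 2) (by
      rw [Metric.mem_ball, Real.dist_eq, sub_zero, abs_of_pos (by positivity)]; linarith)
    have h2 := hball (-(ε / 2)) (by
      rw [Metric.mem_ball, Real.dist_eq, sub_zero, abs_neg, abs_of_pos (by positivity)]; linarith)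
    have hA : A = 0 := by linarith
    have hB : B = 0 := by
      have : ε * B = 0 := by linarith
      exact (mul_eq_zero.1 this).resolve_left hε.ne'
    have hC : C = 0 := by
      have : (ε / 2) ^ 2 * C = 0 := by rw [hA, hB] at h1; linarith
      exact (mul_eq_zero.1 this).resolve_left (by positivity)
    simp only [hABC a c, hA, hB, hC, mul_zero, add_zero]

end HydroBracket

/-! ### Linear ordinary differential equations and flat linear systems -/

section LinearSystems

set_option maxSynthPendingDepth 3

variable {E V : Type} [NormedAddCommGroup E] [NormedSpace ℝ E]
  [NormedAddCommGroup V] [NormedSpace ℝ V]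

/-- Linear ordinary differential equations have solutions on the whole interval. -/
theorem exists_linear_ode [FiniteDimensional ℝ V] {B : ℝ → V →L[ℝ] V} (hB : ContinuousOn B (Icc 0 1)) (p₀ : V) :
    ∃ p : ℝ → V, p 0 = p₀ ∧ ∀ t ∈ Icc (0 : ℝ) 1, HasDerivWithinAt p (B t (p t)) (Icc 0 1) t := by
  have := FiniteDimensional.complete ℝ V
  obtain ⟨C₀, hC₀⟩ := isCompact_Icc.exists_bound_of_continuousOn hB
  set C : ℝ := |C₀| + 1 with hCdef
  have hC : 0 < C := by positivity
  have hBC : ∀ t ∈ Icc (0 : ℝ) 1, ‖B t‖ ≤ C := fun t ht =>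
    (hC₀ t ht).trans ((le_abs_self _).trans (by rw [hCdef]; linarith))
  -- The linear field is cut off by a bump function equal to one on the ball of radius `R`. It
  -- becomes bounded and globally Lipschitz, so Picard–Lindelöf applies on all of `[0, 1]`. Grönwall
  -- bounds the solution by `‖p₀‖ exp C ≤ R`, where the cut-off has no effect.
  set R : ℝ := (‖p₀‖ + 1) * Real.exp C with hR
  have hRpos : 0 < R := by positivity
  let φ : ContDiffBump (0 : V) := ⟨R, R + 1, hRpos, by linarith⟩
  have hτ : ContDiff ℝ 1 fun x : V => φ x • x := φ.contDiff.smul contDiff_id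
  obtain ⟨K, hK⟩ := hτ.lipschitzWith_of_hasCompactSupport (φ.hasCompactSupport.smul_right)
    one_ne_zero
  have hφn : ∀ x : V, ‖φ x • x‖ ≤ ‖x‖ := fun x => by
    rw [norm_smul, Real.norm_of_nonneg φ.nonneg]
    exact mul_le_of_le_one_left (norm_nonneg _) φ.le_one
  have hφR : ∀ x : V, ‖φ x • x‖ ≤ R + 1 := fun x => by
    by_cases hx : ‖x‖ ≤ R + 1
    · exact (hφn x).trans hx
    · rw [φ.zero_of_le_dist (by rw [dist_zero_right]; exact (not_le.1 hx).le), zero_smul, norm_zero]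
      positivity
  have hpl : IsPicardLindelof (fun t x => B t (φ x • x)) (tmin := 0) (tmax := 1)
      ⟨0, by simp⟩ p₀ (C * (R + 1)).toNNReal 0 (C * (R + 1)).toNNReal (C.toNNReal * K) := by
    refine ⟨fun t ht => ?_, fun x _ => ?_, fun t ht x _ => ?_, ?_⟩
    · have h1 : LipschitzWith C.toNNReal (B t) :=
        (B t).lipschitz.weaken (by
          rw [← NNReal.coe_le_coe, Real.coe_toNNReal _ hC.le]; exact hBC t ht)
      exact (h1.comp hK).lipschitzOnWith
    · exact hB.clm_apply continuousOn_const
    · rw [Real.coe_toNNReal _ (by positivity)]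
      exact (ContinuousLinearMap.le_opNorm _ _).trans
        (mul_le_mul (hBC t ht) (hφR x) (norm_nonneg _) hC.le)
    · simp
  obtain ⟨p, hp0, hp⟩ := hpl.exists_eq_forall_mem_Icc_hasDerivWithinAt₀
  have hbound : ∀ t ∈ Icc (0 : ℝ) 1, ‖p t‖ ≤ R := fun t ht => by
    have h := norm_le_gronwallBound_of_norm_deriv_right_le (δ := ‖p₀‖) (K := C) (ε := 0)
      (f := p) (f' := fun t => B t (φ (p t) • p t)) (a := 0) (b := 1)
      (fun s hs => (hp s hs).continuousWithinAt)
      (fun s hs => (hp s ⟨hs.1, hs.2.le⟩).mono_of_mem_nhdsWithin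
        (Icc_mem_nhdsGE_of_mem hs)) (by
          have : p 0 = p₀ := hp0
          rw [this]) (fun s hs => by
        rw [add_zero]
        exact (ContinuousLinearMap.le_opNorm _ _).trans (mul_le_mul (hBC s ⟨hs.1, hs.2.le⟩)
          (hφn _) (norm_nonneg _) hC.le)) t ht
    refine h.trans ?_
    rw [gronwallBound_ε0, hR, sub_zero]
    have : C * t ≤ C := mul_le_of_le_one_right hC.le ht.2
    gcongr
    linarith
  refine ⟨p, hp0, fun t ht => ?_⟩
  have h := hp t ht
  rwa [φ.one_of_mem_closedBall (by simpa using hbound t ht), one_smul] at h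

/-- Linearity in the error term, used to pull the factor `‖δ‖²` out of the Grönwall estimate. -/
theorem gronwallBound_zero_left (K ε x : ℝ) :
    gronwallBound 0 K ε x = ε * gronwallBound 0 K 1 x := by
  unfold gronwallBound
  split_ifs <;> ring

/-- Second order Taylor estimates on a compact convex subset. -/
theorem exists_taylor_bound {F : Type} [NormedAddCommGroup F] [NormedSpace ℝ F] {U K : Set E}
    (hU : IsOpen U) {A : E → F} (hA : ContDiffOn ℝ ∞ A U) (hK : IsCompact K) (hKc : Convex ℝ K)
    (hKU : K ⊆ U) : ∃ C : ℝ, 0 ≤ C ∧ (∀ x ∈ K, ‖A x‖ ≤ C) ∧ (∀ x ∈ K, ‖fderiv ℝ A x‖ ≤ C) ∧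
      ∀ x ∈ K, ∀ y ∈ K, ‖A y - A x - fderiv ℝ A x (y - x)‖ ≤ C * ‖y - x‖ ^ 2 := by
  have hA1 : ContDiffOn ℝ ∞ (fderiv ℝ A) U := hA.fderiv_of_isOpen (m := ∞) hU (by simp)
  have hA2 : ContDiffOn ℝ ∞ (fderiv ℝ (fderiv ℝ A)) U := hA1.fderiv_of_isOpen (m := ∞) hU (by simp)
  obtain ⟨C₀, h₀⟩ := hK.exists_bound_of_continuousOn (hA.continuousOn.mono hKU)
  obtain ⟨C₁, h₁⟩ := hK.exists_bound_of_continuousOn (hA1.continuousOn.mono hKU)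
  obtain ⟨C₂, h₂⟩ := hK.exists_bound_of_continuousOn (hA2.continuousOn.mono hKU)
  have hle : ∀ a, a ∈ [C₀, C₁, C₂] → a ≤ |C₀| + |C₁| + |C₂| := by
    intro a ha
    simp only [List.mem_cons, List.not_mem_nil, or_false] at ha
    have := abs_nonneg C₀
    have := abs_nonneg C₁
    have := abs_nonneg C₂
    have := le_abs_self C₀
    have := le_abs_self C₁
    have := le_abs_self C₂
    rcases ha with rfl | rfl | rfl <;> linarith
  refine ⟨|C₀| + |C₁| + |C₂|, by positivity, fun x hx => (h₀ x hx).trans (hle _ (by simp)),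
    fun x hx => (h₁ x hx).trans (hle _ (by simp)), fun x hx y hy => ?_⟩
  have hdA : ∀ z ∈ K, HasFDerivAt A (fderiv ℝ A z) z := fun z hz =>
    ((hA.differentiableOn (by simp)).differentiableAt (hU.mem_nhds (hKU hz))).hasFDerivAt
  have hdA1 : ∀ z ∈ K, DifferentiableAt ℝ (fderiv ℝ A) z := fun z hz =>
    (hA1.differentiableOn (by simp)).differentiableAt (hU.mem_nhds (hKU hz))
  have hseg : segment ℝ x y ⊆ K := hKc.segment_subset hx hy
  have h := (convex_segment x y).norm_image_sub_le_of_norm_hasFDerivWithin_le' (𝕜 := ℝ)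
    (φ := fderiv ℝ A x) (C := (|C₀| + |C₁| + |C₂|) * ‖y - x‖)
    (fun z hz => (hdA z (hseg hz)).hasFDerivWithinAt) (fun z hz => by
      have h3 := hKc.norm_image_sub_le_of_norm_fderiv_le hdA1
        (fun z hz => (h₂ z hz).trans (hle _ (by simp))) hx (hseg hz)
      refine h3.trans ?_
      gcongr
      obtain ⟨t, ht, rfl⟩ := (segment_eq_image' ℝ x y ▸ hz)
      simp only [add_sub_cancel_left]
      rw [norm_smul, Real.norm_of_nonneg ht.1]
      exact mul_le_of_le_one_left (norm_nonneg _) ht.2)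
    (left_mem_segment ℝ x y) (right_mem_segment ℝ x y)
  refine h.trans (le_of_eq (by ring))

/-- Comparison of the solutions of a flat linear system along two nearby rays. -/
theorem flat_comparison {U K : Set E} {A : E → E →L[ℝ] V →L[ℝ] V} {β₀ : E}
    (hU : IsOpen U) (hA : ContDiffOn ℝ ∞ A U)
    (hflat : ∀ x ∈ U, ∀ e d : E, fderiv ℝ A x d e + A x e ∘L A x d
      = fderiv ℝ A x e d + A x d ∘L A x e) (hKU : K ⊆ U)
    {C L M : ℝ} (hC : 0 ≤ C) (hL : 0 ≤ L)
    (h0 : ∀ x ∈ K, ‖A x‖ ≤ C) (h1 : ∀ x ∈ K, ‖fderiv ℝ A x‖ ≤ C)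
    (h2 : ∀ x ∈ K, ∀ y ∈ K, ‖A y - A x - fderiv ℝ A x (y - x)‖ ≤ C * ‖y - x‖ ^ 2)
    {e δ : E} (he : ‖e + δ‖ ≤ L) (hδ : ‖δ‖ ≤ 1)
    (hK : ∀ s ∈ Icc (0 : ℝ) 1, β₀ + s • e ∈ K)
    (hK' : ∀ s ∈ Icc (0 : ℝ) 1, β₀ + s • (e + δ) ∈ K) {P P' : ℝ → V} (hP0 : P 0 = P' 0)
    (hP : ∀ s ∈ Icc (0 : ℝ) 1, HasDerivWithinAt P (A (β₀ + s • e) e (P s)) (Icc 0 1) s)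
    (hP' : ∀ s ∈ Icc (0 : ℝ) 1,
      HasDerivWithinAt P' (A (β₀ + s • (e + δ)) (e + δ) (P' s)) (Icc 0 1) s)
    (hPM : ∀ s ∈ Icc (0 : ℝ) 1, ‖P s‖ ≤ M) :
    ‖P' 1 - P 1 - A (β₀ + e) δ (P 1)‖ ≤ ((C + C * L) * M + (C + C * L + C * L) * (C * M))
      * gronwallBound 0 (C * L) 1 1 * ‖δ‖ ^ 2 := by
  -- `P + s A(δ) P` is the first-order prediction for the solution along the neighbouring ray. The
  -- error `q` starts at zero and satisfies a linear differential inequality with inhomogeneity of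
  -- order `‖δ‖²`.
  set q : ℝ → V := fun s => P' s - (P s + s • A (β₀ + s • e) δ (P s)) with hq
  set κ : ℝ := (C + C * L) * M + (C + C * L + C * L) * (C * M) with hκ
  have hq' : ∀ s ∈ Icc (0 : ℝ) 1, HasDerivWithinAt q
      (A (β₀ + s • (e + δ)) (e + δ) (P' s) - (A (β₀ + s • e) e (P s)
        + (s • (fderiv ℝ A (β₀ + s • e) e δ (P s) + A (β₀ + s • e) δ (A (β₀ + s • e) e (P s)))
          + A (β₀ + s • e) δ (P s)))) (Icc 0 1) s := fun s hs => by
    have hA' : HasFDerivAt A (fderiv ℝ A (β₀ + s • e)) (β₀ + s • e) :=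
      ((hA.differentiableOn (by simp)).differentiableAt
        (hU.mem_nhds (hKU (hK s hs)))).hasFDerivAt
    have hγ : HasDerivAt (fun s : ℝ => β₀ + s • e) e s := by
      simpa using ((hasDerivAt_id s).smul_const e).const_add β₀
    have hAγ : HasDerivWithinAt (fun s : ℝ => A (β₀ + s • e) δ)
        (fderiv ℝ A (β₀ + s • e) e δ) (Icc 0 1) s :=
      ((ContinuousLinearMap.apply ℝ (V →L[ℝ] V) δ).hasFDerivAt.comp_hasDerivAt s
        (hA'.comp_hasDerivAt s hγ)).hasDerivWithinAt
    have h3 := (hasDerivWithinAt_id s (Icc 0 1)).smul (hAγ.clm_apply (hP s hs))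
    refine ((hP' s hs).sub ((hP s hs).add h3)).congr_deriv ?_
    simp
  have hbound : ∀ s ∈ Icc (0 : ℝ) 1, ‖A (β₀ + s • (e + δ)) (e + δ) (P' s)
      - (A (β₀ + s • e) e (P s)
        + (s • (fderiv ℝ A (β₀ + s • e) e δ (P s) + A (β₀ + s • e) δ (A (β₀ + s • e) e (P s)))
          + A (β₀ + s • e) δ (P s)))‖ ≤ C * L * ‖q s‖ + κ * ‖δ‖ ^ 2 := fun s hs => by
    set x := β₀ + s • e with hx
    set y := β₀ + s • (e + δ) with hy
    have hyx : y - x = s • δ := by rw [hx, hy, smul_add]; abel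
    set ρ := A y - A x - fderiv ℝ A x (y - x) with hρ
    have hAy : A y = A x + s • fderiv ℝ A x δ + ρ := by
      rw [hρ, hyx, map_smul]; abel
    have hs1 : ‖s‖ ≤ 1 := by rw [Real.norm_of_nonneg hs.1]; exact hs.2
    have hρn : ‖ρ‖ ≤ C * ‖δ‖ ^ 2 := by
      refine (h2 x (hK s hs) y (hK' s hs)).trans ?_
      rw [hyx, norm_smul]
      gcongr
      exact mul_le_of_le_one_left (norm_nonneg _) hs1
    have hfl := congrArg (fun T : V →L[ℝ] V => T (P s)) (hflat x (hKU (hK s hs)) e δ)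
    simp only [_root_.add_apply, ContinuousLinearMap.comp_apply] at hfl
    set D := fderiv ℝ A x with hD
    set w := A x δ (P s) with hw
    have key : A y (e + δ) (P' s) - (A x e (P s) + (s • (D e δ (P s) + A x δ (A x e (P s)))
          + A x δ (P s)))
        = A y (e + δ) (q s) + ((s • D δ δ + ρ (e + δ)) (P s)
          + s • (A x δ + s • D δ (e + δ) + ρ (e + δ)) w) := by
      have hP's : P' s = q s + P s + s • w := by simp only [hq, hw]; abel
      -- Vanishing curvature interchanges `e` and `δ` here; after that all terms of first order in
      -- `δ` cancel.
      have hfl' : D e δ (P s) + A x δ (A x e (P s)) = D δ e (P s) + A x e w := hfl.symm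
      rw [hfl', hP's, map_add, map_add, map_smul, add_assoc, add_sub_assoc]
      congr 1
      rw [hAy]
      simp only [_root_.add_apply, _root_.smul_apply, map_add, smul_add]
      rw [← hw]
      module
    have hwn : ‖w‖ ≤ C * ‖δ‖ * M := by
      refine (ContinuousLinearMap.le_opNorm₂ _ _ _).trans ?_
      gcongr
      · exact h0 x (hK s hs)
      · exact hPM s hs
    have hDn : ∀ a b : E, ‖D a b‖ ≤ C * ‖a‖ * ‖b‖ := fun a b =>
      (ContinuousLinearMap.le_opNorm₂ _ _ _).trans (by gcongr; exact h1 x (hK s hs))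
    have hδ2 : ‖δ‖ ^ 2 ≤ ‖δ‖ := by nlinarith [norm_nonneg δ]
    have hρe : ‖ρ (e + δ)‖ ≤ C * ‖δ‖ ^ 2 * L :=
      (ContinuousLinearMap.le_opNorm _ _).trans (by gcongr)
    have t1 : ‖A y (e + δ) (q s)‖ ≤ C * L * ‖q s‖ :=
      (ContinuousLinearMap.le_opNorm₂ _ _ _).trans (by gcongr; exact h0 y (hK' s hs))
    have t2 : ‖(s • D δ δ + ρ (e + δ)) (P s)‖ ≤ (C * ‖δ‖ ^ 2 + C * ‖δ‖ ^ 2 * L) * M := by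
      refine (ContinuousLinearMap.le_opNorm _ _).trans ?_
      gcongr
      · refine (norm_add_le _ _).trans (add_le_add ?_ hρe)
        rw [norm_smul]
        calc ‖s‖ * ‖D δ δ‖ ≤ 1 * (C * ‖δ‖ * ‖δ‖) := by gcongr; exact hDn δ δ
          _ = C * ‖δ‖ ^ 2 := by ring
      · exact hPM s hs
    have t3 : ‖s • (A x δ + s • D δ (e + δ) + ρ (e + δ)) w‖
        ≤ (C * ‖δ‖ + C * ‖δ‖ * L + C * ‖δ‖ * L) * (C * ‖δ‖ * M) := by
      rw [norm_smul]
      have h4 : ‖A x δ + s • D δ (e + δ) + ρ (e + δ)‖ ≤ C * ‖δ‖ + C * ‖δ‖ * L + C * ‖δ‖ * L := by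
        refine (norm_add_le _ _).trans (add_le_add ((norm_add_le _ _).trans (add_le_add ?_ ?_)) ?_)
        · exact (ContinuousLinearMap.le_opNorm _ _).trans (by gcongr; exact h0 x (hK s hs))
        · rw [norm_smul]
          calc ‖s‖ * ‖D δ (e + δ)‖ ≤ 1 * (C * ‖δ‖ * L) := by
                gcongr; exact (hDn _ _).trans (by gcongr)
            _ = C * ‖δ‖ * L := one_mul _
        · exact hρe.trans (by gcongr)
      calc ‖s‖ * ‖(A x δ + s • D δ (e + δ) + ρ (e + δ)) w‖
          ≤ 1 * ((C * ‖δ‖ + C * ‖δ‖ * L + C * ‖δ‖ * L) * (C * ‖δ‖ * M)) := by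
            gcongr
            exact (ContinuousLinearMap.le_opNorm _ _).trans (by gcongr)
        _ = _ := one_mul _
    rw [key]
    refine (norm_add_le _ _).trans (add_le_add t1 ((norm_add_le _ _).trans
      ((add_le_add t2 t3).trans (le_of_eq ?_))))
    rw [hκ]; ring
  have hg := norm_le_gronwallBound_of_norm_deriv_right_le (δ := 0) (K := C * L)
    (ε := κ * ‖δ‖ ^ 2) (f := q) (a := 0) (b := 1)
    (fun s hs => (hq' s hs).continuousWithinAt)
    (fun s hs => (hq' s ⟨hs.1, hs.2.le⟩).mono_of_mem_nhdsWithin (Icc_mem_nhdsGE_of_mem hs))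
    (by simp [hq, hP0]) (fun s hs => hbound s ⟨hs.1, hs.2.le⟩) 1 (by simp)
  rw [sub_zero, gronwallBound_zero_left] at hg
  calc ‖P' 1 - P 1 - A (β₀ + e) δ (P 1)‖ = ‖q 1‖ := by
        simp only [hq, one_smul]; congr 1; abel
    _ ≤ _ := hg
    _ = _ := by ring

/-- A linear system of partial differential equations with vanishing curvature on a convex open
set has a global solution for every initial value. -/
theorem exists_flat_section [FiniteDimensional ℝ E] [FiniteDimensional ℝ V] {U : Set E}
    (hU : IsOpen U) (hUc : Convex ℝ U) {β₀ : E} (hβ₀ : β₀ ∈ U)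
    {A : E → E →L[ℝ] V →L[ℝ] V} (hA : ContDiffOn ℝ ∞ A U)
    (hflat : ∀ x ∈ U, ∀ e d : E, fderiv ℝ A x d e + A x e ∘L A x d
      = fderiv ℝ A x e d + A x d ∘L A x e) (p₀ : V) :
    ∃ p : E → V, p β₀ = p₀ ∧ ∀ x ∈ U, HasFDerivAt p ((A x).flip (p x)) x := by
  have := FiniteDimensional.proper ℝ E
  have hray : ∀ β ∈ U, ∀ s ∈ Icc (0 : ℝ) 1, β₀ + s • (β - β₀) ∈ U := fun β hβ s hs =>
    hUc.add_smul_sub_mem hβ₀ hβ hs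
  -- The value of the section at `β` is obtained by parallel transport along the segment from `β₀`;
  -- outside `U` a default value is used.
  have hode : ∀ β : E, ∃ P : ℝ → V, β ∈ U → P 0 = p₀ ∧ ∀ s ∈ Icc (0 : ℝ) 1,
      HasDerivWithinAt P (A (β₀ + s • (β - β₀)) (β - β₀) (P s)) (Icc 0 1) s := fun β => by
    by_cases hβ : β ∈ U
    · have hc : ContinuousOn (fun s : ℝ => A (β₀ + s • (β - β₀)) (β - β₀)) (Icc 0 1) :=
        (hA.continuousOn.comp (by fun_prop) fun s hs => hray β hβ s hs).clm_apply
          continuousOn_const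
      obtain ⟨P, h0, h⟩ := exists_linear_ode hc p₀
      exact ⟨P, fun _ => ⟨h0, h⟩⟩
    · exact ⟨0, fun h => absurd h hβ⟩
  choose P hP using hode
  refine ⟨fun β => P β 1, ?_, fun β hβ => ?_⟩
  · have h := (hP β₀ hβ₀).2
    simp only [sub_self, smul_zero, add_zero, map_zero, _root_.zero_apply] at h
    beta_reduce
    rw [constant_of_has_deriv_right_zero (fun s hs => (h s hs).continuousWithinAt)
      (fun s hs => (h s ⟨hs.1, hs.2.le⟩).mono_of_mem_nhdsWithin (Icc_mem_nhdsGE_of_mem hs)) 1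
      (by simp)]
    exact (hP β₀ hβ₀).1
  obtain ⟨r, hr, hrU⟩ := Metric.nhds_basis_closedBall.mem_iff.1 (hU.mem_nhds hβ)
  set r' := min r 1 with hr'
  have hr'pos : 0 < r' := lt_min hr one_pos
  have hballU : Metric.closedBall β r' ⊆ U :=
    (Metric.closedBall_subset_closedBall (min_le_left _ _)).trans hrU
  -- The cone over a small ball with vertex `β₀` is compact and convex and contains all the segments
  -- being compared, so one constant serves for every small `δ`.
  set K : Set E := convexJoin ℝ {β₀} (Metric.closedBall β r') with hKdef
  have hKeq : K = (fun q : ℝ × E => β₀ + q.1 • (q.2 - β₀)) ''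
      (Icc (0 : ℝ) 1 ×ˢ Metric.closedBall β r') := by
    ext z
    rw [hKdef, mem_convexJoin]
    constructor
    · rintro ⟨a, rfl, b, hb, hz⟩
      rw [segment_eq_image'] at hz
      obtain ⟨t, ht, rfl⟩ := hz
      exact ⟨(t, b), ⟨ht, hb⟩, rfl⟩
    · rintro ⟨⟨t, b⟩, ⟨ht, hb⟩, rfl⟩
      refine ⟨β₀, rfl, b, hb, ?_⟩
      rw [segment_eq_image']
      exact ⟨t, ht, rfl⟩
  have hKcpt : IsCompact K := by
    rw [hKeq]
    exact (isCompact_Icc.prod (isCompact_closedBall _ _)).image (by fun_prop)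
  have hKc : Convex ℝ K := (convex_singleton β₀).convexJoin (convex_closedBall β r')
  have hmem : ∀ b ∈ Metric.closedBall β r', ∀ s ∈ Icc (0 : ℝ) 1, β₀ + s • (b - β₀) ∈ K :=
    fun b hb s hs => hKeq ▸ ⟨(s, b), ⟨hs, hb⟩, rfl⟩
  have hKU : K ⊆ U := by
    rw [hKeq]
    rintro _ ⟨⟨t, b⟩, ⟨ht, hb⟩, rfl⟩
    exact hray b (hballU hb) t ht
  obtain ⟨C, hC, h0, h1, h2⟩ := exists_taylor_bound hU hA hKcpt hKc hKU
  obtain ⟨M, hM⟩ := (isCompact_Icc (a := (0 : ℝ)) (b := 1)).exists_bound_of_continuousOn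
    (f := P β) fun s hs => ((hP β hβ).2 s hs).continuousWithinAt
  have hM0 : 0 ≤ M := (norm_nonneg _).trans (hM 0 (by simp))
  rw [hasFDerivAt_iff_isLittleO_nhds_zero]
  refine (Asymptotics.IsBigO.of_bound (((C + C * (‖β - β₀‖ + 1)) * M
    + (C + C * (‖β - β₀‖ + 1) + C * (‖β - β₀‖ + 1)) * (C * M))
      * gronwallBound 0 (C * (‖β - β₀‖ + 1)) 1 1) ?_).trans_isLittleO
    (Asymptotics.isLittleO_norm_pow_id one_lt_two)
  filter_upwards [Metric.closedBall_mem_nhds (0 : E) hr'pos] with δ hδ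
  have hδn : ‖δ‖ ≤ r' := by simpa using hδ
  have hδ1 : ‖δ‖ ≤ 1 := hδn.trans (min_le_right _ _)
  have hβδ : β + δ ∈ Metric.closedBall β r' := by simpa using hδn
  have hsub : β + δ - β₀ = β - β₀ + δ := by abel
  have hcomp := flat_comparison hU hA hflat hKU hC (by positivity : 0 ≤ ‖β - β₀‖ + 1) h0 h1 h2
    (e := β - β₀) (δ := δ) (β₀ := β₀) ((norm_add_le _ _).trans (by linarith)) hδ1
    (hmem β (Metric.mem_closedBall_self hr'pos.le)) (fun s hs => hsub ▸ hmem _ hβδ s hs)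
    (P := P β) (P' := P (β + δ)) ((hP β hβ).1.trans (hP _ (hballU hβδ)).1.symm)
    (hP β hβ).2 (fun s hs => by
      have := (hP _ (hballU hβδ)).2 s hs
      rwa [hsub] at this) hM
  rw [add_sub_cancel] at hcomp
  rw [ContinuousLinearMap.flip_apply, Real.norm_of_nonneg (by positivity : (0:ℝ) ≤ ‖δ‖ ^ 2)]
  exact hcomp

end LinearSystems

/-! ### Partition functions -/

section PartitionFunctions

variable {n : ℕ} {Ω : Type*} [MeasurableSpace Ω] {ν : Measure Ω} {X : Ω → Vec n}

theorem isOpen_paramManifold : IsOpen (paramManifold ν X) := isOpen_interior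

theorem integrable_of_mem_paramManifold {β : Vec n} (hβ : β ∈ paramManifold ν X) :
    Integrable (fun w => Real.exp (-∑ j, β j * X w j)) ν := by
  have h : β ∈ {β | Integrable (fun w => Real.exp (-∑ j, β j * X w j)) ν} := interior_subset hβ
  exact h

theorem measurable_exp_dot (hX : Measurable X) (β : Vec n) :
    Measurable fun w => Real.exp (-∑ j, β j * X w j) := by
  have h : ∀ j, Measurable fun w => X w j := fun j => (measurable_pi_apply j).comp hX
  fun_prop

/-- Convexity of the exponential dominates the integrand at a convex combination, and interiors of
convex sets are convex. -/
theorem convex_paramManifold (hX : Measurable X) : Convex ℝ (paramManifold ν X) := by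
  refine Convex.interior fun β hβ γ hγ a b ha hb hab => ?_
  refine ((hβ.const_mul a).add (hγ.const_mul b)).mono'
    (measurable_exp_dot hX _).aestronglyMeasurable (Filter.Eventually.of_forall fun w => ?_)
  rw [Real.norm_of_nonneg (Real.exp_pos _).le]
  have h := convexOn_exp.2 (mem_univ (-∑ j, β j * X w j)) (mem_univ (-∑ j, γ j * X w j)) ha hb hab
  simp only [smul_eq_mul] at h
  refine le_trans (le_of_eq (congrArg _ ?_)) h
  simp only [Pi.add_apply, Pi.smul_apply, smul_eq_mul, add_mul, Finset.sum_add_distrib, mul_neg,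
    Finset.mul_sum, mul_assoc]
  ring

/-- The moments of the observables under the weight `exp (-β · X)`. -/
def moment (ν : Measure Ω) (X : Ω → Vec n) (l : List (Fin n)) (β : Vec n) : ℝ :=
  ∫ w, (l.map (X w)).prod * Real.exp (-∑ j, β j * X w j) ∂ν

theorem measurable_monomial (hX : Measurable X) (l : List (Fin n)) :
    Measurable fun w => (l.map (X w)).prod := by
  induction l with
  | nil => simp
  | cons j l ih =>
    simp only [List.map_cons, List.prod_cons]
    exact ((measurable_pi_apply j).comp hX).mul ih

theorem abs_monomial_le {n : ℕ} (v : Vec n) (l : List (Fin n)) :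
    |(l.map v).prod| ≤ (∑ j, |v j|) ^ l.length := by
  induction l with
  | nil => simp
  | cons j l ih =>
    simp only [List.map_cons, List.prod_cons, List.length_cons, abs_mul, pow_succ']
    exact mul_le_mul (Finset.single_le_sum (f := fun j => |v j|) (fun i _ => abs_nonneg _)
      (Finset.mem_univ j)) ih (abs_nonneg _) (Finset.sum_nonneg fun i _ => abs_nonneg _)

/-- Near a point of the parameter manifold all moments are dominated by an integrable function. -/
theorem exists_moment_bound {β₀ : Vec n} (hβ₀ : β₀ ∈ paramManifold ν X) :
    ∃ s ∈ nhds β₀, ∃ G : Ω → ℝ, Integrable G ν ∧ ∀ l : List (Fin n), ∃ C : ℝ, ∀ β ∈ s, ∀ w,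
      ‖(l.map (X w)).prod * Real.exp (-∑ j, β j * X w j)‖ ≤ C * G w := by
  obtain ⟨r, hr, hrU⟩ := Metric.nhds_basis_closedBall.mem_iff.1
    (isOpen_paramManifold.mem_nhds hβ₀)
  have hint : ∀ ε : Fin n → Bool, Integrable (fun w => Real.exp (-∑ j,
      (β₀ j + if ε j then r else -r) * X w j)) ν := fun ε => by
    refine integrable_of_mem_paramManifold (β := fun j => β₀ j + if ε j then r else -r) (hrU ?_)
    rw [Metric.mem_closedBall, dist_pi_le_iff hr.le]
    intro j
    rw [Real.dist_eq, add_sub_cancel_left]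
    split_ifs <;> simp [abs_of_pos hr]
  -- The dominating function sums the weights at the `2ⁿ` corners of a cube around `β₀`; the corner
  -- matching the signs of `X w` alone dominates `exp (-β₀ · X + r ∑ |Xⱼ|)`. Half of the radius pays
  -- for moving `β`, the other half for the monomial.
  refine ⟨_, Metric.closedBall_mem_nhds β₀ (half_pos hr), fun w => ∑ ε : Fin n → Bool,
    Real.exp (-∑ j, (β₀ j + if ε j then r else -r) * X w j),
    integrable_finsetSum _ fun ε _ => hint ε, fun l => ?_⟩
  -- The constant comes from `t ^ k / k! ≤ exp t` at `t = (r / 2) ∑ |Xⱼ|`.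
  refine ⟨(l.length.factorial : ℝ) * (2 / r) ^ l.length, fun β hβ w => ?_⟩
  set S := ∑ j, |X w j| with hS
  have hS0 : 0 ≤ S := Finset.sum_nonneg fun _ _ => abs_nonneg _
  have h1 : |(l.map (X w)).prod| ≤ (l.length.factorial : ℝ) * (2 / r) ^ l.length
      * Real.exp (r / 2 * S) := by
    refine (abs_monomial_le (X w) l).trans ?_
    have h := Real.pow_div_factorial_le_exp (r / 2 * S) (by positivity) l.length
    rw [div_le_iff₀ (by positivity)] at h
    calc S ^ l.length = (2 / r) ^ l.length * (r / 2 * S) ^ l.length := by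
          rw [← mul_pow]; congr 1; field_simp
      _ ≤ (2 / r) ^ l.length * (Real.exp (r / 2 * S) * l.length.factorial) := by gcongr
      _ = _ := by ring
  have h2 : -∑ j, β j * X w j ≤ -∑ j, β₀ j * X w j + r / 2 * S := by
    have h : ∑ j, (β₀ j - β j) * X w j ≤ r / 2 * S := by
      rw [hS, Finset.mul_sum]
      refine Finset.sum_le_sum fun j _ => (le_abs_self _).trans ?_
      rw [abs_mul]
      refine mul_le_mul_of_nonneg_right ?_ (abs_nonneg _)
      rw [← Real.dist_eq, dist_comm]
      exact (dist_le_pi_dist β β₀ j).trans hβ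
    simp only [sub_mul, Finset.sum_sub_distrib] at h
    linarith
  have h3 : Real.exp (-∑ j, β₀ j * X w j + r * S)
      ≤ ∑ ε : Fin n → Bool, Real.exp (-∑ j, (β₀ j + if ε j then r else -r) * X w j) := by
    refine le_trans (le_of_eq (congrArg _ ?_)) (Finset.single_le_sum
      (f := fun ε : Fin n → Bool => Real.exp (-∑ j, (β₀ j + if ε j then r else -r) * X w j))
      (fun ε _ => (Real.exp_pos _).le) (Finset.mem_univ fun j => decide (X w j ≤ 0)))
    rw [hS, Finset.mul_sum, ← Finset.sum_neg_distrib, ← Finset.sum_neg_distrib,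
      ← Finset.sum_add_distrib]
    refine Finset.sum_congr rfl fun j _ => ?_
    by_cases hj : X w j ≤ 0
    · simp only [hj, decide_true, if_true, abs_of_nonpos hj]; ring
    · simp only [hj, decide_false, Bool.false_eq_true, if_false, abs_of_pos (not_le.1 hj)]; ring
  rw [norm_mul, Real.norm_eq_abs, Real.norm_of_nonneg (Real.exp_pos _).le]
  calc |(l.map (X w)).prod| * Real.exp (-∑ j, β j * X w j)
      ≤ ((l.length.factorial : ℝ) * (2 / r) ^ l.length * Real.exp (r / 2 * S))
        * Real.exp (-∑ j, β₀ j * X w j + r / 2 * S) := by gcongr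
    _ = (l.length.factorial : ℝ) * (2 / r) ^ l.length
        * Real.exp (-∑ j, β₀ j * X w j + r * S) := by
      rw [mul_assoc, ← Real.exp_add]; congr 2; ring
    _ ≤ _ := by gcongr

theorem integrable_moment (hX : Measurable X) {β : Vec n} (hβ : β ∈ paramManifold ν X)
    (l : List (Fin n)) :
    Integrable (fun w => (l.map (X w)).prod * Real.exp (-∑ j, β j * X w j)) ν := by
  obtain ⟨s, hs, G, hG, hb⟩ := exists_moment_bound hβ
  obtain ⟨C, hC⟩ := hb l
  exact (hG.const_mul C).mono' ((measurable_monomial hX l).mul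
    (measurable_exp_dot hX β)).aestronglyMeasurable
    (Filter.Eventually.of_forall (hC β (mem_of_mem_nhds hs)))

set_option maxSynthPendingDepth 3 in
theorem hasFDerivAt_moment (hX : Measurable X) {β : Vec n} (hβ : β ∈ paramManifold ν X)
    (l : List (Fin n)) : HasFDerivAt (moment ν X l)
      (∑ j, (-moment ν X (j :: l) β) • (ContinuousLinearMap.proj j : Vec n →L[ℝ] ℝ)) β := by
  obtain ⟨s, hs, G, hG, hb⟩ := exists_moment_bound hβ
  choose C hC using hb
  have hproj : ∀ j : Fin n, ‖(ContinuousLinearMap.proj j : Vec n →L[ℝ] ℝ)‖ ≤ 1 := fun j =>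
    ContinuousLinearMap.opNorm_le_bound _ zero_le_one fun v => by
      rw [one_mul]; exact norm_le_pi_norm v j
  have hmeas : ∀ (l : List (Fin n)) (β : Vec n), AEStronglyMeasurable
      (fun w => (l.map (X w)).prod * Real.exp (-∑ j, β j * X w j)) ν := fun l β =>
    ((measurable_monomial hX l).mul (measurable_exp_dot hX β)).aestronglyMeasurable
  set F : Vec n → Ω → ℝ := fun β w => (l.map (X w)).prod * Real.exp (-∑ j, β j * X w j) with hFdef
  set F' : Vec n → Ω → Vec n →L[ℝ] ℝ := fun β w =>
    ∑ j, (-(((j :: l).map (X w)).prod * Real.exp (-∑ j, β j * X w j))) •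
      (ContinuousLinearMap.proj j : Vec n →L[ℝ] ℝ) with hF'def
  have hF'meas : AEStronglyMeasurable (F' β) ν :=
    Finset.aestronglyMeasurable_fun_sum _ fun j _ =>
      (hmeas (j :: l) β).neg.smul aestronglyMeasurable_const
  have hbound : ∀ w, ∀ β ∈ s, ‖F' β w‖ ≤ ∑ j, C (j :: l) * G w := fun w β hβ => by
    refine norm_sum_le_of_le _ fun j _ => ?_
    rw [norm_smul, norm_neg]
    exact (mul_le_of_le_one_right (norm_nonneg _) (hproj j)).trans (hC (j :: l) β hβ w)
  have hdiff : ∀ w, ∀ β ∈ s, HasFDerivAt (fun β => F β w) (F' β w) β := fun w β _ => by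
    have h1 : HasFDerivAt (fun β : Vec n => -∑ j, β j * X w j)
        (-∑ j, X w j • (ContinuousLinearMap.proj j : Vec n →L[ℝ] ℝ)) β := by
      refine (HasFDerivAt.fun_sum fun j _ => ?_).neg
      exact (ContinuousLinearMap.proj (R := ℝ) (φ := fun _ : Fin n => ℝ) j).hasFDerivAt.mul_const
        (X w j)
    refine (h1.exp.const_mul ((l.map (X w)).prod)).congr_fderiv ?_
    simp only [hF'def, List.map_cons, List.prod_cons, smul_neg, Finset.smul_sum, smul_smul,
      neg_smul, Finset.sum_neg_distrib]
    congr 1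
    exact Finset.sum_congr rfl fun j _ => by congr 1; ring
  have hF : HasFDerivAt (fun β => ∫ w, F β w ∂ν) (∫ w, F' β w ∂ν) β :=
    hasFDerivAt_integral_of_dominated_of_fderiv_le (𝕜 := ℝ) hs
      (Filter.Eventually.of_forall fun β => hmeas l β) (integrable_moment hX hβ l) hF'meas
      (Filter.Eventually.of_forall hbound) (integrable_finsetSum _ fun j _ => hG.const_mul _)
      (Filter.Eventually.of_forall hdiff)
  refine hF.congr_fderiv ?_
  simp only [hF'def]
  rw [integral_finsetSum]
  swap
  · exact fun j _ => ((integrable_moment hX hβ (j :: l)).neg.smul_const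
      (ContinuousLinearMap.proj j : Vec n →L[ℝ] ℝ))
  refine Finset.sum_congr rfl fun j _ => ?_
  rw [integral_smul_const, integral_neg]
  rfl

/-- Differentiation lengthens the list by one index, so the induction on the order runs over all
moments at once. -/
theorem contDiffOn_moment (hX : Measurable X) (l : List (Fin n)) :
    ContDiffOn ℝ ∞ (moment ν X l) (paramManifold ν X) := by
  refine contDiffOn_infty.2 fun k => ?_
  induction k generalizing l with
  | zero =>
    simp only [CharP.cast_eq_zero, contDiffOn_zero]
    exact fun β hβ => (hasFDerivAt_moment hX hβ l).continuousAt.continuousWithinAt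
  | succ k ih =>
    push_cast
    rw [contDiffOn_succ_iff_hasFDerivWithinAt_of_uniqueDiffOn isOpen_paramManifold.uniqueDiffOn]
    exact ⟨by simp, _, ContDiffOn.sum fun j _ => (ih (j :: l)).neg.smul contDiffOn_const,
      fun β hβ => (hasFDerivAt_moment hX hβ l).hasFDerivWithinAt⟩

theorem contDiffOn_partitionFn (hX : Measurable X) :
    ContDiffOn ℝ ∞ (partitionFn ν X) (paramManifold ν X) := by
  have h : partitionFn ν X = moment ν X [] := by
    funext β; simp [partitionFn, moment]
  rw [h]
  exact contDiffOn_moment hX []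

/-- The only obstruction is `ν = 0`. Then the potential is `log 0 = 0`, and its Hessian is not
positive definite because `n > 0`. -/
theorem partitionFn_pos (hn : 0 < n) (hM : IsInfoFrobenius ν X) {β : Vec n}
    (hβ : β ∈ paramManifold ν X) : 0 < partitionFn ν X β := by
  have hν : NeZero ν := by
    refine ⟨fun h0 => ?_⟩
    have hz : ksPotential ν X = fun _ => 0 := by
      funext β; simp [ksPotential, partitionFn, h0]
    have hp := (hM.posDef β hβ).diag_pos (i := ⟨0, hn⟩)
    have hpd : ∀ j : Fin n, pd j (fun _ : Vec n => (0 : ℝ)) = fun _ => 0 := fun j => by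
      funext x; simp
    simp [ksHessian, hz, hpd] at hp
  exact integral_exp_pos (integrable_of_mem_paramManifold hβ)

theorem contDiffOn_ksPotential (hn : 0 < n) (hM : IsInfoFrobenius ν X) :
    ContDiffOn ℝ ∞ (ksPotential ν X) (paramManifold ν X) :=
  (contDiffOn_partitionFn hM.measurable).log fun _ hβ => (partitionFn_pos hn hM hβ).ne'

/-! ### The standard Gaussian family -/

/-- The standard Gaussian measure on `ℝⁿ`. -/
def stdGaussianMeasure (n : ℕ) : Measure (Vec n) :=
  Measure.pi fun _ => ProbabilityTheory.gaussianReal 0 1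

theorem exp_neg_dot_eq_prod (φ ξ : Vec n) :
    Real.exp (-∑ j, φ j * ξ j) = ∏ j, Real.exp (-φ j * ξ j) := by
  rw [← Real.exp_sum, ← Finset.sum_neg_distrib]
  simp only [neg_mul]

theorem paramManifold_stdGaussian :
    paramManifold (stdGaussianMeasure n) (fun ξ : Vec n => ξ) = univ := by
  have h : {φ : Vec n | Integrable (fun ξ : Vec n => Real.exp (-∑ j, φ j * ξ j))
      (stdGaussianMeasure n)} = univ := by
    refine eq_univ_of_forall fun φ => ?_
    simp only [mem_ofPred_eq, exp_neg_dot_eq_prod]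
    exact Integrable.fintype_prod (f := fun j x => Real.exp (-φ j * x)) fun j =>
      ProbabilityTheory.integrable_exp_mul_gaussianReal _
  rw [paramManifold, h, interior_univ]

theorem ksPotential_stdGaussian :
    ksPotential (stdGaussianMeasure n) (fun ξ : Vec n => ξ) = fun φ => ∑ j, φ j * φ j / 2 := by
  funext φ
  have h : ∀ j, ∫ x, Real.exp (-φ j * x) ∂ProbabilityTheory.gaussianReal 0 1
      = Real.exp (φ j * φ j / 2) := fun j => by
    have := ProbabilityTheory.mgf_gaussianReal (p := ProbabilityTheory.gaussianReal 0 1) (X := id)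
      (μ := 0) (v := 1) (by simp) (-φ j)
    simp only [ProbabilityTheory.mgf, id] at this
    rw [this]
    congr 1
    push_cast; ring
  simp only [ksPotential, partitionFn, exp_neg_dot_eq_prod]
  rw [stdGaussianMeasure, integral_fintype_prod_eq_prod (f := fun j x => Real.exp (-φ j * x))]
  simp only [h]
  rw [← Real.exp_sum, Real.log_exp]

theorem pd_coord (i j : Fin n) (x : Vec n) :
    pd i (fun y : Vec n => y j) x = if i = j then 1 else 0 := by
  have h : HasFDerivAt (fun y : Vec n => y j) (ContinuousLinearMap.proj j : Vec n →L[ℝ] ℝ) x :=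
    (ContinuousLinearMap.proj (R := ℝ) (φ := fun _ : Fin n => ℝ) j).hasFDerivAt
  rw [pd, h.fderiv]
  simp [Pi.single_apply, eq_comm]

/-- Thus a Euclidean metric in local coordinates is a Koszul–Souriau metric, with no restriction on
the range of the coordinates. -/
theorem ksHessian_stdGaussian (φ : Vec n) :
    ksHessian (stdGaussianMeasure n) (fun ξ : Vec n => ξ) φ = 1 := by
  have hc : ∀ (j : Fin n) (x : Vec n), DifferentiableAt ℝ (fun y : Vec n => y j) x := fun j x =>
    differentiableAt_apply j x
  have h1 : ∀ j, pd j (fun φ : Vec n => ∑ k, φ k * φ k / 2) = fun φ => φ j := fun j => by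
    funext φ
    rw [pd_sum (f := fun k (φ : Vec n) => φ k * φ k / 2) _
      fun k _ => by fun_prop]
    have : ∀ k, pd j (fun φ : Vec n => φ k * φ k / 2) φ = if j = k then φ k else 0 := fun k => by
      have e : (fun φ : Vec n => φ k * φ k / 2) = fun φ => (1 / 2 : ℝ) * (φ k * φ k) := by
        funext φ; ring
      rw [e, pd_const_mul ((hc k φ).fun_mul (hc k φ)), pd_mul (hc k φ) (hc k φ), pd_coord]
      split_ifs <;> ring
    simp only [this, Finset.sum_ite_eq, Finset.mem_univ, if_true]
  ext i j
  simp only [ksHessian, ksPotential_stdGaussian, h1, pd_coord, Matrix.of_apply, Matrix.one_apply]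

end PartitionFunctions

/-! ### Flat coordinates of the Levi-Civita connection -/

section FlatCoordinates

open scoped MatrixOrder

variable {n : ℕ} {U : Set (Vec n)}

set_option maxSynthPendingDepth 3 in
/-- Parallel rows `∂ₖ p = p Θₖ` of a connection with vanishing curvature. -/
theorem exists_parallel_row {m : Type} [Fintype m] [DecidableEq m] (hU : IsOpen U)
    (hUc : Convex ℝ U) {β₀ : Vec n} (hβ₀ : β₀ ∈ U) {Θ : Fin n → Vec n → Matrix m m ℝ}
    (hΘ : ∀ k i j, ContDiffOn ℝ ∞ (fun x => Θ k x i j) U)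
    (hflat : ∀ x ∈ U, ∀ k l i j, pd l (fun y => Θ k y i j) x + (Θ l x * Θ k x) i j
      = pd k (fun y => Θ l y i j) x + (Θ k x * Θ l x) i j) (p₀ : m → ℝ) :
    ∃ p : Vec n → m → ℝ, p β₀ = p₀ ∧ (∀ j, ContDiffOn ℝ ∞ (fun x => p x j) U) ∧
      ∀ x ∈ U, ∀ k j, pd k (fun y => p y j) x = ∑ i, p x i * Θ k x i j := by
  let B : Fin n → m → m → Vec n →L[ℝ] (m → ℝ) →L[ℝ] (m → ℝ) := fun k i j =>
    (ContinuousLinearMap.proj k : Vec n →L[ℝ] ℝ).smulRight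
      ((ContinuousLinearMap.proj i : (m → ℝ) →L[ℝ] ℝ).smulRight (Pi.single j 1))
  have hB : ∀ k i j e v r, B k i j e v r = if r = j then e k * v i else 0 := fun k i j e v r => by
    simp [B, Pi.single_apply]
  -- The connection one-form acting on rows: in direction `e` it sends `v` to `∑ₖ eᵏ v Θₖ`.
  let A : Vec n → Vec n →L[ℝ] (m → ℝ) →L[ℝ] (m → ℝ) := fun x =>
    ∑ k, ∑ i, ∑ j, Θ k x i j • B k i j
  have hAapp : ∀ x e v r, A x e v r = ∑ k, ∑ i, Θ k x i r * (e k * v i) := fun x e v r => by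
    simp [A, Finset.sum_apply, hB]
  have hA : ContDiffOn ℝ ∞ A U := ContDiffOn.sum fun k _ => ContDiffOn.sum fun i _ =>
    ContDiffOn.sum fun j _ => (hΘ k i j).smul contDiffOn_const
  have hA' : ∀ x ∈ U, ∀ d e v r, fderiv ℝ A x d e v r
      = ∑ k, ∑ i, (∑ l, d l * pd l (fun y => Θ k y i r) x) * (e k * v i) := fun x hx d e v r => by
    have h : HasFDerivAt A (∑ k, ∑ i, ∑ j, (fderiv ℝ (fun y => Θ k y i j) x).smulRight (B k i j))
        x := HasFDerivAt.fun_sum fun k _ => HasFDerivAt.fun_sum fun i _ =>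
      HasFDerivAt.fun_sum fun j _ => ((hΘ k i j).diffAt hU hx).hasFDerivAt.smul_const _
    rw [h.fderiv]
    simp only [_root_.sum_apply, Finset.sum_apply,
      ContinuousLinearMap.smulRight_apply, _root_.smul_apply, Pi.smul_apply,
      smul_eq_mul, hB, mul_ite, mul_zero, Finset.sum_ite_eq, Finset.mem_univ, if_true,
      fderiv_apply_eq_sum_pd]
  have hcurv : ∀ x ∈ U, ∀ d e v r, (fderiv ℝ A x d e + A x e ∘L A x d) v r
      = ∑ k, ∑ l, ∑ i, (e k * d l * v i) *
        (pd l (fun y => Θ k y i r) x + (Θ l x * Θ k x) i r) := fun x hx d e v r => by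
    rw [_root_.add_apply, Pi.add_apply, hA' x hx, ContinuousLinearMap.comp_apply,
      hAapp]
    simp only [hAapp]
    rw [← Finset.sum_add_distrib]
    refine Finset.sum_congr rfl fun k _ => ?_
    simp only [mul_add, Finset.sum_add_distrib]
    congr 1
    · rw [Finset.sum_comm]
      refine Finset.sum_congr rfl fun i _ => ?_
      rw [Finset.sum_mul]
      exact Finset.sum_congr rfl fun l _ => by ring
    · simp only [Matrix.mul_apply, Finset.mul_sum]
      rw [Finset.sum_comm]
      refine Finset.sum_congr rfl fun l _ => ?_
      rw [Finset.sum_comm]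
      exact Finset.sum_congr rfl fun i _ => Finset.sum_congr rfl fun s _ => by ring
  obtain ⟨p, hp₀, hp⟩ := exists_flat_section hU hUc hβ₀ hA (fun x hx e d => by
    ext v r
    rw [hcurv x hx, hcurv x hx, Finset.sum_comm]
    refine Finset.sum_congr rfl fun l _ => Finset.sum_congr rfl fun k _ =>
      Finset.sum_congr rfl fun i _ => ?_
    rw [hflat x hx]; ring) p₀
  have hpj : ∀ x ∈ U, ∀ j, HasFDerivAt (fun y => p y j)
      (∑ k, (∑ i, p x i * Θ k x i j) • (ContinuousLinearMap.proj k : Vec n →L[ℝ] ℝ)) x :=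
    fun x hx j => by
    refine (hasFDerivAt_pi'.1 (hp x hx) j).congr_fderiv ?_
    ext e
    simp only [ContinuousLinearMap.comp_apply, ContinuousLinearMap.proj_apply,
      ContinuousLinearMap.flip_apply, hAapp, _root_.sum_apply,
      _root_.smul_apply, smul_eq_mul, Finset.sum_mul]
    exact Finset.sum_congr rfl fun k _ => Finset.sum_congr rfl fun i _ => by ring
  refine ⟨p, hp₀, fun j => contDiffOn_infty.2 fun N => ?_, fun x hx k j => ?_⟩
  -- Bootstrapping: the derivative of the row is a polynomial in the row and `Θ`.
  · induction N generalizing j with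
    | zero =>
      simp only [CharP.cast_eq_zero, contDiffOn_zero]
      exact fun x hx => (hpj x hx j).continuousAt.continuousWithinAt
    | succ N ih =>
      push_cast
      rw [contDiffOn_succ_iff_hasFDerivWithinAt_of_uniqueDiffOn hU.uniqueDiffOn]
      exact ⟨by simp, _, ContDiffOn.sum fun k _ => (ContDiffOn.sum fun i _ =>
        (ih i).mul (contDiffOn_infty.1 (hΘ k i j) N)).smul contDiffOn_const,
        fun x hx => (hpj x hx j).hasFDerivWithinAt⟩
  · rw [pd, (hpj x hx j).fderiv]
    simp [Pi.single_apply]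

/-- The Jacobian matrix of the functions `yᵃ`. -/
def jac (y : Fin n → Vec n → ℝ) (x : Vec n) : Matrix (Fin n) (Fin n) ℝ :=
  Matrix.of fun a i => pd i (y a) x

theorem smooth_jac (hU : IsOpen U) {y : Fin n → Vec n → ℝ} (hy : ∀ a, ContDiffOn ℝ ∞ (y a) U) :
    MSmooth U (jac y) := fun a i => (hy a).pd_smooth hU i

/-- A torsion-free connection with vanishing curvature has flat coordinates with prescribed
differentials at one point. -/
theorem exists_flat_functions (hU : IsOpen U) (hUc : Convex ℝ U) {β₀ : Vec n} (hβ₀ : β₀ ∈ U)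
    {Γ : Fin n → Vec n → Matrix (Fin n) (Fin n) ℝ} (hΓ : ∀ k, MSmooth U (Γ k))
    (hsymm : ∀ x ∈ U, ∀ i j k, Γ k x i j = Γ j x i k)
    (hflat : ∀ x ∈ U, ∀ k l, mpd l (Γ k) x + Γ l x * Γ k x = mpd k (Γ l) x + Γ k x * Γ l x)
    (J₀ : Matrix (Fin n) (Fin n) ℝ) :
    ∃ y : Fin n → Vec n → ℝ, (∀ a, ContDiffOn ℝ ∞ (y a) U) ∧ jac y β₀ = J₀ ∧
      ∀ x ∈ U, ∀ k, mpd k (jac y) x = jac y x * Γ k x := by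
  -- The function and its differential are found together as one parallel row `(y, dy)`, with `none`
  -- indexing the function. Curvature of the enlarged connection vanishes in the `none` column
  -- precisely because `Γ` has no torsion.
  let Θ : Fin n → Vec n → Matrix (Option (Fin n)) (Option (Fin n)) ℝ := fun k x => Matrix.of
    fun a b => a.elim 0 fun i => b.elim (if i = k then 1 else 0) fun j => Γ k x i j
  have h := fun a => exists_parallel_row hU hUc hβ₀ (Θ := Θ)
    (fun k i j => by
      rcases i with _ | i
      · exact contDiffOn_const
      · rcases j with _ | j
        · exact contDiffOn_const
        · exact hΓ k i j)
    (fun x hx k l i j => by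
      rcases i with _ | i
      · simp [Θ, Matrix.mul_apply]
      · rcases j with _ | j
        · simp [Θ, Matrix.mul_apply, hsymm x hx i k l]
        · have := congrFun (congrFun (hflat x hx k l) i) j
          simpa [Θ, Matrix.mul_apply, mpd] using this)
    (fun b => b.elim 0 fun j => J₀ a j)
  choose p hp₀ hps hp using h
  have hy : ∀ x ∈ U, ∀ a i, pd i (fun x => p a x none) x = p a x (some i) := fun x hx a i => by
    rw [hp a x hx]; simp [Θ]
  refine ⟨fun a x => p a x none, fun a => hps a none, ?_, fun x hx k => ?_⟩
  · ext a i
    rw [jac, Matrix.of_apply, hy _ hβ₀, hp₀]; rfl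
  · ext a i
    rw [mpd, Matrix.of_apply, pd_congr_on hU (f := fun y => jac (fun a x => p a x none) y a i)
      (fun x hx => hy x hx a i) hx, hp a x hx, Matrix.mul_apply, Fintype.sum_option]
    simp only [jac, Matrix.of_apply, hy x hx, Θ]
    simp

/-- A Hessian metric whose structure matrices `G⁻¹ ∂ₖG` commute is flat: it is the pull-back of
the Euclidean metric under globally defined flat coordinates. -/
theorem exists_orthonormal_coordinates (hU : IsOpen U) (hUc : Convex ℝ U) (hne : U.Nonempty)
    {G : Vec n → Matrix (Fin n) (Fin n) ℝ} (hG : MSmooth U G) (hpos : ∀ x ∈ U, (G x).PosDef)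
    (hT : ∀ x ∈ U, ∀ i j k, mpd k G x i j = mpd j G x i k)
    (hcomm : ∀ x ∈ U, ∀ k l, Commute ((G x)⁻¹ * mpd k G x) ((G x)⁻¹ * mpd l G x)) :
    ∃ y : Fin n → Vec n → ℝ, (∀ a, ContDiffOn ℝ ∞ (y a) U) ∧
      ∀ x ∈ U, G x = (jac y x)ᵀ * jac y x := by
  obtain ⟨β₀, hβ₀⟩ := hne
  have hdet : ∀ x ∈ U, (G x).det ≠ 0 := fun x hx => (hpos x hx).det_pos.ne'
  have hu : ∀ x ∈ U, IsUnit (G x).det := fun x hx => isUnit_iff_ne_zero.2 (hdet x hx)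
  have hGs : ∀ x ∈ U, (G x)ᵀ = G x := fun x hx => by
    simpa [Matrix.conjTranspose_eq_transpose_of_trivial] using (hpos x hx).isHermitian.eq
  have hCs : ∀ k, MSmooth U fun x => (G x)⁻¹ * mpd k G x := fun k =>
    (hG.inv hdet).mul (hG.mpd hU k)
  have hTt : ∀ x ∈ U, ∀ k, (mpd k G x)ᵀ = mpd k G x := fun x hx k => by
    rw [← mpd_transpose, mpd_congr_on hU hGs hx]
  have hGi : ∀ x ∈ U, ((G x)⁻¹)ᵀ = (G x)⁻¹ := fun x hx => by
    rw [Matrix.transpose_nonsing_inv, hGs x hx]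
  let Γ : Fin n → Vec n → Matrix (Fin n) (Fin n) ℝ := fun k x =>
    (1 / 2 : ℝ) • ((G x)⁻¹ * mpd k G x)
  have hΓs : ∀ k, MSmooth U (Γ k) := fun k i j => contDiffOn_const.mul (hCs k i j)
  have hΓd : ∀ x ∈ U, ∀ k l, mpd l (Γ k) x = (1 / 2 : ℝ) •
      (-((G x)⁻¹ * mpd l G x * (G x)⁻¹) * mpd k G x + (G x)⁻¹ * mpd l (mpd k G) x) :=
    fun x hx k l => by
    rw [← mpd_inv hU hG hdet hx, ← mpd_mul hU (hG.inv hdet) (hG.mpd hU k) hx]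
    ext i j
    exact pd_const_mul ((hCs k i j).diffAt hU hx) _ _
  -- The initial differentials form an orthonormal coframe at the base point.
  obtain ⟨J₀, hJ₀⟩ := CStarAlgebra.nonneg_iff_eq_star_mul_self.1 (hpos β₀ hβ₀).posSemidef.nonneg
  obtain ⟨y, hy, hy₀, hyJ⟩ := exists_flat_functions hU hUc hβ₀ hΓs
    (fun x hx i j k => by
      simp only [Γ, Matrix.smul_apply, Matrix.mul_apply, hT x hx _ j k])
    (fun x hx k l => by
      have hc := (hcomm x hx k l).eq
      rw [hΓd x hx, hΓd x hx, mpd_comm hU hG hx k l]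
      simp only [Γ, Matrix.smul_mul, Matrix.mul_smul, ← hc, Matrix.neg_mul]
      have : (G x)⁻¹ * mpd l G x * (G x)⁻¹ * mpd k G x
          = (G x)⁻¹ * mpd k G x * (G x)⁻¹ * mpd l G x := by
        simpa only [Matrix.mul_assoc] using hc.symm
      rw [this]) J₀
  have hJs := smooth_jac hU hy
  have hKs : MSmooth U fun x => jac y x * (G x)⁻¹ * (jac y x)ᵀ :=
    (hJs.mul (hG.inv hdet)).mul hJs.transpose
  -- The entries are the inner products of the parallel one-forms `dyᵃ`. Two contributions `½` from
  -- the forms cancel the derivative of `G⁻¹`, so orthonormality propagates from the base point.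
  have hK : ∀ x ∈ U, ∀ k, mpd k (fun x => jac y x * (G x)⁻¹ * (jac y x)ᵀ) x = 0 :=
    fun x hx k => by
    rw [mpd_mul hU (hJs.mul (hG.inv hdet)) hJs.transpose hx, mpd_mul hU hJs (hG.inv hdet) hx,
      mpd_transpose, mpd_inv hU hG hdet hx, hyJ x hx]
    simp only [Γ, Matrix.transpose_mul, Matrix.transpose_smul, hTt x hx, hGi x hx,
      Matrix.mul_smul, Matrix.smul_mul, Matrix.add_mul, Matrix.mul_neg, Matrix.neg_mul,
      Matrix.mul_assoc]
    module
  have hK1 : ∀ x ∈ U, jac y x * (G x)⁻¹ * (jac y x)ᵀ = 1 := fun x hx => by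
    have h0 : jac y β₀ * (G β₀)⁻¹ * (jac y β₀)ᵀ = 1 := by
      have hJu : IsUnit J₀.det := by
        have h := hu β₀ hβ₀
        rw [hJ₀, Matrix.det_mul] at h
        exact isUnit_of_mul_isUnit_right h
      have hs : star J₀ = J₀ᵀ := by
        rw [Matrix.star_eq_conjTranspose, Matrix.conjTranspose_eq_transpose_of_trivial]
      rw [hy₀, hJ₀, hs, Matrix.mul_inv_rev, ← Matrix.mul_assoc, Matrix.mul_nonsing_inv _ hJu,
        one_mul, Matrix.nonsing_inv_mul _ (by rwa [Matrix.det_transpose])]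
    rw [← h0]
    ext i j
    refine hU.is_const_of_fderiv_eq_zero hUc.isPreconnected
      ((hKs i j).differentiableOn (by simp)) (fun z hz => ?_) hx hβ₀
    ext v
    rw [fderiv_apply_eq_sum_pd]
    exact Finset.sum_eq_zero fun k _ => by
      rw [show pd k _ z = 0 from congrFun (congrFun (hK z hz k) i) j, mul_zero]
  refine ⟨y, hy, fun x hx => ?_⟩
  have h := hK1 x hx
  rw [Matrix.mul_assoc, mul_eq_one_comm, Matrix.mul_assoc] at h
  have h2 := congrArg (G x * ·) h
  simpa only [← Matrix.mul_assoc, Matrix.mul_nonsing_inv _ (hu x hx), one_mul, mul_one]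
    using h2.symm

end FlatCoordinates

/-! ### Flat coordinates of an information geometry Frobenius manifold -/

section Frobenius

variable {n : ℕ} {Ω : Type*} [MeasurableSpace Ω] {ν : Measure Ω} {X : Ω → Vec n}

theorem smooth_ksHessian (hn : 0 < n) (hM : IsInfoFrobenius ν X) :
    MSmooth (paramManifold ν X) (ksHessian ν X) := fun i j =>
  ((contDiffOn_ksPotential hn hM).pd_smooth isOpen_paramManifold j).pd_smooth
    isOpen_paramManifold i

theorem mpd_ksHessian_comm (hn : 0 < n) (hM : IsInfoFrobenius ν X) {x : Vec n}
    (hx : x ∈ paramManifold ν X) (i j k : Fin n) :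
    mpd k (ksHessian ν X) x i j = mpd j (ksHessian ν X) x i k := by
  have hΦ := contDiffOn_ksPotential hn hM
  have hU : IsOpen (paramManifold ν X) := isOpen_paramManifold
  calc pd k (pd i (pd j (ksPotential ν X))) x
      = pd i (pd k (pd j (ksPotential ν X))) x := pd_comm hU (hΦ.pd_smooth hU j) hx k i
    _ = pd i (pd j (pd k (ksPotential ν X))) x :=
      pd_congr_on hU (fun z hz => pd_comm hU hΦ hz k j) hx i
    _ = pd j (pd i (pd k (ksPotential ν X))) x := pd_comm hU (hΦ.pd_smooth hU k) hx i j

theorem ksCubic_eq (hn : 0 < n) (hM : IsInfoFrobenius ν X) {x : Vec n}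
    (hx : x ∈ paramManifold ν X) (i j k : Fin n) :
    ksCubic ν X i j k x = mpd j (ksHessian ν X) x i k :=
  pd_comm isOpen_paramManifold
    ((contDiffOn_ksPotential hn hM).pd_smooth isOpen_paramManifold k) hx i j

theorem tangentMul_comm (hn : 0 < n) (hM : IsInfoFrobenius ν X) {x : Vec n}
    (hx : x ∈ paramManifold ν X) (u v : Vec n) : tangentMul ν X x u v = tangentMul ν X x v u := by
  funext e
  refine Finset.sum_congr rfl fun f _ => ?_
  rw [Finset.sum_comm]
  refine Finset.sum_congr rfl fun b _ => Finset.sum_congr rfl fun a _ => ?_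
  rw [ksCubic_eq hn hM hx, ksCubic_eq hn hM hx, mpd_ksHessian_comm hn hM hx]
  ring

theorem tangentMul_single (hn : 0 < n) (hM : IsInfoFrobenius ν X) {x : Vec n}
    (hx : x ∈ paramManifold ν X) (k : Fin n) (v : Vec n) :
    tangentMul ν X x (Pi.single k 1) v
      = ((ksHessian ν X x)⁻¹ * mpd k (ksHessian ν X) x) *ᵥ v := by
  funext e
  simp only [tangentMul, ksCubic_eq hn hM hx, Matrix.mulVec, dotProduct, Matrix.mul_apply,
    Pi.single_apply, mul_ite, mul_one, mul_zero, ite_mul, zero_mul, Finset.sum_mul]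
  rw [Finset.sum_comm]
  rw [Finset.sum_comm (s := Finset.univ (α := Fin n)) (f := fun b f =>
    (ksHessian ν X x)⁻¹ e f * mpd k (ksHessian ν X) x f b * v b)]
  rw [Finset.sum_comm]
  refine Finset.sum_congr rfl fun f _ => ?_
  rw [Finset.sum_comm]
  exact Finset.sum_congr rfl fun b _ => by simp

/-- The matrices represent multiplication by coordinate vectors, and in a commutative associative
algebra multiplication operators commute. -/
theorem commute_structureMatrices (hn : 0 < n) (hM : IsInfoFrobenius ν X) {x : Vec n}
    (hx : x ∈ paramManifold ν X) (k l : Fin n) :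
    Commute ((ksHessian ν X x)⁻¹ * mpd k (ksHessian ν X) x)
      ((ksHessian ν X x)⁻¹ * mpd l (ksHessian ν X) x) := by
  have h : ∀ k l v, ((ksHessian ν X x)⁻¹ * mpd k (ksHessian ν X) x
      * ((ksHessian ν X x)⁻¹ * mpd l (ksHessian ν X) x)) *ᵥ v
      = tangentMul ν X x (Pi.single k 1) (tangentMul ν X x (Pi.single l 1) v) := fun k l v => by
    rw [tangentMul_single hn hM hx, tangentMul_single hn hM hx, Matrix.mulVec_mulVec]
  refine Matrix.ext_of_mulVec_single fun i => ?_
  rw [h, h, ← hM.assoc x hx, ← hM.assoc x hx, tangentMul_comm hn hM hx (Pi.single k 1)]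

theorem IsInfoFrobenius.exists_coordinates (hn : 0 < n) (hM : IsInfoFrobenius ν X) :
    ∃ y : Fin n → Vec n → ℝ, (∀ a, ContDiffOn ℝ ∞ (y a) (paramManifold ν X)) ∧
      ∀ x ∈ paramManifold ν X, ksHessian ν X x = (jac y x)ᵀ * jac y x :=
  exists_orthonormal_coordinates isOpen_paramManifold (convex_paramManifold hM.measurable)
    hM.nonempty (smooth_ksHessian hn hM) hM.posDef
    (fun _ hx => mpd_ksHessian_comm hn hM hx) fun _ hx => commute_structureMatrices hn hM hx

end Frobenius

/-! ### Metrics that are diagonal in separated coordinates -/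

section Diagonal

variable {n : ℕ} {U : Set (Vec n)} {y : Fin n → Vec n → ℝ} {D : Fin n → ℝ → ℝ}

theorem pd_comp {f : Vec n → ℝ} {φ : ℝ → ℝ} {φ' : ℝ} {x : Vec n} (hφ : HasDerivAt φ φ' (f x))
    (hf : DifferentiableAt ℝ f x) (i : Fin n) : pd i (fun z => φ (f z)) x = φ' * pd i f x := by
  have h : HasFDerivAt (fun z => φ (f z)) (φ' • fderiv ℝ f x) x :=
    hφ.comp_hasFDerivAt x hf.hasFDerivAt
  rw [pd, h.fderiv]
  rfl

/-- The contravariant metric with components `δᵃᵇ Dₐ(yᵃ)` in the coordinates `y`. -/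
def coordMetric (y : Fin n → Vec n → ℝ) (D : Fin n → ℝ → ℝ) (x : Vec n) :
    Matrix (Fin n) (Fin n) ℝ :=
  (jac y x)⁻¹ * Matrix.diagonal (fun a => D a (y a x)) * ((jac y x)⁻¹)ᵀ

theorem coordMetric_comb (a c : ℝ) (D₁ D₂ : Fin n → ℝ → ℝ) (x : Vec n) :
    coordMetric y (fun i t => a * D₁ i t + c * D₂ i t) x
      = a • coordMetric y D₁ x + c • coordMetric y D₂ x := by
  have h : Matrix.diagonal (fun i => a * D₁ i (y i x) + c * D₂ i (y i x))
      = a • Matrix.diagonal (fun i => D₁ i (y i x))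
        + c • Matrix.diagonal (fun i => D₂ i (y i x)) := by
    rw [← Matrix.diagonal_smul, ← Matrix.diagonal_smul, Matrix.diagonal_add]; rfl
  simp only [coordMetric, h, Matrix.mul_add, Matrix.add_mul, Matrix.mul_smul, Matrix.smul_mul]

theorem coordMetric_symm (x : Vec n) : (coordMetric y D x).IsSymm := by
  simp only [Matrix.IsSymm, coordMetric, Matrix.transpose_mul, Matrix.transpose_transpose,
    Matrix.diagonal_transpose, Matrix.mul_assoc]

theorem det_coordMetric_ne_zero_iff {x : Vec n} (hJ : (jac y x).det ≠ 0) :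
    (coordMetric y D x).det ≠ 0 ↔ ∀ a, D a (y a x) ≠ 0 := by
  rw [coordMetric, Matrix.det_mul, Matrix.det_mul, Matrix.det_transpose, Matrix.det_diagonal,
    Matrix.det_nonsing_inv, Ring.inverse_eq_inv']
  simp [hJ, Finset.prod_eq_zero_iff]

theorem inv_coordMetric {x : Vec n} (hJ : (jac y x).det ≠ 0) (hD : ∀ a, D a (y a x) ≠ 0) :
    (coordMetric y D x)⁻¹
      = (jac y x)ᵀ * Matrix.diagonal (fun a => (D a (y a x))⁻¹) * jac y x := by
  have hu : IsUnit (jac y x).det := isUnit_iff_ne_zero.2 hJ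
  have hd : Matrix.diagonal (fun a => D a (y a x)) * Matrix.diagonal (fun a => (D a (y a x))⁻¹)
      = 1 := by
    rw [Matrix.diagonal_mul_diagonal, ← Matrix.diagonal_one]
    exact congrArg _ (funext fun a => mul_inv_cancel₀ (hD a))
  refine Matrix.inv_eq_right_inv ?_
  have ht : ((jac y x)⁻¹)ᵀ * (jac y x)ᵀ = 1 := by
    rw [← Matrix.transpose_mul, Matrix.mul_nonsing_inv _ hu, Matrix.transpose_one]
  calc _ = (jac y x)⁻¹ * (Matrix.diagonal (fun a => D a (y a x)) *
        (((jac y x)⁻¹)ᵀ * (jac y x)ᵀ) * Matrix.diagonal (fun a => (D a (y a x))⁻¹)) * jac y x := by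
        simp only [coordMetric, Matrix.mul_assoc]
    _ = 1 := by rw [ht, mul_one, hd, mul_one, Matrix.nonsing_inv_mul _ hu]

theorem smooth_coordMetric (hU : IsOpen U) (hy : ∀ a, ContDiffOn ℝ ∞ (y a) U)
    (hJ : ∀ x ∈ U, (jac y x).det ≠ 0) (hD : ∀ a, ContDiff ℝ ∞ (D a)) :
    MSmooth U (coordMetric y D) := by
  have hJi := (smooth_jac hU hy).inv hJ
  refine (hJi.mul fun i j => ?_).mul hJi.transpose
  by_cases hij : i = j
  · subst hij
    simp only [Matrix.diagonal_apply_eq]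
    exact (hD i).comp_contDiffOn (hy i)
  · simpa [Matrix.diagonal_apply_ne _ hij] using contDiffOn_const

/-- The set on which the metric `coordMetric y D` is nondegenerate. -/
def nondegSet (U : Set (Vec n)) (y : Fin n → Vec n → ℝ) (D : Fin n → ℝ → ℝ) : Set (Vec n) :=
  {x | x ∈ U ∧ ∀ a, D a (y a x) ≠ 0}

theorem isMetricOn_coordMetric (hU : IsOpen U) (hy : ∀ a, ContDiffOn ℝ ∞ (y a) U)
    (hJ : ∀ x ∈ U, (jac y x).det ≠ 0) (hD : ∀ a, ContDiff ℝ ∞ (D a)) :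
    IsMetricOn (nondegSet U y D) (coordMetric y D) where
  isOpen := by
    have h : nondegSet U y D = U ∩ {x | (coordMetric y D x).det ≠ 0} := by
      ext x
      exact and_congr_right fun hx => (det_coordMetric_ne_zero_iff (hJ x hx)).symm
    rw [h]
    exact (smooth_coordMetric hU hy hJ hD).det.continuousOn.isOpen_inter_preimage hU
      isOpen_compl_singleton
  smooth := (smooth_coordMetric hU hy hJ hD).mono fun _ hx => hx.1
  symm := fun x _ => coordMetric_symm x
  nondeg := fun x hx => (det_coordMetric_ne_zero_iff (hJ x hx.1)).2 hx.2

theorem hasDerivAt_inv_sqrt {f : ℝ → ℝ} {f' t : ℝ} (hf : HasDerivAt f f' t) (ε : ℝ)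
    (h : 0 < ε * f t) : HasDerivAt (fun s => (√(ε * f s))⁻¹)
      (-(f' / (2 * f t)) * (√(ε * f t))⁻¹) t := by
  have hε : ε ≠ 0 := left_ne_zero_of_mul h.ne'
  have hft : f t ≠ 0 := right_ne_zero_of_mul h.ne'
  have hs : √(ε * f t) ≠ 0 := (Real.sqrt_pos.2 h).ne'
  refine (((hf.const_mul ε).sqrt h.ne').inv hs).congr_deriv ?_
  rw [Real.sq_sqrt h.le]
  field_simp

/-- The coframe `(εₐ Dₐ(yᵃ))^(-1/2) dyᵃ`. -/
def coordCoframe (y : Fin n → Vec n → ℝ) (D : Fin n → ℝ → ℝ) (ε : Fin n → ℝ) (x : Vec n) :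
    Matrix (Fin n) (Fin n) ℝ :=
  Matrix.diagonal (fun a => (√(ε a * D a (y a x)))⁻¹) * jac y x

theorem mpd_coordCoframe (hU : IsOpen U) (hy : ∀ a, ContDiffOn ℝ ∞ (y a) U)
    (hD : ∀ a, ContDiff ℝ ∞ (D a)) {ε : Fin n → ℝ} {x : Vec n} (hx : x ∈ U)
    (hε : ∀ a, 0 < ε a * D a (y a x)) (k : Fin n) :
    mpd k (coordCoframe y D ε) x = Matrix.diagonal (fun a => (√(ε a * D a (y a x)))⁻¹) *
      (mpd k (jac y) x - Matrix.diagonal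
        (fun a => deriv (D a) (y a x) / (2 * D a (y a x)) * jac y x a k) * jac y x) := by
  have hd : ∀ a, HasDerivAt (fun s => (√(ε a * D a s))⁻¹)
      (-(deriv (D a) (y a x) / (2 * D a (y a x))) * (√(ε a * D a (y a x)))⁻¹) (y a x) := fun a =>
    hasDerivAt_inv_sqrt ((hD a).differentiable (by simp) _).hasDerivAt _ (hε a)
  ext a j
  simp only [mpd, coordCoframe, Matrix.diagonal_mul, Matrix.of_apply, Matrix.sub_apply]
  have hc : DifferentiableAt ℝ (fun z => (√(ε a * D a (y a z)))⁻¹) x :=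
    (hd a).differentiableAt.comp x ((hy a).diffAt hU hx)
  rw [pd_mul hc ((smooth_jac hU hy a j).diffAt hU hx), pd_comp (hd a) ((hy a).diffAt hU hx)]
  simp only [jac, Matrix.of_apply]
  ring

/-- Such a metric is flat, with explicit Christoffel symbols. -/
theorem coordMetric_riemann_christoffel (hU : IsOpen U) (hy : ∀ a, ContDiffOn ℝ ∞ (y a) U)
    (hJ : ∀ x ∈ U, (jac y x).det ≠ 0) (hD : ∀ a, ContDiff ℝ ∞ (D a)) {x : Vec n}
    (hx : x ∈ nondegSet U y D) :
    (∀ i j k l, riemann (coordMetric y D) i j k l x = 0) ∧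
    ∀ k, christoffelMat (coordMetric y D) k x = (jac y x)⁻¹ * (mpd k (jac y) x -
      Matrix.diagonal (fun a => deriv (D a) (y a x) / (2 * D a (y a x)) * jac y x a k)
        * jac y x) := by
  -- Entries may be negative in a pencil. Near `x` their signs are constant, so `(εₐ Dₐ)^(-1/2) dyᵃ`
  -- is a smooth coframe with lengths `εₐ`; each form is closed since its coefficient depends on
  -- `yᵃ` only.
  set ε : Fin n → ℝ := fun a => SignType.sign (D a (y a x)) with hεdef
  have hg := isMetricOn_coordMetric hU hy hJ hD
  let W : Set (Vec n) := nondegSet U y D ∩ ⋂ a, {z | z ∈ U ∧ 0 < ε a * D a (y a z)}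
  have hεx : ∀ a, 0 < ε a * D a (y a x) := fun a => by
    rw [hεdef, sign_mul_self]; exact abs_pos.2 (hx.2 a)
  have hWo : IsOpen W := hg.isOpen.inter (isOpen_iInter_of_finite fun a =>
    (continuousOn_const.mul ((hD a).continuous.comp_continuousOn
      (hy a).continuousOn)).isOpen_inter_preimage hU isOpen_Ioi)
  have hxW : x ∈ W := ⟨hx, mem_iInter.2 fun a => ⟨hx.1, hεx a⟩⟩
  have hpos : ∀ z ∈ W, ∀ a, 0 < ε a * D a (y a z) := fun z hz a => (mem_iInter.1 hz.2 a).2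
  have hgW : IsMetricOn W (coordMetric y D) := hg.mono hWo inter_subset_left
  have hWU : W ⊆ U := fun z hz => hz.1.1
  have hMs : MSmooth W (coordCoframe y D ε) := by
    refine MSmooth.mul (fun i j => ?_) ((smooth_jac hU hy).mono hWU)
    by_cases hij : i = j
    · subst hij
      simp only [Matrix.diagonal_apply_eq]
      exact ((contDiffOn_const.mul ((hD i).comp_contDiffOn ((hy i).mono hWU))).sqrt
        fun z hz => (hpos z hz i).ne').inv fun z hz => (Real.sqrt_pos.2 (hpos z hz i)).ne'
    · simpa [Matrix.diagonal_apply_ne _ hij] using contDiffOn_const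
  have hMdet : ∀ z ∈ W, (coordCoframe y D ε z).det ≠ 0 := fun z hz => by
    rw [coordCoframe, Matrix.det_mul, Matrix.det_diagonal]
    exact mul_ne_zero (Finset.prod_ne_zero_iff.2 fun a _ =>
      inv_ne_zero (Real.sqrt_pos.2 (hpos z hz a)).ne') (hJ z (hWU hz))
  have hgM : ∀ z ∈ W, (coordMetric y D z)⁻¹
      = (coordCoframe y D ε z)ᵀ * Matrix.diagonal ε * coordCoframe y D ε z := fun z hz => by
    rw [inv_coordMetric (hJ z (hWU hz)) hz.1.2, coordCoframe, Matrix.transpose_mul,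
      Matrix.diagonal_transpose]
    have : Matrix.diagonal (fun a => (D a (y a z))⁻¹)
        = Matrix.diagonal (fun a => (√(ε a * D a (y a z)))⁻¹) * Matrix.diagonal ε *
          Matrix.diagonal (fun a => (√(ε a * D a (y a z)))⁻¹) := by
      rw [Matrix.diagonal_mul_diagonal, Matrix.diagonal_mul_diagonal]
      refine congrArg _ (funext fun a => ?_)
      have h1 := Real.mul_self_sqrt (hpos z hz a).le
      have h3 : ε a ≠ 0 := left_ne_zero_of_mul (hpos z hz a).ne'
      rw [mul_right_comm, ← mul_inv, h1, mul_inv, mul_right_comm, inv_mul_cancel₀ h3, one_mul]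
    rw [this]
    simp only [Matrix.mul_assoc]
  have hcl : ∀ z ∈ W, ∀ a i j,
      mpd i (coordCoframe y D ε) z a j = mpd j (coordCoframe y D ε) z a i := fun z hz a i j => by
    rw [mpd_coordCoframe hU hy hD (hWU hz) (hpos z hz), mpd_coordCoframe hU hy hD (hWU hz)
      (hpos z hz)]
    simp only [Matrix.diagonal_mul, Matrix.sub_apply]
    have : mpd i (jac y) z a j = mpd j (jac y) z a i := pd_comm hU (hy a) (hWU hz) i j
    rw [this]; ring
  refine ⟨riemann_of_closed_coframe hgW hMs hMdet hgM hcl hxW, fun k => ?_⟩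
  rw [christoffelMat_of_closed_coframe hgW hMs hgM hcl hxW, mpd_coordCoframe hU hy hD hx.1 hεx,
    coordCoframe, Matrix.mul_inv_rev, Matrix.mul_assoc, ← Matrix.mul_assoc _ (Matrix.diagonal _),
    Matrix.nonsing_inv_mul, one_mul]
  rw [Matrix.det_diagonal]
  exact isUnit_iff_ne_zero.2 (Finset.prod_ne_zero_iff.2 fun a _ =>
      inv_ne_zero (Real.sqrt_pos.2 (hεx a)).ne')

/-- Raising the index cancels the denominators `Dₐ` of the Christoffel symbols. The result is linear
in `D` and its derivative, which is what makes the pencil condition hold. -/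
theorem contraMat_coordMetric (hU : IsOpen U) (hy : ∀ a, ContDiffOn ℝ ∞ (y a) U)
    (hJ : ∀ x ∈ U, (jac y x).det ≠ 0) (hD : ∀ a, ContDiff ℝ ∞ (D a)) {x : Vec n}
    (hx : x ∈ nondegSet U y D) (k : Fin n) :
    contraMat (coordMetric y D) k x = (jac y x)⁻¹ *
      Matrix.diagonal (fun a => deriv (D a) (y a x) / 2 * jac y x a k) * ((jac y x)⁻¹)ᵀ
      - coordMetric y D x * (mpd k (jac y) x)ᵀ * ((jac y x)⁻¹)ᵀ := by
  have hu : IsUnit (jac y x).det := isUnit_iff_ne_zero.2 (hJ x hx.1)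
  have ht : ((jac y x)⁻¹)ᵀ * (jac y x)ᵀ = 1 := by
    rw [← Matrix.transpose_mul, Matrix.mul_nonsing_inv _ hu, Matrix.transpose_one]
  rw [(isMetricOn_coordMetric hU hy hJ hD).contraMat_eq hx,
    (coordMetric_riemann_christoffel hU hy hJ hD hx).2, Matrix.transpose_mul,
    Matrix.transpose_sub, Matrix.transpose_mul, Matrix.diagonal_transpose]
  have hd : Matrix.diagonal (fun a => deriv (D a) (y a x) / 2 * jac y x a k)
      = Matrix.diagonal (fun a => D a (y a x)) * Matrix.diagonal
        (fun a => deriv (D a) (y a x) / (2 * D a (y a x)) * jac y x a k) := by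
    rw [Matrix.diagonal_mul_diagonal]
    refine congrArg _ (funext fun a => ?_)
    have := hx.2 a
    field_simp
  have h1 : coordMetric y D x * ((jac y x)ᵀ * Matrix.diagonal
        (fun a => deriv (D a) (y a x) / (2 * D a (y a x)) * jac y x a k))
      = (jac y x)⁻¹ * Matrix.diagonal (fun a => deriv (D a) (y a x) / 2 * jac y x a k) := by
    rw [hd, coordMetric, Matrix.mul_assoc, ← Matrix.mul_assoc _ (jac y x)ᵀ, ht, one_mul,
      Matrix.mul_assoc]
  rw [← h1, Matrix.sub_mul, Matrix.mul_sub]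
  simp only [Matrix.mul_assoc]
  abel

theorem contraChristoffel_coordMetric_comb (hU : IsOpen U) (hy : ∀ a, ContDiffOn ℝ ∞ (y a) U)
    (hJ : ∀ x ∈ U, (jac y x).det ≠ 0) {D₁ D₂ : Fin n → ℝ → ℝ} (hD₁ : ∀ a, ContDiff ℝ ∞ (D₁ a))
    (hD₂ : ∀ a, ContDiff ℝ ∞ (D₂ a)) {a c : ℝ} {x : Vec n} (hx₁ : x ∈ nondegSet U y D₁)
    (hx₂ : x ∈ nondegSet U y D₂)
    (hx : x ∈ nondegSet U y fun i t => a * D₁ i t + c * D₂ i t) (i j k : Fin n) :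
    contraChristoffel (coordMetric y fun i t => a * D₁ i t + c * D₂ i t) i j k x
      = a * contraChristoffel (coordMetric y D₁) i j k x
        + c * contraChristoffel (coordMetric y D₂) i j k x := by
  have hder : ∀ i t, deriv (fun t => a * D₁ i t + c * D₂ i t) t
      = a * deriv (D₁ i) t + c * deriv (D₂ i) t := fun i t => by
    have h1 := ((hD₁ i).differentiable (by simp) t).hasDerivAt
    have h2 := ((hD₂ i).differentiable (by simp) t).hasDerivAt
    exact ((h1.const_mul a).add (h2.const_mul c)).deriv
  have hd : Matrix.diagonal (fun i => deriv (fun t => a * D₁ i t + c * D₂ i t) (y i x) / 2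
        * jac y x i k)
      = a • Matrix.diagonal (fun i => deriv (D₁ i) (y i x) / 2 * jac y x i k)
        + c • Matrix.diagonal (fun i => deriv (D₂ i) (y i x) / 2 * jac y x i k) := by
    rw [← Matrix.diagonal_smul, ← Matrix.diagonal_smul, Matrix.diagonal_add]
    refine congrArg _ (funext fun i => ?_)
    simp only [hder, Pi.smul_apply, smul_eq_mul]
    ring
  have h : contraMat (coordMetric y fun i t => a * D₁ i t + c * D₂ i t) k x
      = a • contraMat (coordMetric y D₁) k x + c • contraMat (coordMetric y D₂) k x := by
    rw [contraMat_coordMetric hU hy hJ (fun i => (contDiff_const.mul (hD₁ i)).add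
      (contDiff_const.mul (hD₂ i))) hx, contraMat_coordMetric hU hy hJ hD₁ hx₁,
      contraMat_coordMetric hU hy hJ hD₂ hx₂, coordMetric_comb, hd]
    simp only [Matrix.mul_add, Matrix.add_mul, Matrix.mul_smul, Matrix.smul_mul, smul_sub]
    abel
  exact congrFun (congrFun h i) j

end Diagonal

/-! ### Diagonal metrics as Koszul–Souriau metrics -/

section KoszulSouriau

variable {n : ℕ} {U : Set (Vec n)} {y : Fin n → Vec n → ℝ} {D : Fin n → ℝ → ℝ}

/-- A smooth map with invertible Jacobian matrix is locally injective. -/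
theorem exists_injOn_of_det_ne_zero (hU : IsOpen U) {φ : Vec n → Vec n}
    (hφ : ContDiffOn ℝ ∞ φ U) {x : Vec n} (hx : x ∈ U)
    (hdet : (Matrix.of fun a i => pd i (fun z => φ z a) x).det ≠ 0) :
    ∃ W, IsOpen W ∧ x ∈ W ∧ W ⊆ U ∧ InjOn φ W := by
  have hs : HasStrictFDerivAt φ (fderiv ℝ φ x) x :=
    (hφ.contDiffAt (hU.mem_nhds hx)).hasStrictFDerivAt (by simp)
  have hd : (fderiv ℝ φ x).det ≠ 0 := by
    have h : LinearMap.toMatrix' (fderiv ℝ φ x : Vec n →ₗ[ℝ] Vec n)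
        = Matrix.of fun a i => pd i (fun z => φ z a) x := by
      ext a i
      rw [LinearMap.toMatrix'_apply, Matrix.of_apply, pd,
        (hasFDerivAt_pi'.1 hs.hasFDerivAt a).fderiv]
      rfl
    rw [ContinuousLinearMap.det, ← LinearMap.det_toMatrix', h]
    exact hdet
  have hs' : HasStrictFDerivAt φ
      ((fderiv ℝ φ x).toContinuousLinearEquivOfDetNeZero hd : Vec n →L[ℝ] Vec n) x := by
    rwa [ContinuousLinearMap.coe_toContinuousLinearEquivOfDetNeZero]
  refine ⟨U ∩ (hs'.toOpenPartialHomeomorph φ).source,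
    hU.inter (hs'.toOpenPartialHomeomorph φ).open_source,
    ⟨hx, hs'.mem_toOpenPartialHomeomorph_source⟩, inter_subset_left, ?_⟩
  exact (hs'.toOpenPartialHomeomorph φ).injOn.mono inter_subset_right

/-- The primitive of `D^(-1/2)` that vanishes at zero. -/
theorem exists_primitive_inv_sqrt {f : ℝ → ℝ} (hf : ContDiff ℝ ∞ f) (hpos : ∀ t, 0 < f t) :
    ∃ F : ℝ → ℝ, ContDiff ℝ ∞ F ∧ ∀ t, HasDerivAt F (√(f t))⁻¹ t := by
  have hs : ContDiff ℝ ∞ fun t => (√(f t))⁻¹ :=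
    (hf.sqrt fun t => (hpos t).ne').inv fun t => (Real.sqrt_pos.2 (hpos t)).ne'
  have hF : ∀ t, HasDerivAt (fun t => ∫ s in (0 : ℝ)..t, (√(f s))⁻¹) (√(f t))⁻¹ t := fun t =>
    intervalIntegral.integral_hasDerivAt_right (hs.continuous.intervalIntegrable _ _)
      (hs.continuous.stronglyMeasurableAtFilter _ _) hs.continuous.continuousAt
  refine ⟨_, contDiff_infty_iff_deriv.2 ⟨fun t => (hF t).differentiableAt, ?_⟩, hF⟩
  rwa [show deriv _ = _ from funext fun t => (hF t).deriv]

theorem IsKSMetric.congr {h h' : Vec n → Matrix (Fin n) (Fin n) ℝ} (hh : IsKSMetric U h)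
    (heq : ∀ x ∈ U, h' x = h x) : IsKSMetric U h' := fun x hx => by
  obtain ⟨hp, W, φ, ν, hW, hxW, hWU, hφ, hinj, hyp⟩ := hh x hx
  refine ⟨heq x hx ▸ hp, W, φ, ν, hW, hxW, hWU, hφ, hinj, fun z hz => ?_⟩
  rw [heq z (hWU hz)]
  exact hyp z hz

/-- A positive metric that is diagonal in separated coordinates is locally the Koszul–Souriau
metric of the Gaussian family. -/
theorem isKSMetric_coordMetric (hU : IsOpen U) (hy : ∀ a, ContDiffOn ℝ ∞ (y a) U)
    (hJ : ∀ x ∈ U, (jac y x).det ≠ 0) (hD : ∀ a, ContDiff ℝ ∞ (D a))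
    (hpos : ∀ a t, 0 < D a t) : IsKSMetric U fun x => (coordMetric y D x)⁻¹ := by
  choose F hFs hF using fun a => exists_primitive_inv_sqrt (hD a) (hpos a)
  -- Since `dφᵃ = Dₐ^(-1/2) dyᵃ`, the metric `∑ Dₐ⁻¹ (dyᵃ)²` is Euclidean in the coordinates `φ`.
  let φ : Vec n → Vec n := fun x a => F a (y a x)
  have hφ : ContDiffOn ℝ ∞ φ U := contDiffOn_pi.2 fun a => (hFs a).comp_contDiffOn (hy a)
  have hpd : ∀ x ∈ U, ∀ a i, pd i (fun z => φ z a) x = (√(D a (y a x)))⁻¹ * jac y x a i :=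
    fun x hx a i => pd_comp (hF a _) ((hy a).diffAt hU hx) i
  have hsq : ∀ a t, 0 < √(D a t) := fun a t => Real.sqrt_pos.2 (hpos a t)
  have hdet : ∀ x ∈ U, (Matrix.of fun a i => pd i (fun z => φ z a) x).det ≠ 0 := fun x hx => by
    have h : (Matrix.of fun a i => pd i (fun z => φ z a) x)
        = Matrix.diagonal (fun a => (√(D a (y a x)))⁻¹) * jac y x := by
      ext a i
      rw [Matrix.of_apply, hpd x hx, Matrix.diagonal_mul]
    rw [h, Matrix.det_mul, Matrix.det_diagonal]
    exact mul_ne_zero (Finset.prod_ne_zero_iff.2 fun a _ => inv_ne_zero (hsq a _).ne') (hJ x hx)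
  intro x hx
  refine ⟨?_, ?_⟩
  · beta_reduce
    rw [inv_coordMetric (hJ x hx) fun a => (hpos a _).ne']
    have h := (Matrix.PosDef.diagonal (d := fun a => (D a (y a x))⁻¹)
      fun a => inv_pos.2 (hpos a _)).conjTranspose_mul_mul_same (B := jac y x)
      (Matrix.mulVec_injective_iff_isUnit.2
        ((Matrix.isUnit_iff_isUnit_det _).2 (isUnit_iff_ne_zero.2 (hJ x hx))))
    rwa [Matrix.conjTranspose_eq_transpose_of_trivial] at h
  · obtain ⟨W, hW, hxW, hWU, hinj⟩ := exists_injOn_of_det_ne_zero hU hφ hx (hdet x hx)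
    refine ⟨W, φ, stdGaussianMeasure n, hW, hxW, hWU, hφ.mono hWU, hinj, fun z hz =>
      ⟨hdet z (hWU hz), by rw [paramManifold_stdGaussian]; trivial, fun i j => ?_⟩⟩
    beta_reduce
    rw [inv_coordMetric (hJ z (hWU hz)) fun a => (hpos a _).ne', ksHessian_stdGaussian,
      Matrix.mul_assoc, Matrix.mul_apply]
    refine Finset.sum_congr rfl fun a _ => ?_
    simp only [Matrix.diagonal_mul, Matrix.transpose_apply, hpd z (hWU hz), Matrix.one_apply,
      mul_ite, mul_one, mul_zero, Finset.sum_ite_eq, Finset.mem_univ, if_true]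
    have h := Real.mul_self_sqrt (hpos a (y a z)).le
    rw [← h, mul_inv, Real.sqrt_mul_self (hsq a _).le]
    ring

end KoszulSouriau

/-! ### The flat pencil -/

section Pencil

variable {n : ℕ}

/-- The diagonal components of the second metric of the pencil. -/
def pencilFactor (i₀ : Fin n) (a : Fin n) (t : ℝ) : ℝ := if a = i₀ then Real.exp t else 1

theorem pencilFactor_pos (i₀ a : Fin n) (t : ℝ) : 0 < pencilFactor i₀ a t := by
  unfold pencilFactor; split_ifs <;> positivity

theorem contDiff_pencilFactor (i₀ a : Fin n) : ContDiff ℝ ∞ (pencilFactor i₀ a) := by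
  unfold pencilFactor
  split_ifs
  · exact Real.contDiff_exp
  · exact contDiff_const

variable {U : Set (Vec n)} {y : Fin n → Vec n → ℝ} {g₁ : Vec n → Matrix (Fin n) (Fin n) ℝ}

theorem isFlatPencil_coordMetric (hU : IsOpen U) (hy : ∀ a, ContDiffOn ℝ ∞ (y a) U)
    (hJ : ∀ x ∈ U, (jac y x).det ≠ 0) {D₁ D₂ : Fin n → ℝ → ℝ} (hD₁ : ∀ a, ContDiff ℝ ∞ (D₁ a))
    (hD₂ : ∀ a, ContDiff ℝ ∞ (D₂ a)) (h₁ : ∀ a t, D₁ a t ≠ 0) (h₂ : ∀ a t, D₂ a t ≠ 0)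
    (hg₁ : ∀ x ∈ U, g₁ x = coordMetric y D₁ x) : IsFlatPencil U g₁ (coordMetric y D₂) where
  smooth₁ := (smooth_coordMetric hU hy hJ hD₁).congr hg₁
  smooth₂ := smooth_coordMetric hU hy hJ hD₂
  symm₁ := fun x hx => hg₁ x hx ▸ coordMetric_symm x
  symm₂ := fun x _ => coordMetric_symm x
  nondeg₁ := fun x hx => by
    rw [hg₁ x hx]; exact (det_coordMetric_ne_zero_iff (hJ x hx)).2 fun a => h₁ a _
  nondeg₂ := fun x hx => (det_coordMetric_ne_zero_iff (hJ x hx)).2 fun a => h₂ a _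
  flat := fun a c x hx hdet i j k l => by
    have heq : ∀ z ∈ U, a • g₁ z + c • coordMetric y D₂ z
        = coordMetric y (fun i t => a * D₁ i t + c * D₂ i t) z := fun z hz => by
      rw [hg₁ z hz, coordMetric_comb]
    rw [heq x hx, det_coordMetric_ne_zero_iff (hJ x hx)] at hdet
    rw [riemann_congr_on hU heq hx]
    exact (coordMetric_riemann_christoffel hU hy hJ (fun i => (contDiff_const.mul (hD₁ i)).add
      (contDiff_const.mul (hD₂ i))) ⟨hx, hdet⟩).1 i j k l
  linear := fun a c x hx hdet i j k => by
    have heq : ∀ z ∈ U, a • g₁ z + c • coordMetric y D₂ z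
        = coordMetric y (fun i t => a * D₁ i t + c * D₂ i t) z := fun z hz => by
      rw [hg₁ z hz, coordMetric_comb]
    rw [heq x hx, det_coordMetric_ne_zero_iff (hJ x hx)] at hdet
    rw [contraChristoffel_congr_on hU heq hx, contraChristoffel_congr_on hU hg₁ hx]
    exact contraChristoffel_coordMetric_comb hU hy hJ hD₁ hD₂ ⟨hx, fun a => h₁ a _⟩
      ⟨hx, fun a => h₂ a _⟩ ⟨hx, hdet⟩ i j k

/-- The connections differ by a term in which the logarithmic derivative of `exp`, equal to one,
multiplies the differential of `y i₀`. If they agreed at a point, that row of the Jacobian matrix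
would vanish there. -/
theorem exists_christoffel_ne (hU : IsOpen U) (hy : ∀ a, ContDiffOn ℝ ∞ (y a) U)
    (hJ : ∀ x ∈ U, (jac y x).det ≠ 0) (i₀ : Fin n)
    (hg₁ : ∀ x ∈ U, g₁ x = coordMetric y (fun _ _ => 1) x) {x : Vec n} (hx : x ∈ U) :
    ∃ i j k, christoffel g₁ i j k x ≠ christoffel (coordMetric y (pencilFactor i₀)) i j k x := by
  by_contra! hcon
  have hu : IsUnit (jac y x).det := isUnit_iff_ne_zero.2 (hJ x hx)
  refine hJ x hx (Matrix.det_eq_zero_of_row_eq_zero i₀ fun k => ?_)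
  have h : christoffelMat (coordMetric y fun _ _ => 1) k x
      = christoffelMat (coordMetric y (pencilFactor i₀)) k x := by
    ext i j
    simp only [christoffelMat, Matrix.of_apply]
    rw [← hcon, christoffel_congr_on hU hg₁ hx]
  rw [(coordMetric_riemann_christoffel hU hy hJ (fun _ => contDiff_const)
      ⟨hx, fun _ => one_ne_zero⟩).2,
    (coordMetric_riemann_christoffel hU hy hJ (contDiff_pencilFactor i₀)
      ⟨hx, fun a => (pencilFactor_pos i₀ a _).ne'⟩).2] at h
  have h' := congrArg (fun A => jac y x * A * (jac y x)⁻¹) h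
  simp only [← Matrix.mul_assoc, Matrix.mul_nonsing_inv _ hu, one_mul, Matrix.sub_mul,
    Matrix.mul_nonsing_inv_cancel_right _ _ hu] at h'
  have h0 := congrFun (congrFun (sub_right_injective h') i₀) i₀
  have hexp : deriv (pencilFactor i₀ i₀) = Real.exp := by
    rw [show pencilFactor i₀ i₀ = Real.exp from funext fun t => if_pos rfl, Real.deriv_exp]
  simp only [Matrix.diagonal_apply_eq, deriv_const, zero_div, zero_mul, hexp] at h0
  simpa [pencilFactor, (Real.exp_pos _).ne'] using h0.symm

end Pencil

end

/-! ### The main theorem -/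

theorem mainTheorem5 {n : ℕ} (hn : 0 < n) {Ω : Type*} [MeasurableSpace Ω]
    (ν : Measure Ω) (X : Ω → Vec n) (hM : IsInfoFrobenius ν X) :
    (∃ g₂ : Vec n → Matrix (Fin n) (Fin n) ℝ,
      IsFlatPencil (paramManifold ν X) (fun β => (ksHessian ν X β)⁻¹) g₂ ∧
      (∀ a c : ℝ, 0 ≤ a → 0 ≤ c → 0 < a + c →
        IsKSMetric (paramManifold ν X) (fun β => (a • (ksHessian ν X β)⁻¹ + c • g₂ β)⁻¹)) ∧
      (∃ β ∈ paramManifold ν X, ∃ i j k,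
        christoffel (fun β' => (ksHessian ν X β')⁻¹) i j k β ≠ christoffel g₂ i j k β) ∧
      HydroBracket.Compatible (paramManifold ν X)
        (HydroBracket.ofMetric fun β => (ksHessian ν X β)⁻¹) (HydroBracket.ofMetric g₂)) ∧
    (∀ P Q : HydroBracket n,
      P.IsRegular (paramManifold ν X) → Q.IsRegular (paramManifold ν X) →
      (HydroBracket.Compatible (paramManifold ν X) P Q ↔
        IsFlatPencil (paramManifold ν X) P.g Q.g ∧
        ∀ β ∈ paramManifold ν X, ∀ i j k,
          P.b i j k β = contraChristoffel P.g i j k β ∧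
          Q.b i j k β = contraChristoffel Q.g i j k β)) := by
  obtain ⟨y, hy, hG⟩ := hM.exists_coordinates hn
  have hU : IsOpen (paramManifold ν X) := isOpen_paramManifold
  have hJ : ∀ x ∈ paramManifold ν X, (jac y x).det ≠ 0 := fun x hx h => by
    have hp := (hM.posDef x hx).det_pos
    rw [hG x hx, Matrix.det_mul, h, mul_zero] at hp
    exact lt_irrefl _ hp
  let i₀ : Fin n := ⟨0, hn⟩
  -- In the flat coordinates the first metric has all diagonal factors equal to one, so a
  -- combination has the factors `a + c Dₐ`, positive in the stated range of `a` and `c`.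
  have hg₁ : ∀ x ∈ paramManifold ν X,
      (ksHessian ν X x)⁻¹ = coordMetric y (fun _ _ => 1) x := fun x hx => by
    rw [hG x hx, Matrix.mul_inv_rev, coordMetric, Matrix.diagonal_one, mul_one,
      Matrix.transpose_nonsing_inv]
  have hpencil := isFlatPencil_coordMetric hU hy hJ (fun _ => contDiff_const)
    (contDiff_pencilFactor i₀) (fun _ _ => one_ne_zero)
    (fun a t => (pencilFactor_pos i₀ a t).ne') hg₁
  refine ⟨⟨coordMetric y (pencilFactor i₀), hpencil, fun a c ha hc hac => ?_, ?_, ?_⟩,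
    fun P Q hP hQ => HydroBracket.compatible_iff hU hP hQ⟩
  · refine (isKSMetric_coordMetric hU hy hJ (D := fun i t => a * 1 + c * pencilFactor i₀ i t)
      (fun i => contDiff_const.add (contDiff_const.mul (contDiff_pencilFactor i₀ i)))
      fun i t => ?_).congr fun x hx => ?_
    · rcases ha.eq_or_lt with rfl | ha
      · have : 0 < c := by simpa using hac
        have := mul_pos this (pencilFactor_pos i₀ i t)
        linarith
      · have := mul_nonneg hc (pencilFactor_pos i₀ i t).le
        linarith
    · rw [hg₁ x hx, coordMetric_comb a c fun _ _ => 1]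
  · obtain ⟨x, hx⟩ := hM.nonempty
    exact ⟨x, hx, exists_christoffel_ne hU hy hJ i₀ hg₁ hx⟩
  · have hm₁ : IsMetricOn (paramManifold ν X) fun x => (ksHessian ν X x)⁻¹ :=
      ⟨hU, hpencil.smooth₁, hpencil.symm₁, hpencil.nondeg₁⟩
    have hm₂ : IsMetricOn (paramManifold ν X) (coordMetric y (pencilFactor i₀)) :=
      ⟨hU, hpencil.smooth₂, hpencil.symm₂, hpencil.nondeg₂⟩
    have hr₁ : (HydroBracket.ofMetric fun x => (ksHessian ν X x)⁻¹).IsRegular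
        (paramManifold ν X) := ⟨hm₁.smooth, hm₁.smooth_contraChristoffel, hm₁.nondeg⟩
    have hr₂ : (HydroBracket.ofMetric (coordMetric y (pencilFactor i₀))).IsRegular
        (paramManifold ν X) := ⟨hm₂.smooth, hm₂.smooth_contraChristoffel, hm₂.nondeg⟩
    exact (HydroBracket.compatible_iff hU hr₁ hr₂).2 ⟨hpencil, fun x _ i j k => ⟨rfl, rfl⟩⟩
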